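/- For a cyclic ordering $(a_1,\dots,a_{18})$ of the nonzero elements of $\mathbb Z_{19}$, consider the map (cellular embedding of a graph in a closed oriented surface) with vertex set $\mathbb Z_{19}$, whose darts are the pairs $(i,a)$ with $i\in\mathbb Z_{19}$ and $a\neq 0$, going from $i$ to $i+a$, where the opposite of $(i,a)$ is $(i+a,-a)$ and the rotation around $i$ is $(i,a_1),(i,a_2),\dots,(i,a_{18})$. It is the covering, given by voltages in $\mathbb Z_{19}$, of a one-vertex map of genus $2$. Let $A$, $B$, $C$ be the maps obtained from the orderings * $A$: $(1,6,8,12,9,5,18,2,13,14,4,11,17,16,7,15,10,3)$; the faces of the one-vertex map are $(1,2,16),(3,7,9),(4,10,5),(6,14,18),(8,17,13),(11,12,15)$; * $B$: $(1,11,6,15,12,17,16,4,10,18,2,14,8,9,13,5,7,3)$; faces $(1,2,16),(3,4,12),(5,8,6),(7,17,14),(9,18,11),(10,13,15)$; * $C$: $(1,8,14,17,7,18,3,5,13,9,2,16,15,6,11,12,10,4)$; faces $(1,3,15),(2,7,10),(4,6,9),(5,17,16),(8,12,18),(11,14,13)$. (These are the three triangular embeddings of $K_{19}$ of Lawrencenko,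 Negami and White; $A$ is the Ringel–Youngs embedding and $B$ the Gross–Tucker embedding.) A cycle of the graph of a map on a surface of genus $g$ (a closed walk without repeated vertex) is *splitting* if it cuts the surface into two components, neither of which is a disk; it has *type* $k$ if these components have genus $k$ and $g-k$ (so, up to exchanging $k$ and $g-k$, the possible types are $1\le k\le g/2$). A *triangulation* is a map whose graph is simple and whose faces all have three sides, other than the 3-cycle in the sphere. The *face-width* of a map is the least number of intersections of its graph with a non-contractible closed curve on the surface. Then: 1. Each of $A$, $B$, $C$ is a triangulation of a connected closed orientable surface of genus $20$ by the complete graph $K_{19}$. Every splitting cycle of it has one of the types $1,2,3,4$; each of these four types occurs; and it has no splitting cycle of type $k$ for any $5\le k\le 10$. 2. The minimum lengths of the splitting cycles of types $1,2,3,4$ are respectively $11,14,16,18$ in $A$; $10,14,18,19$ in $B$; $11,15,17,18$ in $C$. 3. Consequently the conjecture of Mohar and Thomassen (every triangulation of an orientable surface of genus at least $2$ has splitting cycles of every possible type) is false, and so is the conjecture of Zha and Zhao (every map of genus at least $2$ and face-width at least $3$ has splitting cycles of every possible type), even when the latter is restricted to orientable maps. -/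

import Mathlib

/-- A rotation system on a type `D` of darts (directed edges): the combinatorial encoding of a
cellular embedding of a graph in a closed oriented surface.  `rev d` is the dart opposite to `d`
and `rot d` is the dart that follows `d` in clockwise order around the origin of `d`. -/
structure RotationSystem (D : Type) where
  rot : Equiv.Perm D
  rev : Equiv.Perm D
  rev_rev : ∀ d, rev (rev d) = d
  rev_ne : ∀ d, rev d ≠ d

namespace RotationSystem

variable {D : Type} (M : RotationSystem D)

/-- The dart that follows `d` along the boundary of the face to the left of `d`. -/
def face : Equiv.Perm D := M.rot * M.rev

/-- Vertices are the orbits of `rot`, edges those of `rev`, faces those of `face`. -/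
def Vertex : Type := Quotient (Equiv.Perm.SameCycle.setoid M.rot)

def Edge : Type := Quotient (Equiv.Perm.SameCycle.setoid M.rev)

def Face : Type := Quotient (Equiv.Perm.SameCycle.setoid M.face)

/-- The vertex from which a dart starts. -/
def origin (d : D) : M.Vertex := Quotient.mk _ d

/-- The vertex at which a dart ends. -/
def target (d : D) : M.Vertex := M.origin (M.rev d)

/-- The edge that carries a dart. -/
def edge (d : D) : M.Edge := Quotient.mk _ d

/-- The face to the left of a dart. -/
def leftFace (d : D) : M.Face := Quotient.mk _ d

/-- The embedded graph is nonempty and connected (equivalently, so is the surface). -/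
def IsConnected : Prop :=
  Nonempty D ∧
    MulAction.IsPretransitive (Subgroup.closure ({M.rot, M.rev} : Set (Equiv.Perm D))) D

/-- The Euler characteristic `V - E + F`. -/
noncomputable def eulerChar : ℤ :=
  (Nat.card M.Vertex : ℤ) - Nat.card M.Edge + Nat.card M.Face

/-- The surface has genus `g`, that is, Euler characteristic `2 - 2g`. -/
def HasGenus (g : ℕ) : Prop := M.eulerChar = 2 - 2 * (g : ℤ)

/-- The graph is simple, every face has three sides, and the map is not the embedding of a
3-cycle in the sphere (the only one with these properties that has fewer than four vertices). -/
def IsTriangulation : Prop :=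
  (∀ d, M.origin d ≠ M.target d) ∧
  (∀ d e, M.origin d = M.origin e → M.target d = M.target e → d = e) ∧
  (∀ d, Function.minimalPeriod M.face d = 3) ∧
  4 ≤ Nat.card M.Vertex

/-- There are `n` vertices, any two of them adjacent; for a map with a simple graph, this says
that the graph is the complete graph `K_n`. -/
def IsCompleteOn (n : ℕ) : Prop :=
  Nat.card M.Vertex = n ∧
    ∀ v w : M.Vertex, v ≠ w → ∃ d, M.origin d = v ∧ M.target d = w

/-! ### Cycles of the graph, and cutting the surface along a cycle -/

/-- A directed cycle of the graph: a closed walk without repeated vertex and without repeated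
edge (the latter only excludes going back and forth along one edge). -/
structure Cycle where
  length : ℕ
  length_pos : 0 < length
  dart : Fin length → D
  closed : ∀ i, M.target (dart i) = M.origin (dart (finRotate length i))
  vertex_injective : Function.Injective fun i => M.origin (dart i)
  edge_injective : Function.Injective fun i => M.edge (dart i)

namespace Cycle

variable {M} (γ : M.Cycle)

/-- The edges of the cycle. -/
def edges : Set M.Edge := Set.range fun i => M.edge (γ.dart i)

/-- Darts are used to label the faces to their left.  Two darts label the same component of the
surface cut along `γ` if one passes from the one to the other by moving along the boundary of a
face and by crossing edges that do not belong to `γ`. -/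
def cutSetoid : Setoid D :=
  Relation.EqvGen.setoid fun d e =>
    e = M.face d ∨ (M.edge d ∉ γ.edges ∧ e = M.rev d)

/-- The components of the surface cut along `γ`. -/
def Component : Type := Quotient γ.cutSetoid

/-- The darts that have a given component on their left. -/
def dartsOf (C : γ.Component) : Set D := {d | (Quotient.mk γ.cutSetoid d) = C}

/-- The Euler characteristic of a component, with its boundary included. -/
noncomputable def componentEulerChar (C : γ.Component) : ℤ :=
  ((M.origin '' γ.dartsOf C).ncard : ℤ) - (M.edge '' γ.dartsOf C).ncard
    + (M.leftFace '' γ.dartsOf C).ncard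

/-- If `γ` is separating, a component is a compact oriented surface bounded by one circle; it has
genus `h` if its Euler characteristic is `1 - 2h`, and it is a disk if and only if `h = 0`. -/
def ComponentHasGenus (C : γ.Component) (h : ℕ) : Prop :=
  γ.componentEulerChar C = 1 - 2 * (h : ℤ)

/-- `γ` cuts the surface into the two components `C₁` and `C₂`. -/
def CutsInto (C₁ C₂ : γ.Component) : Prop := C₁ ≠ C₂ ∧ ∀ C, C = C₁ ∨ C = C₂

/-- `γ` cuts the surface into two components, neither of which is a disk. -/
def IsSplitting : Prop :=
  ∃ C₁ C₂ : γ.Component, γ.CutsInto C₁ C₂ ∧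
    ¬ γ.ComponentHasGenus C₁ 0 ∧ ¬ γ.ComponentHasGenus C₂ 0

/-- `γ` is a splitting cycle that cuts the surface, of genus `g`, into two components of
respective genus `k` and `g - k`. -/
def IsSplittingOfType (k : ℕ) : Prop :=
  γ.IsSplitting ∧ ∃ (g : ℕ) (C₁ C₂ : γ.Component), M.HasGenus g ∧ k ≤ g ∧ γ.CutsInto C₁ C₂ ∧
    γ.ComponentHasGenus C₁ k ∧ γ.ComponentHasGenus C₂ (g - k)

end Cycle

/-! ### Homotopy and face-width -/

/-- Consecutive darts of the list are composable. -/
def IsWalk (w : List D) : Prop := w.IsChain fun d e => M.target d = M.origin e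

/-- The walk of `m` steps along the boundary of the face to the left of `d`, starting with `d`. -/
def faceWalk (d : D) (m : ℕ) : List D := (List.range m).map fun i => (M.face)^[i] d

/-- Elementary homotopies of walks: removal of a spur, removal of the full boundary of a face. -/
inductive Move : List D → List D → Prop
  | spur (u v : List D) (d : D) (h : M.IsWalk (u ++ [d, M.rev d] ++ v)) :
      Move (u ++ [d, M.rev d] ++ v) (u ++ v)
  | face (u v : List D) (d : D)
      (h : M.IsWalk (u ++ M.faceWalk d (Function.minimalPeriod M.face d) ++ v)) :
      Move (u ++ M.faceWalk d (Function.minimalPeriod M.face d) ++ v) (u ++ v)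

/-- The closed walk `w` is contractible in the surface. -/
def IsContractible (w : List D) : Prop := Relation.EqvGen M.Move w []

/-- Every closed curve on the surface that meets the graph in fewer than `w` points is
contractible.  Up to homotopy, and without more intersections, such a curve meets the graph in
vertices only.  It is then a cyclic sequence of passages through faces: the `i`-th one starts in
the corner, at the origin of `d i`, of the face to the left of `d i`, ends in the corner of this
face reached from there in `m i` steps along its boundary, and is homotopic to these steps. -/
def FaceWidthAtLeast (w : ℕ) : Prop :=
  ∀ n < w, ∀ (d : Fin n → D) (m : Fin n → ℕ),
    (∀ i, M.origin ((M.face)^[m i] (d i)) = M.origin (d (finRotate n i))) →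
      M.IsContractible (List.ofFn fun i => M.faceWalk (d i) (m i)).flatten

/-! ### Coverings given by voltages -/

/-- The covering of a base map defined by a voltage assignment in a group `G`, opposite darts
having opposite voltages: the dart `(x, d)` covers `d` and goes from the sheet `x` to the sheet
`x + volt d`. -/
def covering {G : Type} [AddGroup G] (volt : D → G) (h : ∀ d, volt (M.rev d) = - volt d) :
    RotationSystem (G × D) where
  rot := (Equiv.refl G).prodCongr M.rot
  rev :=
    { toFun := fun p => (p.1 + volt p.2, M.rev p.2)
      invFun := fun p => (p.1 + volt p.2, M.rev p.2)
      left_inv := fun p => by simp [h, M.rev_rev]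
      right_inv := fun p => by simp [h, M.rev_rev] }
  rev_rev := fun p => by simp [h, M.rev_rev]
  rev_ne := fun p hp => M.rev_ne p.2 (congrArg Prod.snd hp)

end RotationSystem

/-- Darts of the base maps, identified with their voltages. -/
abbrev Arc : Type := {a : ZMod 19 // a ≠ 0}

/-- The map with a single vertex whose darts are the nonzero elements of `ℤ/19`, with `-a`
opposite to `a`, and whose rotation at the vertex is the cyclic order given by a list. -/
def oneVertexMap (l : List (ZMod 19)) (h : (0 : ZMod 19) ∉ l) :
    RotationSystem Arc where
  rot := l.formPerm.subtypePerm fun x => by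
    have h0 : l.formPerm 0 = 0 := List.formPerm_apply_of_notMem h
    exact not_congr ⟨fun hx => l.formPerm.injective (hx.trans h0.symm), fun hx => hx ▸ h0⟩
  rev := (Equiv.neg (ZMod 19)).subtypePerm (p := fun a => a ≠ 0) fun _ => neg_ne_zero
  rev_rev := fun d => Subtype.ext (neg_neg d.1)
  rev_ne := fun d hd => by
    have key : ∀ a : ZMod 19, -a = a → a = 0 := by decide
    exact d.2 (key d.1 (congrArg Subtype.val hd))

/-- The covering by voltages of such a map: a dart `(i, a)` goes from the vertex labelled `i` to
the one labelled `i + a`, and is followed around `i` by `(i, b)` where `b` follows `a` in `l`. -/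
def cyclicEmbedding (l : List (ZMod 19)) (h : (0 : ZMod 19) ∉ l) :
    RotationSystem (ZMod 19 × Arc) :=
  (oneVertexMap l h).covering Subtype.val fun _ => rfl

/-- Embedding A; the faces of the base map are
`(1,2,16) (3,7,9) (4,10,5) (6,14,18) (8,17,13) (11,12,15)`. -/
def embeddingA : RotationSystem (ZMod 19 × Arc) :=
  cyclicEmbedding [1, 6, 8, 12, 9, 5, 18, 2, 13, 14, 4, 11, 17, 16, 7, 15, 10, 3] (by decide)

/-- Embedding B; the faces of the base map are
`(1,2,16) (3,4,12) (5,8,6) (7,17,14) (9,18,11) (10,13,15)`. -/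
def embeddingB : RotationSystem (ZMod 19 × Arc) :=
  cyclicEmbedding [1, 11, 6, 15, 12, 17, 16, 4, 10, 18, 2, 14, 8, 9, 13, 5, 7, 3] (by decide)

/-- Embedding C; the faces of the base map are
`(1,3,15) (2,7,10) (4,6,9) (5,17,16) (8,12,18) (11,14,13)`. -/
def embeddingC : RotationSystem (ZMod 19 × Arc) :=
  cyclicEmbedding [1, 8, 14, 17, 7, 18, 3, 5, 13, 9, 2, 16, 15, 6, 11, 12, 10, 4] (by decide)

/-- The conjecture of Mohar and Thomassen: every triangulation of an orientable surface of genus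
at least 2 has a splitting cycle of every possible type. -/
def MoharThomassenConjecture : Prop :=
  ∀ (D : Type) [Finite D] (M : RotationSystem D), M.IsConnected → M.IsTriangulation →
    ∀ g : ℕ, 2 ≤ g → M.HasGenus g →
      ∀ k : ℕ, 1 ≤ k → 2 * k ≤ g → ∃ γ : M.Cycle, γ.IsSplittingOfType k

/-- The conjecture of Zha and Zhao, restricted to orientable maps: every orientable map of genus
at least 2 and face-width at least 3 has splitting cycles of every possible type. -/
def ZhaZhaoConjecture : Prop :=
  ∀ (D : Type) [Finite D] (M : RotationSystem D), M.IsConnected → M.FaceWidthAtLeast 3 →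
    ∀ g : ℕ, 2 ≤ g → M.HasGenus g →
      ∀ k : ℕ, 1 ≤ k → 2 * k ≤ g → ∃ γ : M.Cycle, γ.IsSplittingOfType k

/-!
Let `γ` be a cycle of length `l` that separates a triangulation `M` of the surface of genus 20 by
`K₁₉`. Two vertices off `γ` are adjacent, so all of them are on the same side of `γ`
(`RotationSystem.Cycle.componentOf_off_off`); the other side `T` has no vertex but the `l` vertices of
`γ`. Run through `γ` with `T` on the left. Around its `i`-th vertex, `T` then takes up the `w i` darts
that follow the one at which `γ` comes, up to the one along which `γ` leaves. If `n` is the sum of all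
`w i`, then `T` has `n / 3` faces and `(n + l) / 2` edges, hence `n = 3 * l - 6 + 12 * h` where `h` is
the genus of `T`. That this `h` is an integer comes down to the number of edges being odd: shrinking
the boundary of `T` to a point at which all its vertices are merged gives a rotation that is a single
cycle on the darts of `T`, and it is the product of the involution `rev` with a permutation all of
whose cycles have length 3, so that comparing signs gives the parity (`LeftSide.odd_card_edges`).

It remains to know which pairs `(l, n)` occur. What is left of `γ` is a purely combinatorial object, a
cyclic sequence of vertices with consistent left sides (`LeftCut`). For each of the three embeddings an
exhaustive search, evaluated by the kernel, shows that no `LeftCut` has one of the pairs to be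
excluded, that is, `h` not in `0, …, 4, 16, …, 20` or a length below the claimed minimum
(`excluded_eq_falseA` and its analogues). The search extends a path at both ends. It keeps, for every
vertex, the set of its possible states (off the cycle, or a pair of the darts at which the cycle comes
and leaves) as the bits of one natural number, so that one bitwise conjunction with a precomputed mask
draws all consequences of a further step. The embedding has a vertex-transitive symmetry, so a path may
start at the vertex `0`; moreover it may start where the partial sums of `w i` minus its mean are
minimal, so that all forward averages of `w` are at least the mean and all backward averages at most
the mean (`exists_forward_high_backward_low`); several searches, each for a narrow range of means, make
the most of this. Cycles through all 19 vertices can be run backwards, which exchanges the sides, so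
that for them `n ≤ 171` may be assumed.

Conversely, explicit cycles realize the types 1 to 4 with the claimed lengths
(`IsCyclicTriangulation.exists_isSplittingOfType`). Both conjectures fail for the type 5 in embedding
A. For that of Zha and Zhao, the face-width is at least 3 because a closed curve through two vertices
runs through two faces that share these vertices; in a simple triangulation this makes it homotopic
to a spur or to a product of triangle boundaries (`IsCyclicTriangulation.faceWidthAtLeast_three`).
-/

/-! ### A search that the kernel can evaluate -/

-- The definitions of the search are written with recursors, raw literals and those functions on the
-- natural numbers for which the kernel has built-in arithmetic, so that evaluating them by definitional
-- unfolding is fast. Functions of the form `(fun x => …) t` make the kernel share the term `t`.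

/-- Entry `i` of a list, `z` beyond its end. -/
def nthD {α : Type} (z : α) (l : List α) : ℕ → α :=
  List.rec (motive := fun _ => ℕ → α) (fun _ => z) (fun a _ ih i => Nat.rec a (fun j _ => ih j) i) l

/-- The list of the first `n` values of a function. -/
def tabulate {α : Type} (f : ℕ → α) (n : ℕ) : List α :=
  Nat.rec (motive := fun _ => ℕ → List α) (fun _ => [])
    (fun _ ih i => f i :: ih (Nat.succ i)) n (nat_lit 0)

/-- Concatenation of the binary words `f 0, …, f (n - 1)` of `w` bits each, least significant
first. -/
def pack (w : ℕ) (f : ℕ → ℕ) (n : ℕ) : ℕ :=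
  Nat.rec (nat_lit 0) (fun i acc => Nat.lor acc (Nat.shiftLeft (f i) (Nat.mul w i))) n

/-- `if b then t else e`, in a form that unfolds to a recursor in one step. -/
def select {α : Type} (b : Bool) (t e : α) : α := Bool.rec e t b

/-- Difference of two positions on the cycle of the 18 darts around a vertex. -/
def sub18 (a b : ℕ) : ℕ := Nat.mod (Nat.sub (Nat.add a (nat_lit 18)) b) (nat_lit 18)

/-- The local states of a vertex at which the cycle enters at position `a` and leaves at position
`a + w`, as a set of bits: bit `18 * a + w` and bit `324 + 18 * (a + w) + w`, the sum `a + w` being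
taken modulo 18, are set if the state satisfies `p a w`. -/
def stateSet (p : ℕ → ℕ → Bool) : ℕ :=
  pack (nat_lit 18) (fun c => pack (nat_lit 1) (fun w =>
    Bool.rec (Bool.rec (nat_lit 0) (nat_lit 1)
      (p (Bool.rec (sub18 c w) c (Nat.blt c (nat_lit 18))) w)) (nat_lit 0)
      (Nat.beq w (nat_lit 0))) (nat_lit 18)) (nat_lit 36)

/-- The states of a vertex for which the dart at position `q` is where the cycle comes from. -/
def enterAt (q : ℕ) : ℕ := stateSet fun a _ => Nat.beq a q

/-- The states of a vertex for which the cycle leaves along the dart at position `q`. -/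
def leaveAt (q : ℕ) : ℕ := stateSet fun a w => Nat.beq (sub18 q a) w

/-- The states of a vertex for which the dart at position `q` is to the left of the cycle. -/
def leftAt (q : ℕ) : ℕ :=
  stateSet fun a w => Bool.rec (Nat.blt (sub18 q a) w) false (Nat.beq a q)

/-- The states of a vertex for which the dart at position `q` is to the right of the cycle; bit 0
stands for a vertex that is not on the cycle. -/
def rightAt (q : ℕ) : ℕ :=
  Nat.lor (nat_lit 1) (stateSet fun a w => Nat.blt w (sub18 q a))

/-- All states of a vertex on the cycle. -/
def anyState : ℕ := stateSet fun _ _ => true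

/-- The states that each vertex may have when the vertex `0` has the state `(a, w)`: bits
`666 * x, …, 666 * x + 665` are those of vertex `x`.  The arguments `rE`, `rN`, `rL`, `rR` are the
tables of `enterAt`, `leaveAt`, `leftAt`, `rightAt`, and `pos` is the table of positions of labels. -/
def mask (rE rN rL rR : List ℕ) (pos : List ℕ) (a w : ℕ) : ℕ :=
  pack (nat_lit 666) (fun x => Bool.rec
    ((fun d q => Bool.rec (Bool.rec (Bool.rec (nthD (nat_lit 0) rR q) (nthD (nat_lit 0) rL q)
        (Nat.blt d w)) (nthD (nat_lit 0) rE q) (Nat.beq d w)) (nthD (nat_lit 0) rN q)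
        (Nat.beq d (nat_lit 0)))
      (sub18 (nthD (nat_lit 0) pos x) a) (nthD (nat_lit 0) pos (Nat.sub (nat_lit 19) x)))
    anyState (Nat.beq x (nat_lit 0))) (nat_lit 19)

/-- Two copies of a mask side by side, of which the masks of all vertices are shifts. -/
def twice (m : ℕ) : ℕ := Nat.lor m (Nat.shiftLeft m (nat_lit 12654))

/-- The masks indexed by the position at which the cycle enters. -/
def maskTable (pos : List ℕ) : List (List ℕ) :=
  (fun rE rN rL rR => tabulate (fun a => tabulate (fun w => twice (mask rE rN rL rR pos a w))
      (nat_lit 18)) (nat_lit 18))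
    (tabulate enterAt (nat_lit 18)) (tabulate leaveAt (nat_lit 18)) (tabulate leftAt (nat_lit 18))
    (tabulate rightAt (nat_lit 18))

/-- The same masks indexed by the position at which the cycle leaves. -/
def maskTableBack (ms : List (List ℕ)) : List (List ℕ) :=
  tabulate (fun b => tabulate (fun w => nthD (nat_lit 0) (nthD [] ms (sub18 b w)) w) (nat_lit 18))
    (nat_lit 18)

/-- The dart at position `p` around `x` goes to a vertex `y`, where the position of the opposite
dart is `q`; the entry of 18 bits that starts at bit `666 * x + 18 * p` is `666 * y + 18 * q`. -/
def neighborTable (rot pos : List ℕ) : ℕ :=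
  pack (nat_lit 18) (fun i => (fun x b => Nat.mul (nat_lit 18) (Nat.add (Nat.mul (nat_lit 37)
      (Nat.mod (Nat.add x b) (nat_lit 19))) (nthD (nat_lit 0) pos (Nat.sub (nat_lit 19) b))))
    (Nat.div i (nat_lit 37))
    (nthD (nat_lit 0) rot (Nat.mod (Nat.mod i (nat_lit 37)) (nat_lit 18)))) (nat_lit 703)

/-- The data of a search: the tables, the upper bound `maxLen` for the length of the cycle, bounds
`loNum / loDen` and `hiNum / hiDen` for the average of `w` over the cycle, and the pairs of a length
and a sum of all `w` that are to be excluded. -/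
structure SearchTask where
  nbr : ℕ
  masks : List (List ℕ)
  masksBack : List (List ℕ)
  maxLen : ℕ
  loNum : ℕ
  loDen : ℕ
  hiNum : ℕ
  hiDen : ℕ
  bad : ℕ → ℕ → Bool

/-- Rows of 666 bits with bits 0 to 647 set. -/
def rowOnes : ℕ := pack 666 (fun _ => 2 ^ 648 - 1) 19

/-- Rows of 666 bits with bit 648 set. -/
def rowGuards : ℕ := pack 666 (fun _ => 2 ^ 648) 19

/-- Rows of 666 bits with bit 0 set. -/
def rowUnits : ℕ := pack 666 (fun _ => 1) 19

/-- No vertex has run out of states: adding `2 ^ 648 - 1` to a row carries into bit 648 if and only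
if the row is not zero. -/
def nonemptyRows (dom : ℕ) : Bool :=
  Nat.beq (Nat.land (Nat.add dom rowOnes) rowGuards) rowGuards

/-- The base of the rows of 666 bits, minus one. -/
def rowModulus : ℕ := 2 ^ 666 - 1

/-- The number of vertices that may be off the cycle: the sum of the digits in base `2 ^ 666` of a
number whose digits are 0 or 1 is its remainder modulo `2 ^ 666 - 1`. -/
def offCount (dom : ℕ) : ℕ := Nat.mod (Nat.land dom rowUnits) rowModulus

/-- The row, that is, the vertex, to which a bit of a domain belongs. -/
def row (o : ℕ) : ℕ := Nat.div o (nat_lit 666)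

/-- The number of the block of 18 bits to which a bit of a domain belongs within its row. -/
def col (o : ℕ) : ℕ := Nat.div (Nat.mod o (nat_lit 666)) (nat_lit 18)

/-- The mask for a path vertex `0`, given in two copies side by side, cyclically shifted by `r` rows: the
mask for a path vertex `r`. Only the lowest 19 rows matter. -/
def rotateMask (m r : ℕ) : ℕ :=
  Nat.shiftRight m (Nat.sub (nat_lit 12654) (Nat.mul (nat_lit 666) r))

/-- The 18 bits from bit `o` on. -/
def slice (dom o : ℕ) : ℕ := Nat.land (Nat.shiftRight dom o) (nat_lit 262143)

/-- `p` holds for all elements of a set of natural numbers below `fuel`, given by its bits. -/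
def allBits (p : ℕ → Bool) (fuel : ℕ) : ℕ → Bool :=
  Nat.rec (fun _ => true) (fun _ ih s => Bool.rec
    (Bool.rec false (ih (Nat.sub s (Nat.shiftLeft (nat_lit 1) (Nat.log2 s)))) (p (Nat.log2 s)))
    true (Nat.beq s (nat_lit 0))) fuel

/-- The factor that makes five copies of a number below `2 ^ 18`. -/
def spread : ℕ := 2 ^ 72 + 2 ^ 54 + 2 ^ 36 + 2 ^ 18 + 1

/-- Every fifth bit: in five copies of 18 bits, these are the bits of one copy in another order, as 5 is
prime to 18. -/
def spreadMask : ℕ := pack 5 (fun _ => 1) 18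

/-- The number of bits of a number below `2 ^ 18`.  It only serves to choose the end of the path at
which to branch, and no property of it is used. -/
def bitCount (s : ℕ) : ℕ := Nat.mod (Nat.land (Nat.mul s spread) spreadMask) (nat_lit 31)

/-- A state of the search, see `search`. -/
abbrev SearchState := (dom F B sf sb m n : ℕ) → Bool

namespace SearchTask

/-- The far end of a dart, see `neighborTable`. -/
def neighbor (T : SearchTask) (c : ℕ) : ℕ := slice T.nbr c

/-- Every vertex has a state left, and enough vertices may be off the cycle. -/
def viable (T : SearchTask) (dom : ℕ) : Bool :=
  select (nonemptyRows dom) (Nat.ble (Nat.sub (nat_lit 19) T.maxLen) (offCount dom)) false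

/-- The path closes up to a cycle of length `len` with sum `tot`: the answer is `true` unless this pair
is to be excluded and enough vertices may be off the cycle. -/
def closeUp (T : SearchTask) (len tot dom : ℕ) : Bool :=
  select (T.bad len tot) (Nat.blt (offCount dom) (Nat.sub (nat_lit 19) len)) true

/-- Goes on after a step at the forward end, unless the domain has become contradictory. -/
def forwardNext (T : SearchTask) (ih : SearchState) (B sf sb m n w o dom : ℕ) : Bool :=
  select (T.viable dom) (ih dom o B (Nat.add sf w) sb (Nat.succ m) n) true

/-- The forward end gets the width `w`, and the path goes on to the vertex with code `o`. -/
def forwardExtend (T : SearchTask) (ih : SearchState) (ms : List ℕ) (dom F B sf sb m n w o : ℕ) : Bool :=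
  T.forwardNext ih B sf sb m n w o (Nat.land dom (rotateMask (nthD (nat_lit 0) ms w) (row F)))

/-- The forward end gets the width `w`, and the path comes to its other end by the dart with code `o`. -/
def forwardClose (T : SearchTask) (dom B sf sb m n w o : ℕ) : Bool :=
  T.closeUp (Nat.add (Nat.add m n) (nat_lit 2))
    (Nat.add (Nat.add sf sb) (Nat.add w (sub18 (col B) (col o)))) dom

/-- The branch of the search in which the forward end has the width `w`. -/
def forwardStep (T : SearchTask) (ih : SearchState) (ms : List ℕ) (dom F B sf sb m n w o : ℕ) : Bool :=
  select (Nat.beq (row o) (row B)) (T.forwardClose dom B sf sb m n w o)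
    (T.forwardExtend ih ms dom F B sf sb m n w o)

/-- All widths of the forward end that are given by the bits of a number. -/
def forward (T : SearchTask) (ih : SearchState) (ms : List ℕ) (dom F B sf sb m n : ℕ) : ℕ → Bool :=
  allBits (fun w => T.forwardStep ih ms dom F B sf sb m n w
    (T.neighbor (Nat.add F (Nat.mul (nat_lit 18) w)))) (nat_lit 18)

/-- Goes on after a step at the backward end, unless the domain has become contradictory. -/
def backwardNext (T : SearchTask) (ih : SearchState) (F sf sb m n w o dom : ℕ) : Bool :=
  select (T.viable dom) (ih dom F (Nat.add o (nat_lit 324)) sf (Nat.add sb w) m (Nat.succ n)) true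

/-- The backward end gets the width `w`, and the path is continued to the vertex with code `o`. -/
def backwardExtend (T : SearchTask) (ih : SearchState) (ms : List ℕ) (dom F B sf sb m n w o : ℕ) : Bool :=
  T.backwardNext ih F sf sb m n w o (Nat.land dom (rotateMask (nthD (nat_lit 0) ms w) (row B)))

/-- The backward end gets the width `w`, and the path comes to its other end by the dart with code `o`. -/
def backwardClose (T : SearchTask) (dom F sf sb m n w o : ℕ) : Bool :=
  T.closeUp (Nat.add (Nat.add m n) (nat_lit 2))
    (Nat.add (Nat.add sf sb) (Nat.add w (sub18 (col o) (col F)))) dom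

/-- The branch of the search in which the backward end has the width `w`. -/
def backwardStep (T : SearchTask) (ih : SearchState) (ms : List ℕ) (dom F B sf sb m n w o : ℕ) : Bool :=
  select (Nat.beq (row o) (row F)) (T.backwardClose dom F sf sb m n w o)
    (T.backwardExtend ih ms dom F B sf sb m n w o)

/-- All widths of the backward end that are given by the bits of a number. -/
def backward (T : SearchTask) (ih : SearchState) (ms : List ℕ) (dom F B sf sb m n : ℕ) : ℕ → Bool :=
  allBits (fun w => T.backwardStep ih ms dom F B sf sb m n w
    (T.neighbor (Nat.sub B (Nat.mul (nat_lit 18) w)))) (nat_lit 18)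

/-- The values of `w` that the state of `F` may have and that keep the forward average high. -/
def forwardChoices (T : SearchTask) (dom F sf m : ℕ) : ℕ :=
  (fun t => Nat.shiftLeft (Nat.shiftRight (slice dom F) t) t)
    (Nat.sub (Nat.div (Nat.add (Nat.mul T.loNum (Nat.succ m)) (Nat.pred T.loDen)) T.loDen) sf)

/-- The values of `w` that the state of `B` may have and that keep the backward average low. -/
def backwardChoices (T : SearchTask) (dom B sb n : ℕ) : ℕ :=
  Nat.mod (slice dom B) (Nat.shiftLeft (nat_lit 1)
    (Nat.sub (Nat.succ (Nat.div (Nat.mul T.hiNum (Nat.succ n)) T.hiDen)) sb))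

/-- Branches at the end of the path that seems to have fewer possible widths. -/
def branch (T : SearchTask) (ih : SearchState) (dom F B sf sb m n sF sB : ℕ) : Bool :=
  select (Nat.ble (bitCount sF) (bitCount sB))
    (T.forward ih (nthD [] T.masks (col F)) dom F B sf sb m n sF)
    (T.backward ih (nthD [] T.masksBack (Nat.sub (col B) (nat_lit 18))) dom F B sf sb m n sB)

/-- Exhaustive search for the cycles that contain a given path; the value `true` says that there
are none.  The path has `m` inner vertices from the vertex `0` on in the forward direction, and `n`
before it; the sums of `w` over these are `sf` and `sb`.  If the forward end is `x` and the path
comes to it at position `a`, then `F = 666 * x + 18 * a`; if the backward end is `y` and the path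
leaves it at position `b`, then `B = 666 * y + 324 + 18 * b`.  The rows of `dom` are the states left
to the vertices. -/
def search (T : SearchTask) (fuel : ℕ) : SearchState :=
  Nat.rec (fun _ _ _ _ _ _ _ => true) (fun _ ih dom F B sf sb m n =>
    T.branch ih dom F B sf sb m n (T.forwardChoices dom F sf m) (T.backwardChoices dom B sb n)) fuel

/-- The states of the vertices before anything is known, except that `0` is on the cycle. -/
def startDomain : ℕ :=
  pack (nat_lit 666) (fun x => Bool.rec (Nat.lor (nat_lit 1) anyState) anyState
    (Nat.beq x (nat_lit 0))) (nat_lit 19)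

/-- The search from the state `(a, w)` of the vertex `0`. -/
def searchFrom (T : SearchTask) (a w : ℕ) : Bool :=
  T.search (Nat.sub T.maxLen (nat_lit 2))
    (Nat.land startDomain (rotateMask (nthD (nat_lit 0) (nthD [] T.masks a) w) (nat_lit 0)))
    (T.neighbor (Nat.mul (nat_lit 18) (Nat.add a w)))
    (Nat.add (T.neighbor (Nat.mul (nat_lit 18) a)) (nat_lit 324))
    w (nat_lit 0) (nat_lit 1) (nat_lit 0)

/-- The search from all states `(a, w)` of the vertex `0` with a given `a`. -/
def searchAll (T : SearchTask) (a : ℕ) : Bool :=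
  allBits (fun w => select (Nat.ble T.loNum (Nat.mul T.loDen w))
    (T.searchFrom a w) true) (nat_lit 18) 262142

end SearchTask

/-- The search task for a rotation given by the list of labels and the list of their positions. -/
def mkTask (rot pos : List ℕ) (maxLen loNum loDen hiNum hiDen : ℕ) (bad : ℕ → ℕ → Bool) : SearchTask :=
  (fun ms => ⟨neighborTable rot pos, ms, maskTableBack ms, maxLen, loNum, loDen, hiNum, hiDen, bad⟩)
    (maskTable pos)

-- The cyclic orders of the three embeddings, and the positions in them. Entry 0 of `posA`, `posB` and
-- `posC` has no meaning.

/-- The rotation of embedding A. -/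
def rotA : List ℕ := [1, 6, 8, 12, 9, 5, 18, 2, 13, 14, 4, 11, 17, 16, 7, 15, 10, 3]

/-- The positions of the labels in `rotA`. -/
def posA : List ℕ := [0, 0, 7, 17, 10, 5, 1, 14, 2, 4, 16, 11, 3, 8, 9, 15, 13, 12, 6]

/-- The rotation of embedding B. -/
def rotB : List ℕ := [1, 11, 6, 15, 12, 17, 16, 4, 10, 18, 2, 14, 8, 9, 13, 5, 7, 3]

/-- The positions of the labels in `rotB`. -/
def posB : List ℕ := [0, 0, 10, 17, 7, 15, 2, 16, 12, 13, 8, 1, 4, 14, 11, 3, 6, 5, 9]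

/-- The rotation of embedding C. -/
def rotC : List ℕ := [1, 8, 14, 17, 7, 18, 3, 5, 13, 9, 2, 16, 15, 6, 11, 12, 10, 4]

/-- The positions of the labels in `rotC`. -/
def posC : List ℕ := [0, 0, 10, 6, 17, 7, 13, 4, 1, 9, 16, 14, 15, 8, 2, 12, 11, 3, 5]

/-- The lengths `l` and sums `n` to be excluded: with `n = 3 * l - 6 + 12 * h`, the side without
further vertices has genus `h`.  Excluded are `h < 0`, `5 ≤ h ≤ 15`, `20 < h`, and lengths less than
entry `h` of `ml` if `h ≤ 4`, less than entry `20 - h` if `16 ≤ h`.  The variable `k` is `h + 3`. -/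
def excluded (ml : List ℕ) (l n : ℕ) : Bool :=
  (fun k => Nat.beq (n + 42) (3 * l + 12 * k) &&
    bif Nat.blt k 3 then true
    else bif Nat.ble k 7 then Nat.blt l (nthD 0 ml (k - 3))
    else bif Nat.ble k 18 then true
    else bif Nat.ble k 23 then Nat.blt l (nthD 0 ml (23 - k))
    else true) ((n + 42 - 3 * l) / 12)

/-! ### Bits of packed numbers -/

theorem nthD_tabulate {α : Type} (z : α) (f : ℕ → α) {n i : ℕ} (h : i < n) :
    nthD z (tabulate f n) i = f i := by
  have key : ∀ (n k i : ℕ), i < n → nthD z (Nat.rec (motive := fun _ => ℕ → List α) (fun _ => [])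
      (fun _ ih i => f i :: ih (Nat.succ i)) n k) i = f (k + i) := by
    intro n
    induction n with
    | zero => intro k i h; omega
    | succ n ih =>
      intro k i h
      cases i with
      | zero => rfl
      | succ i =>
        have := ih (k + 1) i (by omega)
        rw [show k + (i + 1) = k + 1 + i by omega, ← this]
        rfl
  have := key n 0 i h
  rw [Nat.zero_add] at this
  exact this

theorem pack_succ (w : ℕ) (f : ℕ → ℕ) (n : ℕ) :
    pack w f (n + 1) = pack w f n ||| (f n <<< (w * n)) := rfl

theorem testBit_pack {w : ℕ} {f : ℕ → ℕ} {n : ℕ} (hf : ∀ j < n, f j < 2 ^ w) {i b : ℕ}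
    (hb : b < w) : (pack w f n).testBit (w * i + b) = (decide (i < n) && (f i).testBit b) := by
  induction n with
  | zero => simp [pack]
  | succ n ih =>
    rw [pack_succ, Nat.testBit_or, ih fun j hj => hf j (by omega), Nat.testBit_shiftLeft]
    rcases lt_trichotomy i n with h | rfl | h
    · have h2 : ¬ w * n ≤ w * i + b := by
        have : w * (i + 1) ≤ w * n := Nat.mul_le_mul_left w h
        rw [Nat.mul_add] at this
        omega
      simp [h, h2, Nat.lt_succ_of_lt h]
    · simp
    · have h2 : w * n + w ≤ w * i := by
        have : w * (n + 1) ≤ w * i := Nat.mul_le_mul_left w h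
        rwa [Nat.mul_add, Nat.mul_one] at this
      have h3 : (f n).testBit (w * i + b - w * n) = false :=
        Nat.testBit_lt_two_pow ((hf n (by omega)).trans_le (Nat.pow_le_pow_right (by omega) (by omega)))
      simp [h3, show ¬ i < n by omega, show ¬ i < n + 1 by omega]

theorem pack_lt {w : ℕ} {f : ℕ → ℕ} {n : ℕ} (hf : ∀ j < n, f j < 2 ^ w) :
    pack w f n < 2 ^ (w * n) := by
  induction n with
  | zero => simp [pack]
  | succ n ih =>
    rw [pack_succ]
    refine Nat.or_lt_two_pow ?_ ?_
    · exact (ih fun j hj => hf j (by omega)).trans_le (Nat.pow_le_pow_right (by omega) (by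
        rw [Nat.mul_add]; omega))
    · rw [Nat.shiftLeft_eq, Nat.mul_add, Nat.mul_one, Nat.pow_add, mul_comm]
      exact Nat.mul_lt_mul_of_pos_left (hf n (by omega)) (by positivity)

theorem sub18_eq (a b : ℕ) : sub18 a b = (a + 18 - b) % 18 := rfl

theorem stateSet_aux (p : ℕ → ℕ → Bool) (c : ℕ) :
    pack 1 (fun w => Bool.rec (Bool.rec 0 1 (p (Bool.rec (sub18 c w) c (Nat.blt c 18)) w)) 0
      (Nat.beq w 0)) 18 < 2 ^ 18 :=
  pack_lt (w := 1) (n := 18) fun w _ => by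
    cases Nat.beq w 0 <;> cases p (Bool.rec (sub18 c w) c (Nat.blt c 18)) w <;> decide

theorem stateSet_lt (p : ℕ → ℕ → Bool) : stateSet p < 2 ^ 648 :=
  pack_lt (w := 18) (n := 36) fun c _ => stateSet_aux p c

theorem testBit_stateSet (p : ℕ → ℕ → Bool) {c w : ℕ} (hc : c < 36) (h0 : 0 < w) (hw : w < 18) :
    (stateSet p).testBit (18 * c + w) = p (if c < 18 then c else sub18 c w) w := by
  have h1 := testBit_pack (w := 18) (n := 36) (i := c) (b := w) (fun c _ => stateSet_aux p c) hw
  refine h1.trans ?_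
  simp only [hc, decide_true, Bool.true_and]
  have h2 := testBit_pack (w := 1) (n := 18) (i := w) (b := 0)
    (f := fun w => Bool.rec (Bool.rec 0 1 (p (Bool.rec (sub18 c w) c (Nat.blt c 18)) w)) 0
      (Nat.beq w 0)) (fun w _ => by
    cases Nat.beq w 0 <;> cases p (Bool.rec (sub18 c w) c (Nat.blt c 18)) w <;> decide) (by omega)
  rw [Nat.one_mul, Nat.add_zero] at h2
  rw [h2]
  have h3 : Nat.beq w 0 = false := by cases w <;> first | omega | rfl
  have h4 : (Bool.rec (sub18 c w) c (Nat.blt c 18) : ℕ) = if c < 18 then c else sub18 c w := by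
    by_cases h : c < 18
    · have : Nat.blt c 18 = true := by simpa using h
      simp [this, h]
    · have : Nat.blt c 18 = false := by
        rw [← Bool.not_eq_true]
        exact fun h' => h (Nat.le_of_ble_eq_true h')
      simp [this, h]
  simp only [h3, h4, hw, decide_true, Bool.true_and]
  cases p (if c < 18 then c else sub18 c w) w <;> rfl

/-- The row `r` contains the state `(a, w)` of a vertex, in both encodings. -/
def HasState (r : ℕ → Bool) (a w : ℕ) : Prop :=
  r (18 * a + w) = true ∧ r (324 + 18 * ((a + w) % 18) + w) = true

theorem hasState_stateSet {p : ℕ → ℕ → Bool} {a w : ℕ} (ha : a < 18) (h0 : 0 < w) (hw : w < 18)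
    (h : p a w = true) : HasState (stateSet p).testBit a w := by
  constructor
  · rw [testBit_stateSet p (by omega) h0 hw, if_pos ha, h]
  · rw [show 324 + 18 * ((a + w) % 18) + w = 18 * (18 + (a + w) % 18) + w by ring,
      testBit_stateSet p (by omega) h0 hw, if_neg (by omega),
      show sub18 (18 + (a + w) % 18) w = a by rw [sub18_eq]; omega, h]

theorem testBit_rotateMask {m r x b : ℕ} (hm : m < 2 ^ 12654) (hr : r < 19) (hx : x < 19)
    (hb : b < 666) :
    (rotateMask (twice m) r).testBit (666 * x + b) =
      m.testBit (666 * ((x + 19 - r) % 19) + b) := by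
  change ((m ||| (m <<< 12654)) >>> (12654 - 666 * r)).testBit (666 * x + b) = _
  rw [Nat.testBit_shiftRight, Nat.testBit_or, Nat.testBit_shiftLeft]
  by_cases h : x < r
  · rw [show 12654 - 666 * r + (666 * x + b) = 666 * ((x + 19 - r) % 19) + b by omega]
    simp [show ¬ 12654 ≤ 666 * ((x + 19 - r) % 19) + b by omega]
  · have h1 : m.testBit (12654 - 666 * r + (666 * x + b)) = false :=
      Nat.testBit_lt_two_pow (hm.trans_le (Nat.pow_le_pow_right (by omega) (by omega)))
    rw [h1, show 12654 - 666 * r + (666 * x + b) - 12654 = 666 * ((x + 19 - r) % 19) + b by omega]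
    simp [show 12654 ≤ 12654 - 666 * r + (666 * x + b) by omega]

theorem allBits_spec {p : ℕ → Bool} : ∀ {fuel s : ℕ}, s < 2 ^ fuel → allBits p fuel s = true →
    ∀ b, s.testBit b = true → p b = true := by
  intro fuel
  induction fuel with
  | zero =>
    intro s hs _ b hb
    have : s = 0 := by simpa using hs
    simp [this] at hb
  | succ n ih =>
    intro s hs h b hb
    change (Bool.rec (Bool.rec false (allBits p n (s - 1 <<< Nat.log2 s)) (p (Nat.log2 s))) true
      (Nat.beq s 0) : Bool) = true at h
    have hs0 : s ≠ 0 := by rintro rfl; simp at hb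
    have h0 : Nat.beq s 0 = false := by cases s <;> first | contradiction | rfl
    rw [h0] at h
    have hp : p (Nat.log2 s) = true := by
      cases hq : p (Nat.log2 s)
      · rw [hq] at h; exact h
      · rfl
    rw [hp] at h
    change allBits p n (s - 1 <<< Nat.log2 s) = true at h
    have h2 : 2 ^ Nat.log2 s ≤ s := Nat.log2_self_le hs0
    have h3 : s < 2 ^ (Nat.log2 s + 1) := Nat.lt_log2_self
    rw [Nat.shiftLeft_eq, Nat.one_mul] at h
    by_cases hbl : b = Nat.log2 s
    · rw [hbl]; exact hp
    · have hln : Nat.log2 s ≤ n := by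
        have := (Nat.log2_lt hs0).2 hs
        omega
      have h4 : s - 2 ^ Nat.log2 s < 2 ^ Nat.log2 s := by
        rw [pow_succ] at h3; omega
      refine ih (h4.trans_le (Nat.pow_le_pow_right (by omega) hln)) h b ?_
      have h5 : s = 2 ^ Nat.log2 s * 1 + (s - 2 ^ Nat.log2 s) := by omega
      rw [h5, Nat.testBit_two_pow_mul_add _ h4] at hb
      by_cases hlt : b < Nat.log2 s
      · simpa [hlt] using hb
      · simp only [hlt, if_false] at hb
        have : b - Nat.log2 s ≠ 0 := by omega
        rw [Nat.testBit_one_eq_true_iff_self_eq_zero] at hb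
        contradiction

theorem slice_lt (d o : ℕ) : slice d o < 2 ^ 18 := Nat.lt_of_le_of_lt Nat.and_le_right (by norm_num)

theorem testBit_slice {d o b : ℕ} (hb : b < 18) : (slice d o).testBit b = d.testBit (o + b) := by
  change ((d >>> o) &&& (2 ^ 18 - 1)).testBit b = _
  rw [Nat.testBit_and, Nat.testBit_shiftRight, Nat.testBit_two_pow_sub_one]
  simp [hb]

theorem slice_pack {f : ℕ → ℕ} {n i : ℕ} (hf : ∀ j < n, f j < 2 ^ 18) (hi : i < n) :
    slice (pack 18 f n) (18 * i) = f i := by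
  apply Nat.eq_of_testBit_eq
  intro b
  by_cases hb : b < 18
  · rw [testBit_slice hb, testBit_pack hf hb]
    simp [hi]
  · have h1 : ∀ x < 2 ^ 18, x.testBit b = false := fun x hx =>
      Nat.testBit_lt_two_pow (hx.trans_le (Nat.pow_le_pow_right (by omega) (by omega)))
    rw [h1 _ (slice_lt _ _), h1 _ (hf i hi)]

/-! ### Emptiness test and bit count for rows -/

theorem pack_const_succ (w c n : ℕ) (hc : c < 2 ^ w) :
    pack w (fun _ => c) (n + 1) = c + 2 ^ w * pack w (fun _ => c) n := by
  apply Nat.eq_of_testBit_eq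
  intro k
  rw [Nat.add_comm c, Nat.testBit_two_pow_mul_add _ hc]
  rcases Nat.eq_zero_or_pos w with rfl | hw
  · have : c = 0 := by simpa using hc
    subst this
    have h0 : ∀ m, pack 0 (fun _ => 0) m = 0 := by
      intro m
      induction m with
      | zero => rfl
      | succ m ih => rw [pack_succ, ih]; simp
    simp [h0]
  have hk : k = w * (k / w) + k % w := (Nat.div_add_mod k w).symm
  have hm : k % w < w := Nat.mod_lt _ hw
  by_cases h : k < w
  · have h1 := testBit_pack (w := w) (f := fun _ => c) (n := n + 1) (fun _ _ => hc) (i := 0) h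
    simp only [Nat.mul_zero, Nat.zero_add] at h1
    simp [h1, h]
  · have hd : 0 < k / w := Nat.div_pos (by omega) hw
    rw [if_neg h]
    have h1 := testBit_pack (w := w) (f := fun _ => c) (n := n + 1) (fun _ _ => hc) (i := k / w) hm
    have h2 := testBit_pack (w := w) (f := fun _ => c) (n := n) (fun _ _ => hc) (i := k / w - 1) hm
    rw [← hk] at h1
    rw [h1]
    have h3 : w * (k / w - 1) + k % w = k - w := by
      rw [Nat.mul_sub, Nat.mul_one]
      have : w * 1 ≤ w * (k / w) := Nat.mul_le_mul_left w hd
      omega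
    rw [← h3, h2]
    congr 1
    simp only [decide_eq_decide]
    omega

/-- If each row is below `2 ^ 648` and not zero, then adding `2 ^ 648 - 1` to it sets bit 648; no carry
goes from one row to the next. -/
theorem testBit_add_pack {n : ℕ} : ∀ {d : ℕ},
    (∀ x < n, d.testBit (666 * x + 648) = false) →
    (∀ x < n, ∀ b, 648 < b → b < 666 → d.testBit (666 * x + b) = false) →
    (∀ x < n, ∃ b < 648, d.testBit (666 * x + b) = true) →
    ∀ x < n, (d + pack 666 (fun _ => 2 ^ 648 - 1) n).testBit (666 * x + 648) = true := by
  induction n with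
  | zero => intro d _ _ _ x hx; omega
  | succ n ih =>
    intro d h0 h0' h1 x hx
    have hpow : (2:ℕ) ^ 648 + 2 ^ 648 ≤ 2 ^ 666 := by
      rw [← Nat.two_mul, ← pow_succ']
      exact Nat.pow_le_pow_right (by omega) (by omega)
    have hpos : 1 ≤ (2:ℕ) ^ 648 := Nat.one_le_two_pow
    rw [pack_const_succ _ _ _ (by omega)]
    set r := d % 2 ^ 666 with hr
    set q := d / 2 ^ 666 with hq
    have hd : d = r + 2 ^ 666 * q := (Nat.mod_add_div d (2 ^ 666)).symm
    have hrb : ∀ b < 666, r.testBit b = d.testBit b := by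
      intro b hb
      rw [hr, Nat.testBit_mod_two_pow]
      simp [hb]
    have hqb : ∀ b, q.testBit b = d.testBit (666 + b) := by
      intro b
      rw [hq, Nat.testBit_div_two_pow]
      congr 1
      omega
    have hr648 : r < 2 ^ 648 := by
      apply Nat.lt_pow_two_of_testBit
      intro i hi
      by_cases hi2 : i < 666
      · rw [hrb i hi2]
        rcases Nat.eq_or_lt_of_le hi with rfl | hlt
        · simpa using h0 0 (by omega)
        · simpa using h0' 0 (by omega) i hlt hi2
      · exact Nat.testBit_lt_two_pow ((Nat.mod_lt d (by positivity)).trans_le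
          (Nat.pow_le_pow_right (by omega) (by omega)))
    have hr1 : 1 ≤ r := by
      obtain ⟨b, hb, h⟩ := h1 0 (by omega)
      rw [Nat.mul_zero, Nat.zero_add, ← hrb b (by omega)] at h
      by_contra hcon
      have : r = 0 := by omega
      simp [this] at h
    have hlt : r + (2 ^ 648 - 1) < 2 ^ 666 := by omega
    have hsum : d + (2 ^ 648 - 1 + 2 ^ 666 * pack 666 (fun _ => 2 ^ 648 - 1) n) =
        2 ^ 666 * (q + pack 666 (fun _ => 2 ^ 648 - 1) n) + (r + (2 ^ 648 - 1)) := by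
      rw [hd]; ring
    rw [hsum, Nat.testBit_two_pow_mul_add _ hlt]
    cases x with
    | zero =>
      rw [if_pos (by omega)]
      have : r + (2 ^ 648 - 1) = 2 ^ 648 * 1 + (r - 1) := by
        have : 1 ≤ 2 ^ 648 := Nat.one_le_two_pow
        omega
      rw [this, Nat.mul_zero, Nat.zero_add, Nat.testBit_two_pow_mul_add _ (by omega)]
      simp
    | succ x =>
      rw [if_neg (by omega), show 666 * (x + 1) + 648 - 666 = 666 * x + 648 by omega]
      apply ih
      · intro y hy
        rw [hqb, show 666 + (666 * y + 648) = 666 * (y + 1) + 648 by ring]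
        exact h0 _ (by omega)
      · intro y hy b hb hb2
        rw [hqb, show 666 + (666 * y + b) = 666 * (y + 1) + b by ring]
        exact h0' _ (by omega) b hb hb2
      · intro y hy
        obtain ⟨b, hb, h⟩ := h1 (y + 1) (by omega)
        refine ⟨b, hb, ?_⟩
        rw [hqb, show 666 + (666 * y + b) = 666 * (y + 1) + b by ring]
        exact h
      · omega

theorem nonemptyRows_of_bits {d : ℕ}
    (h0 : ∀ x < 19, ∀ b, 648 ≤ b → b < 666 → d.testBit (666 * x + b) = false)
    (h1 : ∀ x < 19, ∃ b < 648, d.testBit (666 * x + b) = true) : nonemptyRows d = true := by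
  have h2 : ∀ x < 19, (d + rowOnes).testBit (666 * x + 648) = true :=
    testBit_add_pack (n := 19) (fun x hx => h0 x hx _ le_rfl (by omega))
      (fun x hx b hb => h0 x hx b (by omega)) h1
  change Nat.beq ((d + rowOnes) &&& rowGuards) rowGuards = true
  rw [Nat.beq_eq]
  apply Nat.eq_of_testBit_eq
  intro k
  rw [Nat.testBit_and]
  have hk : k = 666 * (k / 666) + k % 666 := (Nat.div_add_mod k 666).symm
  have hm : k % 666 < 666 := Nat.mod_lt _ (by omega)
  have h3 : rowGuards.testBit k = (decide (k / 666 < 19) && (2 ^ 648).testBit (k % 666)) := by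
    conv_lhs => rw [hk]
    exact testBit_pack (w := 666) (f := fun _ => 2 ^ 648) (n := 19)
      (fun _ _ => Nat.pow_lt_pow_right (by omega) (by omega)) hm
  by_cases hx : k / 666 < 19
  · by_cases hb : k % 666 = 648
    · have := h2 _ hx
      rw [← hb, ← hk] at this
      simp [this]
    · have : (2 ^ 648).testBit (k % 666) = false := by
        rw [Nat.testBit_two_pow]
        simpa using fun h => hb h.symm
      simp [h3, this]
  · simp [h3, hx]

theorem and_rowUnits (d : ℕ) (n : ℕ) : d &&& pack 666 (fun _ => 1) n =
    ∑ x ∈ Finset.range n, (d.testBit (666 * x)).toNat * 2 ^ (666 * x) := by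
  induction n with
  | zero => simp [pack]
  | succ n ih =>
    rw [pack_succ, Finset.sum_range_succ, ← ih, Nat.and_or_distrib_left]
    have h1 : d &&& 1 <<< (666 * n) = (d.testBit (666 * n)).toNat * 2 ^ (666 * n) := by
      rw [Nat.shiftLeft_eq, Nat.one_mul]
      exact Nat.and_two_pow d _
    rw [h1]
    have h2 : d &&& pack 666 (fun _ => 1) n < 2 ^ (666 * n) :=
      Nat.lt_of_le_of_lt Nat.and_le_right (pack_lt fun _ _ => by norm_num)
    rw [mul_comm, Nat.or_comm, ← Nat.two_pow_add_eq_or_of_lt h2, Nat.add_comm]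

theorem two_pow_mul_modEq_one (k x : ℕ) : 2 ^ (k * x) ≡ 1 [MOD 2 ^ k - 1] := by
  have h : 2 ^ k ≡ 1 [MOD 2 ^ k - 1] := ((Nat.modEq_iff_dvd' Nat.one_le_two_pow).2 dvd_rfl).symm
  have h4 := h.pow x
  rwa [← pow_mul, one_pow] at h4

theorem offCount_eq (d : ℕ) :
    offCount d = ∑ x ∈ Finset.range 19, (d.testBit (666 * x)).toNat := by
  change (d &&& pack 666 (fun _ => 1) 19) % (2 ^ 666 - 1) = _
  rw [and_rowUnits]
  have h1 : (∑ x ∈ Finset.range 19, (d.testBit (666 * x)).toNat * 2 ^ (666 * x)) ≡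
      ∑ x ∈ Finset.range 19, (d.testBit (666 * x)).toNat [MOD 2 ^ 666 - 1] := by
    refine Nat.ModEq.sum fun x _ => ?_
    have := (two_pow_mul_modEq_one 666 x).mul_left (d.testBit (666 * x)).toNat
    rwa [Nat.mul_one] at this
  have h4 : ∑ x ∈ Finset.range 19, (d.testBit (666 * x)).toNat ≤ 19 := by
    calc _ ≤ ∑ x ∈ Finset.range 19, 1 := Finset.sum_le_sum fun x _ => by
          cases d.testBit (666 * x) <;> decide
      _ = 19 := by simp
  rw [h1, Nat.mod_eq_of_lt]
  have h5 : (2:ℕ) ^ 5 < 2 ^ 666 := Nat.pow_lt_pow_right (by omega) (by omega)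
  revert h5 h4
  generalize (2:ℕ) ^ 666 = N
  omega

/-! ### Cycles with a left side that contains no further vertex -/

/-- The lists `rot` and `pos` describe a cyclic order of the labels `1, …, 18`: the label at
position `p` is entry `p` of `rot`, and the position of the label `e` is entry `e` of `pos`. -/
structure ValidTables (rot pos : List ℕ) : Prop where
  rot_pos : ∀ e < 19, e ≠ 0 → nthD 0 rot (nthD 0 pos e) = e
  pos_lt : ∀ e < 19, nthD 0 pos e < 18
  pos_rot : ∀ p < 18, nthD 0 pos (nthD 0 rot p) = p
  rot_lt : ∀ p < 18, nthD 0 rot p < 19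
  rot_ne : ∀ p < 18, nthD 0 rot p ≠ 0

/-- A cyclic sequence of distinct elements of `ℤ/19`, indexed by the integers modulo `len`, with a
consistent notion of left side.  `pos` is the table of positions of the labels around a vertex; around
`v i`, the darts strictly between the one towards `v (i - 1)` and the one towards `v (i + 1)`, in the
order of positions, are to the left.  An edge between two terms of the sequence is to the left at
both ends or at none, and an edge to any other vertex is not to the left. -/
structure LeftCut (pos : List ℕ) where
  len : ℕ
  three_le : 3 ≤ len
  v : ℤ → ZMod 19
  periodic : ∀ i, v (i + len) = v i
  inj : ∀ i j, v i = v j → (len : ℤ) ∣ i - j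
  consistent : ∀ i j, v i ≠ v j →
    sub18 (nthD 0 pos (v j - v i).val) (nthD 0 pos (v (i - 1) - v i).val) ≠ 0 →
    sub18 (nthD 0 pos (v j - v i).val) (nthD 0 pos (v (i - 1) - v i).val) <
      sub18 (nthD 0 pos (v (i + 1) - v i).val) (nthD 0 pos (v (i - 1) - v i).val) →
    sub18 (nthD 0 pos (v i - v j).val) (nthD 0 pos (v (j - 1) - v j).val) ≠ 0 ∧
    sub18 (nthD 0 pos (v i - v j).val) (nthD 0 pos (v (j - 1) - v j).val) <
      sub18 (nthD 0 pos (v (j + 1) - v j).val) (nthD 0 pos (v (j - 1) - v j).val)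
  off : ∀ i x, (∀ j, v j ≠ x) →
    sub18 (nthD 0 pos (v (i + 1) - v i).val) (nthD 0 pos (v (i - 1) - v i).val) ≤
    sub18 (nthD 0 pos (x - v i).val) (nthD 0 pos (v (i - 1) - v i).val)

theorem val_sub_zmod (x y : ZMod 19) : (x - y).val = (x.val + 19 - y.val) % 19 := by
  revert x y; decide

theorem val_sub_ne_zero {x y : ZMod 19} (h : x ≠ y) : (x - y).val ≠ 0 := by
  rw [Ne, ZMod.val_eq_zero, sub_eq_zero]; exact h

theorem sub18_lt (a b : ℕ) : sub18 a b < 18 := Nat.mod_lt _ (show 0 < 18 by decide)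

theorem ValidTables.pos_inj {rot pos : List ℕ} (h : ValidTables rot pos) {a b c : ZMod 19}
    (ha : a ≠ c) (hb : b ≠ c) (hab : nthD 0 pos (a - c).val = nthD 0 pos (b - c).val) : a = b := by
  have h1 := h.rot_pos _ (ZMod.val_lt (a - c)) (val_sub_ne_zero ha)
  have h2 := h.rot_pos _ (ZMod.val_lt (b - c)) (val_sub_ne_zero hb)
  rw [hab, h2] at h1
  have := ZMod.val_injective 19 h1
  exact (sub_left_injective this).symm

namespace LeftCut

variable {rot pos : List ℕ} (c : LeftCut pos)

/-- The position at which the sequence comes to its term `i`. -/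
def enter (i : ℤ) : ℕ := nthD 0 pos (c.v (i - 1) - c.v i).val

/-- The position at which the sequence leaves its term `i`. -/
def leave (i : ℤ) : ℕ := nthD 0 pos (c.v (i + 1) - c.v i).val

/-- The number of darts strictly to the left at term `i`, plus one for the dart along which the
sequence leaves. -/
def width (i : ℤ) : ℕ := sub18 (c.leave i) (c.enter i)

/-- The position of the dart from term `i` to `x`, counted from the one at which the sequence comes
to term `i`. -/
def angle (i : ℤ) (x : ZMod 19) : ℕ := sub18 (nthD 0 pos (x - c.v i).val) (c.enter i)

/-- The sum of the widths of all terms. -/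
def total : ℕ := ∑ k ∈ Finset.range c.len, c.width k

/-- The same sequence, numbered from term `i` on and translated such that it starts at `0`. -/
def shift (i : ℤ) : LeftCut pos where
  len := c.len
  three_le := c.three_le
  v j := c.v (i + j) - c.v i
  periodic j := by rw [← add_assoc, c.periodic]
  inj j k h := by
    have := c.inj (i + j) (i + k) (sub_left_injective h)
    rwa [add_sub_add_left_eq_sub] at this
  consistent j k h := by
    have := c.consistent (i + j) (i + k) (fun h' => h (by rw [h']))
    simpa only [sub_sub_sub_cancel_right, add_sub_assoc, add_assoc] using this
  off j x h := by
    have := c.off (i + j) (x + c.v i) (fun k hk => h (k - i) (by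
      rw [add_sub_cancel, hk, add_sub_cancel_right]))
    rw [show x + c.v i - c.v (i + j) = x - (c.v (i + j) - c.v i) by ring] at this
    simpa only [sub_sub_sub_cancel_right, add_sub_assoc, add_assoc] using this

theorem shift_v_zero (i : ℤ) : (c.shift i).v 0 = 0 := by simp [shift]

theorem shift_enter (i j : ℤ) : (c.shift i).enter j = c.enter (i + j) := by
  simp only [shift, enter, sub_sub_sub_cancel_right, add_sub_assoc]

theorem shift_leave (i j : ℤ) : (c.shift i).leave j = c.leave (i + j) := by
  simp only [shift, leave, sub_sub_sub_cancel_right, add_assoc]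

theorem shift_width (i j : ℤ) : (c.shift i).width j = c.width (i + j) := by
  rw [width, width, shift_enter, shift_leave]

theorem v_eq_of_dvd {i j : ℤ} (h : (c.len : ℤ) ∣ i - j) : c.v i = c.v j := by
  have hp : Function.Periodic c.v (c.len : ℤ) := c.periodic
  obtain ⟨k, hk⟩ := h
  have h1 := hp.int_mul k j
  rw [show i = j + k * c.len by linarith]
  exact_mod_cast h1

theorem v_ne {i j : ℤ} (h : 0 < j - i) (h' : j - i < c.len) : c.v j ≠ c.v i := fun he => by
  have := Int.le_of_dvd h (c.inj _ _ he)
  omega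

theorem v_pred_ne (i : ℤ) : c.v (i - 1) ≠ c.v i :=
  (c.v_ne (by omega) (by have := c.three_le; omega)).symm

theorem v_succ_ne (i : ℤ) : c.v (i + 1) ≠ c.v i :=
  c.v_ne (by omega) (by have := c.three_le; omega)

theorem v_succ_ne_pred (i : ℤ) : c.v (i + 1) ≠ c.v (i - 1) :=
  c.v_ne (by omega) (by have := c.three_le; omega)

theorem v_congr {i j : ℤ} (h : c.v i = c.v j) (k : ℤ) : c.v (i + k) = c.v (j + k) :=
  c.v_eq_of_dvd (by rw [add_sub_add_right_eq_sub]; exact c.inj _ _ h)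

theorem enter_congr {i j : ℤ} (h : c.v i = c.v j) : c.enter i = c.enter j := by
  have := c.v_congr h (-1)
  rw [← sub_eq_add_neg, ← sub_eq_add_neg] at this
  rw [enter, enter, h, this]

theorem leave_congr {i j : ℤ} (h : c.v i = c.v j) : c.leave i = c.leave j := by
  rw [leave, leave, h, c.v_congr h 1]

theorem width_congr {i j : ℤ} (h : c.v i = c.v j) : c.width i = c.width j := by
  rw [width, width, c.enter_congr h, c.leave_congr h]

theorem width_periodic (i : ℤ) : c.width (i + c.len) = c.width i := c.width_congr (c.periodic i)

section Tables

variable (h : ValidTables rot pos)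
include h

theorem enter_lt (i : ℤ) : c.enter i < 18 := h.pos_lt _ (ZMod.val_lt _)

theorem leave_lt (i : ℤ) : c.leave i < 18 := h.pos_lt _ (ZMod.val_lt _)

theorem angle_eq_zero {i : ℤ} {x : ZMod 19} (hx : x ≠ c.v i) (h0 : c.angle i x = 0) :
    x = c.v (i - 1) := by
  refine h.pos_inj hx (c.v_pred_ne i) ?_
  have h1 := h.pos_lt _ (ZMod.val_lt (x - c.v i))
  have h2 := c.enter_lt h i
  rw [angle, sub18_eq] at h0
  change _ = c.enter i
  omega

theorem angle_eq_width {i : ℤ} {x : ZMod 19} (hx : x ≠ c.v i) (h0 : c.angle i x = c.width i) :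
    x = c.v (i + 1) := by
  refine h.pos_inj hx (c.v_succ_ne i) ?_
  have h1 := h.pos_lt _ (ZMod.val_lt (x - c.v i))
  have h2 := c.enter_lt h i
  have h3 := c.leave_lt h i
  rw [angle, width, sub18_eq, sub18_eq] at h0
  change _ = c.leave i
  omega

theorem width_pos (i : ℤ) : 0 < c.width i := by
  refine Nat.pos_of_ne_zero fun h0 => c.v_succ_ne_pred i (c.angle_eq_zero h (c.v_succ_ne i) h0)

theorem leave_eq (i : ℤ) : c.leave i = (c.enter i + c.width i) % 18 := by
  have h2 := c.enter_lt h i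
  have h3 := c.leave_lt h i
  rw [width, sub18_eq]
  omega

end Tables

theorem width_lt (i : ℤ) : c.width i < 18 := sub18_lt _ _

end LeftCut

-- These involve numbers of thousands of bits, which unification must not compute.
attribute [local irreducible] rowOnes rowGuards rowUnits rowModulus offCount nonemptyRows

/-- `dom` contains the states of all vertices. -/
def LeftCut.Allows {pos : List ℕ} (c : LeftCut pos) (dom : ℕ) : Prop :=
  (∀ i, HasState (fun b => dom.testBit (666 * (c.v i).val + b)) (c.enter i) (c.width i)) ∧
    ∀ x, (∀ i, c.v i ≠ x) → dom.testBit (666 * x.val) = true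

/-- The last 18 bits of each row are not set. -/
def CleanRows (dom : ℕ) : Prop :=
  ∀ x < 19, ∀ b, 648 ≤ b → b < 666 → dom.testBit (666 * x + b) = false

theorem CleanRows.land {d : ℕ} (h : CleanRows d) (m : ℕ) : CleanRows (Nat.land d m) := by
  intro x hx b hb hb'
  change (d &&& m).testBit _ = _
  rw [Nat.testBit_and, h x hx b hb hb', Bool.false_and]

theorem one_lt_two_pow_666 : 1 < 2 ^ 666 := Nat.one_lt_two_pow (by omega)

theorem two_pow_648_lt : 2 ^ 648 < 2 ^ 666 := Nat.pow_lt_pow_right (by omega) (by omega)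

theorem stateSet_lt' (p : ℕ → ℕ → Bool) : stateSet p < 2 ^ 666 := (stateSet_lt p).trans two_pow_648_lt

theorem one_lor_stateSet_lt (p : ℕ → ℕ → Bool) : Nat.lor 1 (stateSet p) < 2 ^ 666 :=
  Nat.or_lt_two_pow one_lt_two_pow_666 (stateSet_lt' p)

theorem hasState_lor {r s a w : ℕ} (h : HasState s.testBit a w) :
    HasState (Nat.lor r s).testBit a w := by
  have key : ∀ k, s.testBit k = true → (Nat.lor r s).testBit k = true := fun k hk => by
    change (r ||| s).testBit k = true
    rw [Nat.testBit_or, hk, Bool.or_true]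
  exact ⟨key _ h.1, key _ h.2⟩

theorem testBit_one_lor (s : ℕ) : (Nat.lor 1 s).testBit 0 = true := by
  change (1 ||| s).testBit 0 = true
  rw [Nat.testBit_or]; rfl

/-- The row of `mask` for the vertex at distance `x`. -/
def maskRow (pos : List ℕ) (a w x : ℕ) : ℕ :=
  if x = 0 then anyState
  else if sub18 (nthD 0 pos x) a = 0 then leaveAt (nthD 0 pos (19 - x))
  else if sub18 (nthD 0 pos x) a = w then enterAt (nthD 0 pos (19 - x))
  else if sub18 (nthD 0 pos x) a < w then leftAt (nthD 0 pos (19 - x))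
  else rightAt (nthD 0 pos (19 - x))

theorem maskRow_lt (pos : List ℕ) (a w x : ℕ) : maskRow pos a w x < 2 ^ 666 := by
  unfold maskRow
  split_ifs
  · exact stateSet_lt' _
  · exact stateSet_lt' _
  · exact stateSet_lt' _
  · exact stateSet_lt' _
  · exact one_lor_stateSet_lt _

theorem nineteen_sub_val {x y : ZMod 19} (h : y ≠ x) : 19 - (y - x).val = (x - y).val := by
  revert x y; decide

theorem boolRec_eq {α : Type} (b : Bool) (s t : α) : (Bool.rec s t b : α) = if b then t else s := by
  cases b <;> rfl

theorem select_eq {α : Type} (b : Bool) (s t : α) : select b s t = if b then s else t := by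
  cases b <;> rfl

theorem beq_iff (a b : ℕ) : (Nat.beq a b = true) ↔ a = b := by rw [Nat.beq_eq]

theorem blt_iff (a b : ℕ) : (Nat.blt a b = true) ↔ a < b :=
  ⟨Nat.le_of_ble_eq_true, Nat.ble_eq_true_of_le⟩

theorem ble_iff (a b : ℕ) : (Nat.ble a b = true) ↔ a ≤ b :=
  ⟨Nat.le_of_ble_eq_true, Nat.ble_eq_true_of_le⟩

/-- The entry of `maskTable` at `(a, w)`. -/
def fullMask (pos : List ℕ) (a w : ℕ) : ℕ := pack 666 (maskRow pos a w) 19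

theorem fullMask_lt (pos : List ℕ) (a w : ℕ) : fullMask pos a w < 2 ^ 12654 :=
  (pack_lt fun _ _ => maskRow_lt _ _ _ _).trans_le (Nat.pow_le_pow_right (by omega) (by omega))

theorem pack_congr {w n : ℕ} {f g : ℕ → ℕ} (h : ∀ i < n, f i = g i) : pack w f n = pack w g n := by
  induction n with
  | zero => rfl
  | succ n ih => rw [pack_succ, pack_succ, ih fun i hi => h i (by omega), h n (by omega)]

section Tables

variable {rot pos : List ℕ} (h : ValidTables rot pos)
include h

theorem maskTable_entry {a w : ℕ} (ha : a < 18) (hw : w < 18) :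
    nthD 0 (nthD [] (maskTable pos) a) w = twice (fullMask pos a w) := by
  change nthD 0 (nthD [] (tabulate (fun a => tabulate (fun w => twice (mask (tabulate enterAt 18)
    (tabulate leaveAt 18) (tabulate leftAt 18) (tabulate rightAt 18) pos a w)) 18) 18) a) w = _
  rw [nthD_tabulate _ _ ha, nthD_tabulate _ _ hw]
  congr 1
  refine pack_congr fun x hx => ?_
  have hq : x ≠ 0 → nthD 0 pos (19 - x) < 18 := fun hx0 => h.pos_lt _ (by omega)
  change (Bool.rec (Bool.rec (Bool.rec (Bool.rec (nthD 0 (tabulate rightAt 18) (nthD 0 pos (19 - x)))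
    (nthD 0 (tabulate leftAt 18) (nthD 0 pos (19 - x))) (Nat.blt (sub18 (nthD 0 pos x) a) w))
    (nthD 0 (tabulate enterAt 18) (nthD 0 pos (19 - x))) (Nat.beq (sub18 (nthD 0 pos x) a) w))
    (nthD 0 (tabulate leaveAt 18) (nthD 0 pos (19 - x))) (Nat.beq (sub18 (nthD 0 pos x) a) 0))
    anyState (Nat.beq x 0) : ℕ) = maskRow pos a w x
  simp only [boolRec_eq, beq_iff, blt_iff]
  unfold maskRow
  by_cases hx0 : x = 0
  · rw [if_pos hx0, if_pos hx0]
  · rw [nthD_tabulate _ _ (hq hx0), nthD_tabulate _ _ (hq hx0), nthD_tabulate _ _ (hq hx0),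
      nthD_tabulate _ _ (hq hx0)]

theorem testBit_mask {a w r x b : ℕ} (ha : a < 18) (hw : w < 18) (hr : r < 19) (hx : x < 19)
    (hb : b < 666) :
    (rotateMask (nthD 0 (nthD [] (maskTable pos) a) w) r).testBit (666 * x + b) =
      (maskRow pos a w ((x + 19 - r) % 19)).testBit b := by
  rw [maskTable_entry h ha hw, testBit_rotateMask (fullMask_lt pos a w) hr hx hb,
    fullMask, testBit_pack (fun _ _ => maskRow_lt _ _ _ _) hb]
  rw [decide_eq_true (Nat.mod_lt _ (by decide)), Bool.true_and]

/-- The mask of the state of a term of the sequence keeps the actual states of all vertices: this is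
where the consistency of left sides enters. -/
theorem allows_mask (c : LeftCut pos) (i : ℤ) :
    c.Allows (rotateMask (nthD 0 (nthD [] (maskTable pos) (c.enter i)) (c.width i)) (c.v i).val) := by
  have hbit : ∀ (x : ZMod 19) (b : ℕ), b < 666 →
      (rotateMask (nthD 0 (nthD [] (maskTable pos) (c.enter i)) (c.width i)) (c.v i).val).testBit
        (666 * x.val + b) = (maskRow pos (c.enter i) (c.width i) (x - c.v i).val).testBit b := by
    intro x b hb
    rw [testBit_mask h (c.enter_lt h i) (c.width_lt i) (ZMod.val_lt _) (ZMod.val_lt _) hb,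
      val_sub_zmod]
  constructor
  · intro j
    have hE := c.enter_lt h j
    have hW := c.width_lt j
    have hW0 := c.width_pos h j
    suffices hs : HasState (maskRow pos (c.enter i) (c.width i) (c.v j - c.v i).val).testBit
        (c.enter j) (c.width j) by
      refine ⟨?_, ?_⟩
      · dsimp only; rw [hbit _ _ (by omega)]; exact hs.1
      · dsimp only; rw [Nat.add_assoc, hbit _ _ (by omega), ← Nat.add_assoc]; exact hs.2
    unfold maskRow
    by_cases hij : c.v j = c.v i
    · rw [if_pos (by rw [hij, sub_self]; rfl)]
      exact hasState_stateSet hE hW0 hW rfl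
    rw [if_neg (val_sub_ne_zero hij)]
    rw [nineteen_sub_val hij]
    change HasState (if c.angle i (c.v j) = 0 then _ else if c.angle i (c.v j) = c.width i then _ else
      if c.angle i (c.v j) < c.width i then _ else _ : ℕ).testBit _ _
    split_ifs with h1 h2 h3
    · refine hasState_stateSet hE hW0 hW ?_
      rw [beq_iff]
      have h4 := c.v_congr (c.angle_eq_zero h hij h1) 1
      rw [sub_add_cancel] at h4
      rw [← h4]; rfl
    · refine hasState_stateSet hE hW0 hW ?_
      rw [beq_iff]
      have h4 := c.v_congr (c.angle_eq_width h hij h2) (-1)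
      rw [add_neg_cancel_right] at h4
      rw [← h4]; rfl
    · have h4 := c.consistent i j (Ne.symm hij) h1 h3
      refine hasState_stateSet hE hW0 hW ?_
      rw [boolRec_eq, if_neg, blt_iff]
      · exact h4.2
      · rw [beq_iff]
        intro h5
        apply h4.1
        rw [← h5]
        rw [sub18_eq]
        change (c.enter j + 18 - c.enter j) % 18 = 0
        omega
    · refine hasState_lor (hasState_stateSet hE hW0 hW ?_)
      rw [blt_iff]
      change c.width j < c.angle j (c.v i)
      have h0 : c.angle j (c.v i) ≠ 0 := fun h4 => by
        have h5 := c.v_congr (c.angle_eq_zero h (Ne.symm hij) h4) 1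
        rw [sub_add_cancel] at h5
        apply h2
        rw [← h5]; rfl
      have h0' : c.angle j (c.v i) ≠ c.width j := fun h4 => by
        have h5 := c.v_congr (c.angle_eq_width h (Ne.symm hij) h4) (-1)
        rw [add_neg_cancel_right] at h5
        apply h1
        rw [← h5]
        change sub18 (c.enter i) (c.enter i) = 0
        rw [sub18_eq]; omega
      by_contra hcon
      exact h3 (c.consistent j i hij h0 (show c.angle j (c.v i) < c.width j by omega)).2
  · intro x hx
    have hb := hbit x 0 (by omega)
    rw [Nat.add_zero] at hb
    rw [hb]
    have h1 : c.angle i x ≠ 0 := fun h4 => hx _ (c.angle_eq_zero h (hx i).symm h4).symm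
    have h2 : c.angle i x ≠ c.width i := fun h4 => hx _ (c.angle_eq_width h (hx i).symm h4).symm
    have h3 : ¬ c.angle i x < c.width i := not_lt.2 (c.off i x hx)
    unfold maskRow
    rw [if_neg (val_sub_ne_zero (hx i).symm)]
    unfold LeftCut.angle at h1 h2 h3
    rw [if_neg h1, if_neg h2, if_neg h3]
    exact testBit_one_lor _

theorem allows_startDomain (c : LeftCut pos) (h0 : c.v 0 = 0) : c.Allows SearchTask.startDomain := by
  have hf : ∀ x, (Bool.rec (Nat.lor 1 anyState) anyState (Nat.beq x 0) : ℕ) < 2 ^ 666 := fun x => by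
    cases Nat.beq x 0
    · exact one_lor_stateSet_lt _
    · exact stateSet_lt' _
  have hbit : ∀ (x : ZMod 19) (b : ℕ), b < 666 →
      SearchTask.startDomain.testBit (666 * x.val + b) =
        (Bool.rec (Nat.lor 1 anyState) anyState (Nat.beq x.val 0) : ℕ).testBit b := fun x b hb => by
    refine (testBit_pack (w := 666) (n := 19) (fun j _ => hf j) hb).trans ?_
    rw [decide_eq_true (ZMod.val_lt x), Bool.true_and]
  constructor
  · intro i
    have hE := c.enter_lt h i
    have hW := c.width_lt i
    have hs : HasState anyState.testBit (c.enter i) (c.width i) :=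
      hasState_stateSet hE (c.width_pos h i) hW rfl
    have hs2 : HasState (Bool.rec (Nat.lor 1 anyState) anyState (Nat.beq (c.v i).val 0) : ℕ).testBit
        (c.enter i) (c.width i) := by
      cases Nat.beq (c.v i).val 0
      · exact hasState_lor hs
      · exact hs
    refine ⟨?_, ?_⟩
    · dsimp only; rw [hbit _ _ (by omega)]; exact hs2.1
    · dsimp only; rw [Nat.add_assoc, hbit _ _ (by omega), ← Nat.add_assoc]; exact hs2.2
  · intro x hx
    have hb := hbit x 0 (by omega)
    rw [Nat.add_zero] at hb
    rw [hb]
    have : ¬ Nat.beq x.val 0 = true := by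
      rw [beq_iff, ZMod.val_eq_zero]
      rintro rfl
      exact hx 0 h0
    rw [boolRec_eq, if_neg this]
    exact testBit_one_lor _

omit h in
theorem cleanRows_startDomain : CleanRows SearchTask.startDomain := by
  intro x hx b hb hb'
  have hlt : Nat.lor 1 anyState < 2 ^ 648 :=
    Nat.or_lt_two_pow (Nat.one_lt_two_pow (by omega)) (stateSet_lt _)
  have hf : ∀ x, (Bool.rec (Nat.lor 1 anyState) anyState (Nat.beq x 0) : ℕ) < 2 ^ 648 := fun x => by
    cases Nat.beq x 0
    · exact hlt
    · exact stateSet_lt _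
  refine (testBit_pack (w := 666) (n := 19) (fun j _ => (hf j).trans two_pow_648_lt) hb').trans ?_
  rw [Nat.testBit_lt_two_pow ((hf x).trans_le (Nat.pow_le_pow_right (by omega) hb)), Bool.and_false]

end Tables

namespace LeftCut

variable {rot pos : List ℕ} {c : LeftCut pos}

theorem Allows.land {d m : ℕ} (h1 : c.Allows d) (h2 : c.Allows m) : c.Allows (Nat.land d m) := by
  have key : ∀ k, d.testBit k = true → m.testBit k = true → (Nat.land d m).testBit k = true :=
    fun k hd hm => by
      change (d &&& m).testBit k = true
      rw [Nat.testBit_and, hd, hm]; rfl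
  exact ⟨fun i => ⟨key _ (h1.1 i).1 (h2.1 i).1, key _ (h1.1 i).2 (h2.1 i).2⟩,
    fun x hx => key _ (h1.2 x hx) (h2.2 x hx)⟩

theorem Allows.nonemptyRows {d : ℕ} (h : ValidTables rot pos) (h1 : c.Allows d) (h2 : CleanRows d) :
    nonemptyRows d = true := by
  refine nonemptyRows_of_bits h2 fun x hx => ?_
  obtain ⟨y, rfl⟩ : ∃ y : ZMod 19, y.val = x := ⟨(x : ZMod 19), ZMod.val_cast_of_lt hx⟩
  by_cases hy : ∃ i, c.v i = y
  · obtain ⟨i, rfl⟩ := hy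
    have hE := c.enter_lt h i
    have hW := c.width_lt i
    exact ⟨_, by omega, (h1.1 i).1⟩
  · push Not at hy
    exact ⟨0, by omega, h1.2 y hy⟩

theorem Allows.le_offCount {d : ℕ} (h1 : c.Allows d) : 19 ≤ offCount d + c.len := by
  classical
  rw [offCount_eq]
  let S : Finset ℕ := (Finset.range c.len).image fun k : ℕ => (c.v (k : ℤ)).val
  have hS : S.card ≤ c.len := Finset.card_image_le.trans (by rw [Finset.card_range])
  have h2 : (Finset.range 19 \ S).card ≤ ∑ x ∈ Finset.range 19, (d.testBit (666 * x)).toNat := by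
    rw [Finset.card_eq_sum_ones]
    calc ∑ x ∈ Finset.range 19 \ S, 1
        = ∑ x ∈ Finset.range 19 \ S, (d.testBit (666 * x)).toNat := by
          refine Finset.sum_congr rfl fun x hx => ?_
          rw [Finset.mem_sdiff, Finset.mem_range] at hx
          have hv : ((x : ZMod 19)).val = x := ZMod.val_cast_of_lt hx.1
          have := h1.2 (x : ZMod 19) fun i hi => hx.2 (Finset.mem_image.2 ⟨(i % c.len).toNat, ?_, ?_⟩)
          · rw [hv] at this
            rw [this]; rfl
          · have h3 : (0 : ℤ) < c.len := by have := c.three_le; omega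
            have := Int.emod_nonneg i h3.ne'
            have := Int.emod_lt_of_pos i h3
            rw [Finset.mem_range]; omega
          · have h3 : (0 : ℤ) < c.len := by have := c.three_le; omega
            have h4 := Int.emod_nonneg i h3.ne'
            rw [Int.toNat_of_nonneg h4]
            rw [← hv, ← hi]
            congr 1
            refine c.v_eq_of_dvd ?_
            rw [← dvd_neg, neg_sub]
            exact Int.dvd_self_sub_emod
      _ ≤ _ := Finset.sum_le_sum_of_subset Finset.sdiff_subset
  have h3 := Finset.le_card_sdiff S (Finset.range 19)
  rw [Finset.card_range] at h3
  omega

end LeftCut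

/-! ### Soundness of the search -/

/-- On a cyclic sequence with mean `n / l`, start where the partial sums of the differences to the mean
are minimal: then all averages of initial segments are at least the mean, and all averages backwards
from this point are at most the mean. -/
theorem exists_forward_high_backward_low (l : ℕ) (hl : 0 < l) (w : ℤ → ℕ) (hw : ∀ i, w (i + l) = w i)
    {n : ℕ} (hn : ∑ k ∈ Finset.range l, w k = n) : ∃ i : ℤ,
      (∀ j : ℕ, n * j ≤ l * ∑ k ∈ Finset.range j, w (i + k)) ∧
      (∀ j : ℕ, l * ∑ k ∈ Finset.range j, w (i + (-1 - k)) ≤ n * j) ∧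
      ∑ k ∈ Finset.range l, w (i + k) = n := by
  let S : ℕ → ℕ := fun j => ∑ k ∈ Finset.range j, w k
  have hS1 : ∀ j, S (j + 1) = S j + w j := fun j => Finset.sum_range_succ _ _
  have hSl : ∀ j, S (j + l) = S j + n := by
    intro j
    induction j with
    | zero => simpa [S] using hn
    | succ j ih =>
      rw [show j + 1 + l = j + l + 1 by ring, hS1, hS1, ih]
      push_cast
      rw [hw]; ring
  have hadd : ∀ i j, S (i + j) = S i + ∑ k ∈ Finset.range j, w (i + k) := by
    intro i j
    simp only [S, Finset.sum_range_add]
    push_cast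
    rfl
  have hsub : ∀ i j, j ≤ i → S i = S (i - j) + ∑ k ∈ Finset.range j, w (i + (-1 - k)) := by
    intro i j
    induction j with
    | zero => intro _; simp
    | succ j ih =>
      intro hj
      rw [ih (by omega), Finset.sum_range_succ, show i - j = i - (j + 1) + 1 by omega, hS1,
        show ((i - (j + 1) : ℕ) : ℤ) = i + (-1 - j) by push_cast [Nat.cast_sub hj]; ring]
      ring
  -- `G` is `l` times the partial sum of the differences to the mean; it has period `l`.
  let G : ℕ → ℤ := fun j => l * S j - n * j
  have hG : ∀ j m, G (j + m * l) = G j := by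
    intro j m
    induction m with
    | zero => simp
    | succ m ih =>
      rw [← ih, show j + (m + 1) * l = j + m * l + l by ring]
      simp only [G, hSl]
      push_cast; ring
  obtain ⟨i, -, hi⟩ := Finset.exists_min_image (Finset.range l) G ⟨0, Finset.mem_range.2 hl⟩
  have hmin : ∀ j, G i ≤ G j := by
    intro j
    have := hi (j % l) (Finset.mem_range.2 (Nat.mod_lt _ hl))
    rwa [← hG (j % l) (j / l), Nat.mod_add_div'] at this
  refine ⟨i, fun j => ?_, fun j => ?_, ?_⟩
  · have h1 := hmin (i + j)
    simp only [G, hadd] at h1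
    push_cast at h1
    zify
    linarith
  · have h1 := hmin (i + j * l - j)
    have hj : j ≤ i + j * l := (Nat.le_mul_of_pos_right j hl).trans (Nat.le_add_left _ _)
    have h2 := hsub (i + j * l) j hj
    have h3 := hG i j
    have h4 : ∑ k ∈ Finset.range j, w (((i + j * l : ℕ) : ℤ) + (-1 - k)) =
        ∑ k ∈ Finset.range j, w (i + (-1 - k)) := by
      refine Finset.sum_congr rfl fun k _ => ?_
      have hp : Function.Periodic w (l : ℤ) := hw
      have := hp.int_mul j (i + (-1 - k))
      rw [← this]
      congr 1
      push_cast; ring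
    rw [h4] at h2
    rw [← h3] at h1
    simp only [G, h2] at h1
    push_cast [Nat.cast_sub hj] at h1
    zify
    linarith
  · have h1 := hadd i l
    rw [hSl] at h1
    omega

theorem row_eq {x b : ℕ} (hb : b < 666) : row (666 * x + b) = x := by
  change (666 * x + b) / 666 = x
  omega

theorem col_eq {x p : ℕ} (hp : p < 37) : col (666 * x + 18 * p) = p := by
  change (666 * x + 18 * p) % 666 / 18 = p
  omega

theorem neighborTable_slice {rot pos : List ℕ} (h : ValidTables rot pos) {x p b : ℕ} (hx : x < 19)
    (hp : p < 37) (hb : b = nthD 0 rot (p % 18)) :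
    slice (neighborTable rot pos) (666 * x + 18 * p) =
      666 * ((x + b) % 19) + 18 * nthD 0 pos (19 - b) := by
  let f : ℕ → ℕ := fun i => 18 * (37 * ((i / 37 + nthD 0 rot (i % 37 % 18)) % 19) +
    nthD 0 pos (19 - nthD 0 rot (i % 37 % 18)))
  have hN : neighborTable rot pos = pack 18 f 703 := pack_congr fun i _ => rfl
  have hf : ∀ i, f i < 2 ^ 18 := by
    intro i
    change 18 * (37 * ((i / 37 + nthD 0 rot (i % 37 % 18)) % 19) +
      nthD 0 pos (19 - nthD 0 rot (i % 37 % 18))) < 2 ^ 18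
    have h0 := h.rot_ne (i % 37 % 18) (Nat.mod_lt _ (by decide))
    have h1 := h.pos_lt (19 - nthD 0 rot (i % 37 % 18)) (by omega)
    omega
  rw [hN, show 666 * x + 18 * p = 18 * (37 * x + p) by ring, slice_pack (fun j _ => hf j) (by omega)]
  change 18 * (37 * (((37 * x + p) / 37 + nthD 0 rot ((37 * x + p) % 37 % 18)) % 19) +
    nthD 0 pos (19 - nthD 0 rot ((37 * x + p) % 37 % 18))) = _
  rw [show (37 * x + p) / 37 = x by omega, show (37 * x + p) % 37 = p by omega, ← hb]
  ring

namespace LeftCut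

variable {rot pos : List ℕ} (c : LeftCut pos)

/-- The code of the forward end of a path. -/
def front (i : ℤ) : ℕ := 666 * (c.v i).val + 18 * c.enter i

/-- The code of the backward end of a path. -/
def back (i : ℤ) : ℕ := 666 * (c.v i).val + 324 + 18 * c.leave i

variable (h : ValidTables rot pos)
include h

theorem row_front (i : ℤ) : row (c.front i) = (c.v i).val :=
  row_eq (by have := c.enter_lt h i; omega)

theorem row_back (i : ℤ) : row (c.back i) = (c.v i).val := by
  rw [back, Nat.add_assoc]
  exact row_eq (by have := c.leave_lt h i; omega)

theorem col_front (i : ℤ) : col (c.front i) = c.enter i :=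
  col_eq (by have := c.enter_lt h i; omega)

theorem col_back (i : ℤ) : col (c.back i) = 18 + c.leave i := by
  rw [back, show 666 * (c.v i).val + 324 + 18 * c.leave i =
    666 * (c.v i).val + 18 * (18 + c.leave i) by ring]
  exact col_eq (by have := c.leave_lt h i; omega)

theorem neighbor_of_pos {x y : ZMod 19} (hxy : y ≠ x) {p : ℕ} (hp : p < 37)
    (hq : p % 18 = nthD 0 pos (y - x).val) :
    slice (neighborTable rot pos) (666 * x.val + 18 * p) =
      666 * y.val + 18 * nthD 0 pos (x - y).val := by
  have hne := val_sub_ne_zero hxy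
  rw [neighborTable_slice h (ZMod.val_lt x) hp (b := (y - x).val)
    (by rw [hq, h.rot_pos _ (ZMod.val_lt _) hne]), nineteen_sub_val hxy, ← ZMod.val_add,
    add_sub_cancel]

theorem neighbor_front (i : ℤ) :
    slice (neighborTable rot pos) (c.front i + 18 * c.width i) = c.front (i + 1) := by
  have h1 := c.enter_lt h i
  have h2 := c.width_lt i
  rw [front, Nat.add_assoc, ← Nat.mul_add, neighbor_of_pos h (c.v_succ_ne i) (by omega)
    (c.leave_eq h i).symm, front, enter, add_sub_cancel_right]

theorem neighbor_back (i : ℤ) :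
    slice (neighborTable rot pos) (c.back i - 18 * c.width i) =
      666 * (c.v (i - 1)).val + 18 * c.leave (i - 1) := by
  have h1 := c.leave_lt h i
  have h2 := c.width_lt i
  have h3 := c.leave_eq h i
  have h4 := c.enter_lt h i
  rw [back, show 666 * (c.v i).val + 324 + 18 * c.leave i - 18 * c.width i =
    666 * (c.v i).val + 18 * (18 + c.leave i - c.width i) by omega,
    neighbor_of_pos h (c.v_pred_ne i) (by omega) (show _ = c.enter i by omega), leave, sub_add_cancel]

end LeftCut

theorem maskTableBack_entry {ms : List (List ℕ)} {b w : ℕ} (hb : b < 18) (hw : w < 18) :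
    nthD 0 (nthD [] (maskTableBack ms) b) w = nthD 0 (nthD [] ms (sub18 b w)) w := by
  unfold maskTableBack
  rw [nthD_tabulate _ _ hb, nthD_tabulate _ _ hw]

/-- The tables of a search task are those of the rotation given by `rot` and `pos`. -/
structure SearchTask.IsFor (T : SearchTask) (rot pos : List ℕ) : Prop where
  nbr : T.nbr = neighborTable rot pos
  masks : T.masks = maskTable pos
  masksBack : T.masksBack = maskTableBack (maskTable pos)

namespace SearchTask

open LeftCut

variable {T : SearchTask} {rot pos : List ℕ} (h : ValidTables rot pos) (hT : T.IsFor rot pos)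
  (c : LeftCut pos)

include h in
theorem viable_of_allows {dom : ℕ} (ha : c.Allows dom) (hc : CleanRows dom) (hlen : c.len ≤ T.maxLen) :
    T.viable dom = true := by
  unfold viable
  rw [select_eq, if_pos (ha.nonemptyRows h hc), ble_iff]
  change 19 - T.maxLen ≤ _
  have := ha.le_offCount
  omega

theorem bad_of_closeUp {len tot dom : ℕ} (ha : c.Allows dom) (hlen : len = c.len) (htot : tot = c.total)
    (hs : T.closeUp len tot dom = true) : T.bad c.len c.total = false := by
  subst hlen htot
  unfold closeUp at hs
  rw [select_eq] at hs
  by_contra hb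
  rw [Bool.not_eq_false] at hb
  rw [if_pos hb, blt_iff] at hs
  change _ < 19 - c.len at hs
  have := ha.le_offCount
  omega

/-- The sum over one period, as the sum over a path of all terms but one to both sides of term `0`, plus
the remaining term. -/
theorem total_eq {m n : ℕ} (hmn : m + n + 1 = c.len) {f : ℤ → ℕ} (hf : ∀ i, f (i + c.len) = f i) :
    ∑ k ∈ Finset.range c.len, f k =
      ∑ k ∈ Finset.range m, f k + f m + ∑ k ∈ Finset.range n, f (-1 - k) := by
  rw [← hmn, Nat.add_right_comm, Finset.sum_range_add, Finset.sum_range_succ]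
  congr 1
  rw [← Finset.sum_range_reflect]
  refine Finset.sum_congr rfl fun k hk => ?_
  rw [Finset.mem_range] at hk
  rw [← hf (-1 - k), ← hmn]
  congr 1
  omega

theorem forwardChoices_lt (T : SearchTask) (dom F sf m : ℕ) : T.forwardChoices dom F sf m < 2 ^ 18 := by
  refine Nat.lt_of_le_of_lt ?_ (slice_lt dom F)
  generalize ht : Nat.sub (Nat.div (Nat.add (Nat.mul T.loNum (Nat.succ m)) (Nat.pred T.loDen)) T.loDen)
    sf = t
  change (slice dom F >>>
    (Nat.sub (Nat.div (Nat.add (Nat.mul T.loNum (Nat.succ m)) (Nat.pred T.loDen)) T.loDen) sf)) <<< _ ≤ _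
  rw [Nat.shiftRight_eq_div_pow, Nat.shiftLeft_eq]
  exact Nat.div_mul_le_self _ _

theorem testBit_forwardChoices (T : SearchTask) {dom F sf m w : ℕ} (hlo : 0 < T.loDen) (hw : w < 18)
    (h1 : T.loNum * (m + 1) ≤ T.loDen * (sf + w)) (h2 : dom.testBit (F + w) = true) :
    (T.forwardChoices dom F sf m).testBit w = true := by
  change ((slice dom F >>> ((T.loNum * (m + 1) + (T.loDen - 1)) / T.loDen - sf)) <<<
    ((T.loNum * (m + 1) + (T.loDen - 1)) / T.loDen - sf)).testBit w = true
  have h3 : (T.loNum * (m + 1) + (T.loDen - 1)) / T.loDen ≤ sf + w := by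
    refine Nat.le_of_lt_succ ((Nat.div_lt_iff_lt_mul hlo).2 ?_)
    rw [Nat.succ_mul, Nat.mul_comm _ T.loDen]
    omega
  rw [Nat.testBit_shiftLeft, decide_eq_true (by omega), Bool.true_and, Nat.testBit_shiftRight,
    Nat.add_sub_cancel' (by omega), testBit_slice hw, h2]

theorem backwardChoices_lt (T : SearchTask) (dom B sb n : ℕ) : T.backwardChoices dom B sb n < 2 ^ 18 :=
  Nat.lt_of_le_of_lt (Nat.mod_le _ _) (slice_lt dom B)

theorem testBit_backwardChoices (T : SearchTask) {dom B sb n w : ℕ} (hhi : 0 < T.hiDen) (hw : w < 18)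
    (h1 : T.hiDen * (sb + w) ≤ T.hiNum * (n + 1)) (h2 : dom.testBit (B + w) = true) :
    (T.backwardChoices dom B sb n).testBit w = true := by
  change (slice dom B % (1 <<< ((T.hiNum * (n + 1)) / T.hiDen + 1 - sb))).testBit w = true
  have h3 : sb + w ≤ T.hiNum * (n + 1) / T.hiDen := by
    rw [Nat.le_div_iff_mul_le hhi, Nat.mul_comm]
    exact h1
  rw [Nat.shiftLeft_eq, Nat.one_mul, Nat.testBit_mod_two_pow, decide_eq_true (by omega), Bool.true_and,
    testBit_slice hw, h2]

include h hT

/-- The search never answers `true` while it follows a cycle that is to be excluded. The proof follows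
the branch of the search that takes the actual widths of the cycle. -/
theorem bad_eq_false_of_search (hlen : c.len ≤ T.maxLen) (hlo : 0 < T.loDen) (hhi : 0 < T.hiDen)
    (hF : ∀ j, T.loNum * j ≤ T.loDen * ∑ k ∈ Finset.range j, c.width k)
    (hB : ∀ j, T.hiDen * ∑ k ∈ Finset.range j, c.width (-1 - k) ≤ T.hiNum * j) :
    ∀ (fuel dom m n : ℕ), fuel + (m + n + 1) = T.maxLen → m + n + 2 ≤ c.len → 1 ≤ m →
      c.Allows dom → CleanRows dom →
      T.search fuel dom (c.front m) (c.back (-1 - n)) (∑ k ∈ Finset.range m, c.width k)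
        (∑ k ∈ Finset.range n, c.width (-1 - k)) m n = true →
      T.bad c.len c.total = false := by
  intro fuel
  induction fuel with
  | zero => intro dom m n h1 h2; omega
  | succ fuel ih =>
    intro dom m n hfuel hmn hm ha hc hs
    have hclose : c.v (m + 1) = c.v (-1 - n) → m + n + 2 = c.len := fun he => by
      have h1 := c.inj _ _ he
      rw [show (m : ℤ) + 1 - (-1 - n) = ((m + n + 2 : ℕ) : ℤ) by push_cast; ring] at h1
      have := Nat.le_of_dvd (by omega) (Int.natCast_dvd_natCast.1 h1)
      omega
    change T.branch (T.search fuel) dom (c.front m) (c.back (-1 - n)) _ _ m n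
      (T.forwardChoices dom (c.front m) _ m) (T.backwardChoices dom (c.back (-1 - n)) _ n) = true at hs
    have hs2 : T.forward (T.search fuel) (nthD [] T.masks (col (c.front m))) dom (c.front m)
          (c.back (-1 - n)) (∑ k ∈ Finset.range m, c.width k)
          (∑ k ∈ Finset.range n, c.width (-1 - k)) m n
          (T.forwardChoices dom (c.front m) (∑ k ∈ Finset.range m, c.width k) m) = true ∨
        T.backward (T.search fuel) (nthD [] T.masksBack (col (c.back (-1 - n)) - 18)) dom (c.front m)
          (c.back (-1 - n)) (∑ k ∈ Finset.range m, c.width k)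
          (∑ k ∈ Finset.range n, c.width (-1 - k)) m n
          (T.backwardChoices dom (c.back (-1 - n)) (∑ k ∈ Finset.range n, c.width (-1 - k)) n) = true := by
      unfold branch at hs
      rw [select_eq] at hs
      split_ifs at hs
      · exact Or.inl hs
      · exact Or.inr hs
    rcases hs2 with hs | hs
    · have hw := c.width_lt m
      have hF1 := hF (m + 1)
      rw [Finset.sum_range_succ] at hF1
      have h1 := allBits_spec (forwardChoices_lt _ _ _ _ _) hs _
        (testBit_forwardChoices T hlo hw hF1 (by rw [front, Nat.add_assoc]; exact (ha.1 m).1))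
      have hnb : T.neighbor (c.front m + 18 * c.width m) = c.front (m + 1) := by
        rw [neighbor, hT.nbr, c.neighbor_front h]
      change T.forwardStep _ _ _ _ _ _ _ _ _ _ (T.neighbor (c.front m + 18 * c.width m)) = true at h1
      rw [hnb] at h1
      unfold forwardStep at h1
      rw [select_eq] at h1
      split_ifs at h1 with h2
      · rw [beq_iff, c.row_front h, c.row_back h] at h2
        have h3 := ZMod.val_injective 19 h2
        have h4 := hclose h3
        refine bad_of_closeUp c ha h4 ?_ h1
        rw [c.col_back h, c.col_front h, ← c.leave_congr h3, total,
          total_eq c (m := m + 1) (n := n) (by omega) c.width_periodic, Finset.sum_range_succ]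
        have h5 : sub18 (18 + c.leave (m + 1)) (c.enter (m + 1)) = c.width (m + 1) := by
          have := c.enter_lt h (m + 1)
          rw [width, sub18_eq, sub18_eq]
          omega
        rw [h5]
        change ∑ k ∈ Finset.range m, c.width k + ∑ k ∈ Finset.range n, c.width (-1 - k) +
          (c.width m + c.width (m + 1)) = _
        push_cast
        ring
      · have ha2 := ha.land (allows_mask h c m)
        have hc2 := hc.land (rotateMask (nthD 0 (nthD [] T.masks (c.enter m)) (c.width m)) (c.v m).val)
        rw [← hT.masks] at ha2
        unfold forwardExtend at h1
        rw [c.row_front h, c.col_front h] at h1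
        unfold forwardNext at h1
        rw [viable_of_allows h c ha2 hc2 hlen] at h1
        refine ih _ (m + 1) n (by omega) ?_ (by omega) ha2 hc2 ?_
        · by_contra hcon
          apply h2
          rw [beq_iff, c.row_front h, c.row_back h]
          congr 1
          refine c.v_eq_of_dvd ⟨1, ?_⟩
          omega
        · rw [Finset.sum_range_succ]
          exact_mod_cast h1
    · have hw := c.width_lt (-1 - n)
      have hB1 := hB (n + 1)
      rw [Finset.sum_range_succ] at hB1
      have hbit := (ha.1 (-1 - n)).2
      rw [← c.leave_eq h] at hbit
      have hcode : c.back (-1 - n) + c.width (-1 - n) = 666 * (c.v (-1 - n)).val +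
          (324 + 18 * c.leave (-1 - n) + c.width (-1 - n)) := by rw [back]; ring
      have h1 := allBits_spec (backwardChoices_lt _ _ _ _ _) hs _
        (testBit_backwardChoices T hhi hw hB1 (by rw [hcode]; exact hbit))
      have hnb : T.neighbor (c.back (-1 - n) - 18 * c.width (-1 - n)) =
          666 * (c.v (-1 - n - 1)).val + 18 * c.leave (-1 - n - 1) := by
        rw [neighbor, hT.nbr, c.neighbor_back h]
      change T.backwardStep _ _ _ _ _ _ _ _ _ _
        (T.neighbor (c.back (-1 - n) - 18 * c.width (-1 - n))) = true at h1
      rw [hnb] at h1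
      have hlt := c.leave_lt h (-1 - n - 1)
      unfold backwardStep at h1
      rw [select_eq, row_eq (by omega)] at h1
      split_ifs at h1 with h2
      · rw [beq_iff, c.row_front h] at h2
        have h3 := ZMod.val_injective 19 h2
        have h4 : m + n + 2 = c.len := by
          refine hclose ?_
          have := c.v_congr h3 1
          rw [sub_add_cancel] at this
          exact this.symm
        refine bad_of_closeUp c ha h4 ?_ h1
        rw [c.col_front h, col_eq (by omega), c.leave_congr h3, total,
          total_eq c (m := m) (n := n + 1) (by omega) c.width_periodic, Finset.sum_range_succ]
        change ∑ k ∈ Finset.range m, c.width k + ∑ k ∈ Finset.range n, c.width (-1 - k) +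
          (c.width (-1 - n) + c.width m) = _
        ring
      · have ha2 := ha.land (allows_mask h c (-1 - n))
        have hc2 := hc.land (rotateMask (nthD 0 (nthD [] T.masks (c.enter (-1 - n))) (c.width (-1 - n)))
          (c.v (-1 - n)).val)
        rw [← hT.masks] at ha2
        unfold backwardExtend at h1
        rw [c.row_back h, c.col_back h, hT.masksBack, Nat.add_sub_cancel_left,
          maskTableBack_entry (c.leave_lt h _) hw,
          show sub18 (c.leave (-1 - n)) (c.width (-1 - n)) = c.enter (-1 - n) by
            have := c.leave_eq h (-1 - n)
            have := c.enter_lt h (-1 - n)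
            rw [sub18_eq]; omega, ← hT.masks] at h1
        unfold backwardNext at h1
        rw [viable_of_allows h c ha2 hc2 hlen] at h1
        refine ih _ m (n + 1) (by omega) ?_ hm ha2 hc2 ?_
        · by_contra hcon
          apply h2
          rw [beq_iff, c.row_front h]
          congr 1
          refine c.v_eq_of_dvd ⟨-1, ?_⟩
          omega
        · rw [Finset.sum_range_succ]
          have h5 : ((-1 : ℤ) - n - 1) = -1 - ((n + 1 : ℕ) : ℤ) := by push_cast; ring
          rw [h5] at h1
          have h6 : c.back (-1 - ((n + 1 : ℕ) : ℤ)) = 666 * (c.v (-1 - ((n + 1 : ℕ) : ℤ))).val +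
              18 * c.leave (-1 - ((n + 1 : ℕ) : ℤ)) + 324 := by
            rw [back]; ring
          rw [h6]
          exact h1

/-- If the search gives `true` from every state of the first vertex, then no cycle that meets the
bounds of the task is to be excluded. -/
theorem bad_eq_false_of_searchAll (hsearch : ∀ a < 18, T.searchAll a = true) (hlen : c.len ≤ T.maxLen)
    (hlo : 0 < T.loDen) (hhi : 0 < T.hiDen) (hF : T.loNum * c.len ≤ T.loDen * c.total)
    (hB : T.hiDen * c.total ≤ T.hiNum * c.len) : T.bad c.len c.total = false := by
  have hl : 0 < c.len := by have := c.three_le; omega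
  obtain ⟨i, hi1, hi2, hi3⟩ := exists_forward_high_backward_low c.len hl c.width c.width_periodic rfl
  let s := c.shift i
  have hsl : s.len = c.len := rfl
  have hsw : ∀ j, s.width j = c.width (i + j) := c.shift_width i
  have hst : s.total = c.total := by
    rw [total, hsl]
    simp only [hsw]
    exact hi3
  have hsF : ∀ j, T.loNum * j ≤ T.loDen * ∑ k ∈ Finset.range j, s.width k := fun j => by
    refine Nat.le_of_mul_le_mul_left ?_ hl
    calc c.len * (T.loNum * j) = T.loNum * c.len * j := by ring
      _ ≤ T.loDen * c.total * j := Nat.mul_le_mul_right j hF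
      _ = T.loDen * (c.total * j) := by ring
      _ ≤ T.loDen * (c.len * ∑ k ∈ Finset.range j, c.width (i + k)) := Nat.mul_le_mul_left _ (hi1 j)
      _ = c.len * (T.loDen * ∑ k ∈ Finset.range j, s.width k) := by simp only [hsw]; ring
  have hsB : ∀ j, T.hiDen * ∑ k ∈ Finset.range j, s.width (-1 - k) ≤ T.hiNum * j := fun j => by
    refine Nat.le_of_mul_le_mul_left ?_ hl
    calc c.len * (T.hiDen * ∑ k ∈ Finset.range j, s.width (-1 - k))
        = T.hiDen * (c.len * ∑ k ∈ Finset.range j, c.width (i + (-1 - k))) := by simp only [hsw]; ring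
      _ ≤ T.hiDen * (c.total * j) := Nat.mul_le_mul_left _ (hi2 j)
      _ = T.hiDen * c.total * j := by ring
      _ ≤ T.hiNum * c.len * j := Nat.mul_le_mul_right j hB
      _ = c.len * (T.hiNum * j) := by ring
  have h0 : s.v 0 = 0 := c.shift_v_zero i
  have hw := s.width_lt 0
  have hE := s.enter_lt h 0
  have hN := s.leave_eq h 0
  have hbit : (262142).testBit (s.width 0) = true := by
    have key : ∀ w < 18, 0 < w → (262142).testBit w = true := by decide
    exact key _ hw (s.width_pos h 0)
  -- The number `262142` is `2 ^ 18 - 2`: its bits are those of all possible widths.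
  have h1 := allBits_spec (by norm_num) (hsearch _ hE) _ hbit
  rw [select_eq, if_pos (by
    rw [ble_iff]
    have := hsF 1
    simp only [Finset.sum_range_one, Nat.mul_one] at this
    exact this)] at h1
  have ha := (allows_startDomain h s h0).land (allows_mask h s 0)
  have hc := cleanRows_startDomain.land
    (rotateMask (nthD 0 (nthD [] T.masks (s.enter 0)) (s.width 0)) (s.v 0).val)
  rw [← hT.masks] at ha
  have hv0 : (s.v 0).val = 0 := by rw [h0]; rfl
  have h2 : T.neighbor (18 * (s.enter 0 + s.width 0)) = s.front 1 := by
    rw [neighbor, hT.nbr]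
    have := s.neighbor_front h 0
    rw [front, hv0, Nat.mul_zero, Nat.zero_add, ← Nat.mul_add] at this
    exact this
  have h3 : T.neighbor (18 * s.enter 0) + 324 = s.back (-1) := by
    rw [neighbor, hT.nbr]
    have h4 := neighbor_of_pos h (s.v_pred_ne 0) (p := s.enter 0) (by omega) (Nat.mod_eq_of_lt hE)
    rw [hv0, Nat.mul_zero, Nat.zero_add] at h4
    rw [h4, back, leave]
    norm_num
    ring
  unfold searchFrom at h1
  have h5 := bad_eq_false_of_search h hT s (hsl ▸ hlen) hlo hhi hsF hsB (T.maxLen - 2) _ 1 0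
    (by have := c.three_le; omega) (by have := c.three_le; omega) le_rfl ha hc
  rw [hst, hsl] at h5
  apply h5
  simp only [Finset.sum_range_one, Finset.sum_range_zero]
  rw [hv0, Nat.cast_one, Nat.cast_zero, sub_zero, ← h2, ← h3]
  exact h1

end SearchTask

/-! ### Lengths and widths excluded by the search -/

namespace LeftCut

variable {rot pos : List ℕ} (c : LeftCut pos)

theorem exists_index (i : ℤ) : ∃ k < c.len, c.v i = c.v (k : ℤ) := by
  have h3 : (0 : ℤ) < c.len := by have := c.three_le; omega
  have h4 := Int.emod_nonneg i h3.ne'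
  have h5 := Int.emod_lt_of_pos i h3
  refine ⟨(i % c.len).toNat, by omega, c.v_eq_of_dvd ?_⟩
  rw [Int.toNat_of_nonneg h4]
  exact Int.dvd_self_sub_emod

/-- The set of the terms of the sequence. -/
def support : Finset (ZMod 19) := (Finset.range c.len).image fun k : ℕ => c.v k

theorem mem_support (i : ℤ) : c.v i ∈ c.support := by
  obtain ⟨k, hk, h⟩ := c.exists_index i
  exact Finset.mem_image.2 ⟨k, Finset.mem_range.2 hk, h.symm⟩

theorem card_support : c.support.card = c.len := by
  rw [support, Finset.card_image_of_injOn, Finset.card_range]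
  intro i hi j hj hij
  rw [Finset.coe_range, Set.mem_Iio] at hi hj
  have h3 : (i : ℤ) % c.len = (j : ℤ) % c.len :=
    Int.emod_eq_emod_iff_emod_sub_eq_zero.2 (Int.emod_eq_zero_of_dvd (c.inj _ _ hij))
  rw [Int.emod_eq_of_lt (by omega) (by omega), Int.emod_eq_of_lt (by omega) (by omega)] at h3
  exact_mod_cast h3

theorem len_le : c.len ≤ 19 := by
  rw [← c.card_support]
  exact (Finset.card_le_univ _).trans_eq (ZMod.card 19)

theorem exists_eq_of_len (h : c.len = 19) (x : ZMod 19) : ∃ i, c.v i = x := by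
  have h1 : c.support = Finset.univ := Finset.eq_univ_of_card _ (by rw [c.card_support, h, ZMod.card])
  have h2 : x ∈ c.support := by rw [h1]; exact Finset.mem_univ x
  obtain ⟨k, -, hk⟩ := Finset.mem_image.1 h2
  exact ⟨_, hk⟩

section Tables

variable (h : ValidTables rot pos)
include h

theorem exists_angle_eq (i : ℤ) {k : ℕ} (hk : k < 18) : ∃ x, x ≠ c.v i ∧ c.angle i x = k := by
  have hE := c.enter_lt h i
  have hp : (c.enter i + k) % 18 < 18 := Nat.mod_lt _ (by decide)
  have h1 := h.rot_lt _ hp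
  have h2 : ((nthD 0 rot ((c.enter i + k) % 18) : ℕ) : ZMod 19).val =
    nthD 0 rot ((c.enter i + k) % 18) := ZMod.val_cast_of_lt h1
  refine ⟨c.v i + (nthD 0 rot ((c.enter i + k) % 18) : ℕ), fun h3 => ?_, ?_⟩
  · rw [add_eq_left] at h3
    rw [h3, ZMod.val_zero] at h2
    exact h.rot_ne _ hp h2.symm
  · rw [angle, add_sub_cancel_left, h2, h.pos_rot _ hp, sub18_eq]
    omega

/-- The darts to the left at a term of the sequence go to other terms, hence are at most `len - 3`. -/
theorem width_le (i : ℤ) : c.width i + 2 ≤ c.len := by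
  have h1 : (Finset.Ioo 0 (c.width i)).card ≤
      (((c.support.erase (c.v i)).erase (c.v (i - 1))).erase (c.v (i + 1))).card := by
    refine Finset.card_le_card_of_surjOn (c.angle i) fun k hk => ?_
    rw [Finset.coe_Ioo, Set.mem_Ioo] at hk
    obtain ⟨x, hx, hxk⟩ := c.exists_angle_eq h i (hk.2.trans (c.width_lt i))
    refine ⟨x, ?_, hxk⟩
    simp only [Finset.coe_erase, Set.mem_sdiff, Finset.mem_coe, Set.mem_singleton_iff]
    refine ⟨⟨⟨?_, hx⟩, ?_⟩, ?_⟩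
    · by_contra hcon
      have := c.off i x fun j hj => hcon (hj ▸ c.mem_support j)
      change c.width i ≤ c.angle i x at this
      omega
    · rintro rfl
      change sub18 (c.enter i) (c.enter i) = k at hxk
      rw [sub18_eq] at hxk
      omega
    · rintro rfl
      change c.width i = k at hxk
      omega
  have hne : c.v (i - 1) ∈ c.support.erase (c.v i) :=
    Finset.mem_erase.2 ⟨c.v_pred_ne i, c.mem_support _⟩
  have hne2 : c.v (i + 1) ∈ (c.support.erase (c.v i)).erase (c.v (i - 1)) :=
    Finset.mem_erase.2 ⟨c.v_succ_ne_pred i, Finset.mem_erase.2 ⟨c.v_succ_ne i, c.mem_support _⟩⟩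
  rw [Finset.card_erase_of_mem hne2, Finset.card_erase_of_mem hne,
    Finset.card_erase_of_mem (c.mem_support i), c.card_support, Nat.card_Ioo] at h1
  have := c.three_le
  omega

theorem total_le : c.total ≤ c.len * (c.len - 2) := by
  have := Finset.sum_le_card_nsmul (Finset.range c.len) (fun k : ℕ => c.width k) (c.len - 2)
    fun k _ => by have := c.width_le h k; omega
  rwa [Finset.card_range, smul_eq_mul] at this

theorem le_total : c.len ≤ c.total := by
  have := Finset.card_nsmul_le_sum (Finset.range c.len) (fun k : ℕ => c.width k) 1
    fun k _ => c.width_pos h k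
  rwa [Finset.card_range, smul_eq_mul, mul_one] at this

theorem width_rev (i : ℤ) : sub18 (c.enter i) (c.leave i) = 18 - c.width i := by
  have h1 := c.enter_lt h i
  have h2 := c.leave_eq h i
  have h3 := c.width_pos h i
  have h4 := c.width_lt i
  rw [sub18_eq]
  omega

theorem angle_rev (i : ℤ) (x : ZMod 19) : sub18 (nthD 0 pos (x - c.v i).val) (c.leave i) =
    (c.angle i x + 18 - c.width i) % 18 := by
  have h1 := c.enter_lt h i
  have h2 := c.leave_eq h i
  have h3 := c.width_pos h i
  have h4 := c.width_lt i
  have h5 := h.pos_lt _ (ZMod.val_lt (x - c.v i))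
  rw [angle, sub18_eq, sub18_eq]
  omega

/-- Going backwards along a sequence that contains all vertices exchanges left and right. -/
theorem exists_reverse (hlen : c.len = 19) :
    ∃ r : LeftCut pos, r.len = 19 ∧ r.total + c.total = 342 := by
  let r : LeftCut pos :=
    { len := c.len
      three_le := c.three_le
      v := fun i => c.v (-i)
      periodic := fun i => by
        refine c.v_eq_of_dvd ⟨-1, ?_⟩
        ring
      inj := fun i j hij => by
        have := c.inj _ _ hij
        rwa [neg_sub_neg, ← dvd_neg, neg_sub] at this
      consistent := fun i j hij h0 h1 => by
        rw [show -(i - 1) = -i + 1 by ring, show -(i + 1) = -i - 1 by ring] at *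
        rw [show -(j - 1) = -j + 1 by ring, show -(j + 1) = -j - 1 by ring] at *
        have e1 := c.angle_rev h (-i) (c.v (-j))
        have e2 := c.angle_rev h (-j) (c.v (-i))
        have e3 := c.width_rev h (-i)
        have e4 := c.width_rev h (-j)
        unfold leave at e1 e2
        unfold leave enter at e3 e4
        rw [e1] at h0 h1
        rw [e3] at h1
        rw [e2, e4]
        have w1 := c.width_lt (-i)
        have w2 := c.width_lt (-j)
        have w1' := c.width_pos h (-i)
        have w2' := c.width_pos h (-j)
        have a1 : c.angle (-i) (c.v (-j)) < 18 := sub18_lt _ _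
        have a2 : c.angle (-j) (c.v (-i)) < 18 := sub18_lt _ _
        have n1 : c.angle (-j) (c.v (-i)) ≠ 0 := fun h4 => by
          have h5 := c.v_congr (c.angle_eq_zero h hij h4) 1
          rw [sub_add_cancel] at h5
          have : c.angle (-i) (c.v (-j)) = c.width (-i) := by rw [← h5]; rfl
          omega
        have n2 : c.angle (-j) (c.v (-i)) ≠ c.width (-j) := fun h4 => by
          have h5 := c.v_congr (c.angle_eq_width h hij h4) (-1)
          rw [add_neg_cancel_right] at h5
          have : c.angle (-i) (c.v (-j)) = 0 := by
            rw [← h5]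
            change sub18 (c.enter (-i)) (c.enter (-i)) = 0
            rw [sub18_eq]; omega
          omega
        have n3 : ¬ c.angle (-j) (c.v (-i)) < c.width (-j) := fun h4 => by
          have := (c.consistent (-j) (-i) (Ne.symm hij) n1 h4).2
          change c.angle (-i) (c.v (-j)) < c.width (-i) at this
          omega
        omega
      off := fun i x hx => by
        obtain ⟨j, hj⟩ := c.exists_eq_of_len hlen x
        exact absurd (by rw [neg_neg]; exact hj) (hx (-j)) }
  have hw : ∀ i, r.width i = 18 - c.width (-i) := fun i => by
    rw [← c.width_rev h]
    change sub18 (nthD 0 pos (c.v (-(i + 1)) - c.v (-i)).val)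
      (nthD 0 pos (c.v (-(i - 1)) - c.v (-i)).val) = _
    rw [show -(i - 1) = -i + 1 by ring, show -(i + 1) = -i - 1 by ring]
    rfl
  refine ⟨r, hlen, ?_⟩
  have h1 : c.total = ∑ k ∈ Finset.range 19, c.width (-(k : ℕ)) := by
    rw [total, SearchTask.total_eq c (m := 0) (n := 18) (by omega) c.width_periodic,
      Finset.sum_range_succ' _ 18, Finset.sum_range_zero, Nat.zero_add, Nat.add_comm]
    simp only [Nat.cast_zero, neg_zero, add_left_inj]
    refine Finset.sum_congr rfl fun k _ => ?_
    congr 1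
    push_cast; ring
  rw [total, show r.len = 19 from hlen, h1, ← Finset.sum_add_distrib]
  have h2 : ∀ k ∈ Finset.range 19, r.width (k : ℕ) + c.width (-(k : ℕ)) = 18 := fun k _ => by
    rw [hw]
    have := c.width_lt (-(k : ℕ))
    omega
  rw [Finset.sum_congr rfl h2]
  rfl

end Tables

end LeftCut

/-- The bounds of a search: the greatest length, and two fractions between which the average width
lies. -/
structure SearchBounds where
  maxLen : ℕ
  loNum : ℕ
  loDen : ℕ
  hiNum : ℕ
  hiDen : ℕ

/-- A search with the given bounds finds nothing to be excluded. -/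
def SearchBounds.findsNothing (b : SearchBounds) (rot pos ml : List ℕ) : Bool :=
  (List.range 18).all fun a =>
    (mkTask rot pos b.maxLen b.loNum b.loDen b.hiNum b.hiDen (excluded ml)).searchAll a

/-- The cycles of length `l` with sum `n` of widths are within the bounds. -/
def SearchBounds.covers (b : SearchBounds) (l n : ℕ) : Bool :=
  Nat.ble l b.maxLen && Nat.ble (b.loNum * l) (b.loDen * n) && Nat.ble (b.hiDen * n) (b.hiNum * l) &&
    Nat.blt 0 b.loDen && Nat.blt 0 b.hiDen

/-- Every pair of a length and a sum of widths that is to be excluded is within one of the bounds;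
for length 19, only the sums up to the mean of the two sides are considered. -/
def coveredBy (bs : List SearchBounds) (ml : List ℕ) : Bool :=
  (List.range 20).all fun l => (List.range (l * (l - 2) + 1)).all fun n =>
    Nat.blt n l || (Nat.beq l 19 && Nat.blt 171 n) || !excluded ml l n || bs.any fun b => b.covers l n

/-- Searches whose bounds cover all pairs to be excluded show that no such pair occurs. -/
theorem LeftCut.excluded_eq_false {rot pos ml : List ℕ} {bs : List SearchBounds}
    (h : ValidTables rot pos) (hbs : ∀ b ∈ bs, b.findsNothing rot pos ml = true)
    (hcov : coveredBy bs ml = true) (hsym : ∀ n ≤ 323, 19 ≤ n → excluded ml 19 n = excluded ml 19 (342 - n))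
    (c : LeftCut pos) : excluded ml c.len c.total = false := by
  have key : ∀ c : LeftCut pos, (c.len = 19 → c.total ≤ 171) → excluded ml c.len c.total = false := by
    intro c hc
    have h1 := List.all_eq_true.1 (List.all_eq_true.1 hcov c.len (List.mem_range.2 (by
      have := c.len_le; omega))) c.total (List.mem_range.2 (by have := c.total_le h; omega))
    have h2 : ¬ Nat.blt c.total c.len = true := by
      rw [blt_iff]
      have := c.le_total h
      omega
    have h3 : ¬ (Nat.beq c.len 19 && Nat.blt 171 c.total) = true := by
      rw [Bool.and_eq_true, beq_iff, blt_iff]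
      rintro ⟨h3, h4⟩
      have := hc h3
      omega
    rw [Bool.not_eq_true] at h2 h3
    rw [h2, h3, Bool.false_or, Bool.false_or] at h1
    by_contra hcon
    rw [Bool.not_eq_false] at hcon
    rw [hcon, Bool.not_true, Bool.false_or, List.any_eq_true] at h1
    obtain ⟨b, hb, hbc⟩ := h1
    simp only [SearchBounds.covers, Bool.and_eq_true, ble_iff, blt_iff] at hbc
    obtain ⟨⟨⟨⟨h4, h5⟩, h6⟩, h7⟩, h8⟩ := hbc
    have h9 : ∀ a < 18,
        (mkTask rot pos b.maxLen b.loNum b.loDen b.hiNum b.hiDen (excluded ml)).searchAll a = true :=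
      fun a ha => List.all_eq_true.1 (hbs b hb) a (List.mem_range.2 ha)
    have h10 := SearchTask.bad_eq_false_of_searchAll h ⟨rfl, rfl, rfl⟩ c h9 h4 h7 h8 h5 h6
    exact Bool.false_ne_true (h10.symm.trans hcon)
  by_cases hc : c.len = 19 ∧ 171 < c.total
  · obtain ⟨r, hr, hrt⟩ := c.exists_reverse h hc.1
    have h1 := key r fun _ => by omega
    have h2 := c.total_le h
    have h3 := c.le_total h
    rw [hc.1] at h2 h3
    rw [hc.1, hsym _ h2 h3, ← h1, hr]
    congr 1
    omega
  · exact key c fun h19 => by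
      by_contra hcon
      exact hc ⟨h19, by omega⟩

/-! ### The searches for the three embeddings -/

-- The range of the mean widths is cut into pieces. On each, the greatest length of a cycle to be
-- excluded gives the first bound of the search; a smaller bound forces more vertices to be off the
-- cycle and shortens the search.

/-- Entry `h` is the least length of a splitting cycle of type `h` in embedding A. -/
def minLengthsA : List ℕ := [0, 11, 14, 16, 18]

theorem validTablesA : ValidTables rotA posA := by constructor <;> decide

theorem searchA_average_18_5_to_4_1 :
    SearchBounds.findsNothing ⟨10, 18, 5, 4, 1⟩ rotA posA minLengthsA = true := by decide +kernel

theorem searchA_average_57_13_to_5_1 :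
    SearchBounds.findsNothing ⟨13, 57, 13, 5, 1⟩ rotA posA minLengthsA = true := by decide +kernel

theorem searchA_average_5_1_to_35_6 :
    SearchBounds.findsNothing ⟨17, 5, 1, 35, 6⟩ rotA posA minLengthsA = true := by decide +kernel

theorem searchA_average_111_19_to_9_1 :
    SearchBounds.findsNothing ⟨19, 111, 19, 9, 1⟩ rotA posA minLengthsA = true := by decide +kernel

theorem searchA_average_9_1_to_14_1 :
    SearchBounds.findsNothing ⟨18, 9, 1, 14, 1⟩ rotA posA minLengthsA = true := by decide +kernel

theorem searchA_average_1_1_to_39_19 :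
    SearchBounds.findsNothing ⟨19, 1, 1, 39, 19⟩ rotA posA minLengthsA = true := by decide +kernel

/-- Entry `h` is the least length of a splitting cycle of type `h` in embedding B. -/
def minLengthsB : List ℕ := [0, 10, 14, 18, 19]

theorem validTablesB : ValidTables rotB posB := by constructor <;> decide

theorem searchB_average_11_3_to_4_1 :
    SearchBounds.findsNothing ⟨9, 11, 3, 4, 1⟩ rotB posB minLengthsB = true := by decide +kernel

theorem searchB_average_57_13_to_5_1 :
    SearchBounds.findsNothing ⟨13, 57, 13, 5, 1⟩ rotB posB minLengthsB = true := by decide +kernel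

theorem searchB_average_81_17_to_35_6 :
    SearchBounds.findsNothing ⟨18, 81, 17, 35, 6⟩ rotB posB minLengthsB = true := by decide +kernel

theorem searchB_average_111_19_to_9_1 :
    SearchBounds.findsNothing ⟨19, 111, 19, 9, 1⟩ rotB posB minLengthsB = true := by decide +kernel

theorem searchB_average_9_1_to_44_3 :
    SearchBounds.findsNothing ⟨18, 9, 1, 44, 3⟩ rotB posB minLengthsB = true := by decide +kernel

theorem searchB_average_1_1_to_39_19 :
    SearchBounds.findsNothing ⟨19, 1, 1, 39, 19⟩ rotB posB minLengthsB = true := by decide +kernel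

/-- Entry `h` is the least length of a splitting cycle of type `h` in embedding C. -/
def minLengthsC : List ℕ := [0, 11, 15, 17, 18]

theorem validTablesC : ValidTables rotC posC := by constructor <;> decide

theorem searchC_average_18_5_to_4_1 :
    SearchBounds.findsNothing ⟨10, 18, 5, 4, 1⟩ rotC posC minLengthsC = true := by decide +kernel

theorem searchC_average_30_7_to_5_1 :
    SearchBounds.findsNothing ⟨14, 30, 7, 5, 1⟩ rotC posC minLengthsC = true := by decide +kernel

theorem searchC_average_39_8_to_35_6 :
    SearchBounds.findsNothing ⟨17, 39, 8, 35, 6⟩ rotC posC minLengthsC = true := by decide +kernel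

theorem searchC_average_111_19_to_9_1 :
    SearchBounds.findsNothing ⟨19, 111, 19, 9, 1⟩ rotC posC minLengthsC = true := by decide +kernel

theorem searchC_average_9_1_to_14_1 :
    SearchBounds.findsNothing ⟨18, 9, 1, 14, 1⟩ rotC posC minLengthsC = true := by decide +kernel

theorem searchC_average_1_1_to_39_19 :
    SearchBounds.findsNothing ⟨19, 1, 1, 39, 19⟩ rotC posC minLengthsC = true := by decide +kernel

theorem excluded_eq_falseA (c : LeftCut posA) : excluded minLengthsA c.len c.total = false := by
  refine c.excluded_eq_false validTablesA (bs := [⟨19, 1, 1, 39, 19⟩, ⟨10, 18, 5, 4, 1⟩, ⟨13, 57, 13, 5, 1⟩,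
    ⟨17, 5, 1, 35, 6⟩, ⟨19, 111, 19, 9, 1⟩, ⟨18, 9, 1, 14, 1⟩])
    ?_ (by decide +kernel) (by decide +kernel)
  simp only [List.forall_mem_cons, List.not_mem_nil, false_implies, implies_true, and_true]
  exact ⟨searchA_average_1_1_to_39_19, searchA_average_18_5_to_4_1,
    searchA_average_57_13_to_5_1, searchA_average_5_1_to_35_6,
    searchA_average_111_19_to_9_1, searchA_average_9_1_to_14_1⟩

theorem excluded_eq_falseB (c : LeftCut posB) : excluded minLengthsB c.len c.total = false := by
  refine c.excluded_eq_false validTablesB (bs := [⟨19, 1, 1, 39, 19⟩, ⟨9, 11, 3, 4, 1⟩, ⟨13, 57, 13, 5, 1⟩,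
    ⟨18, 81, 17, 35, 6⟩, ⟨19, 111, 19, 9, 1⟩, ⟨18, 9, 1, 44, 3⟩])
    ?_ (by decide +kernel) (by decide +kernel)
  simp only [List.forall_mem_cons, List.not_mem_nil, false_implies, implies_true, and_true]
  exact ⟨searchB_average_1_1_to_39_19, searchB_average_11_3_to_4_1,
    searchB_average_57_13_to_5_1, searchB_average_81_17_to_35_6,
    searchB_average_111_19_to_9_1, searchB_average_9_1_to_44_3⟩

theorem excluded_eq_falseC (c : LeftCut posC) : excluded minLengthsC c.len c.total = false := by
  refine c.excluded_eq_false validTablesC (bs := [⟨19, 1, 1, 39, 19⟩, ⟨10, 18, 5, 4, 1⟩, ⟨14, 30, 7, 5, 1⟩,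
    ⟨17, 39, 8, 35, 6⟩, ⟨19, 111, 19, 9, 1⟩, ⟨18, 9, 1, 14, 1⟩])
    ?_ (by decide +kernel) (by decide +kernel)
  simp only [List.forall_mem_cons, List.not_mem_nil, false_implies, implies_true, and_true]
  exact ⟨searchC_average_1_1_to_39_19, searchC_average_18_5_to_4_1,
    searchC_average_30_7_to_5_1, searchC_average_39_8_to_35_6,
    searchC_average_111_19_to_9_1, searchC_average_9_1_to_14_1⟩

/-! ### Triangulations by `K₁₉` whose rotations are translates of each other -/

/-- The position, around its origin, of a dart of a covering. -/
def position (pos : List ℕ) (d : ZMod 19 × Arc) : ℕ := nthD 0 pos (d.2 : ZMod 19).val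

/-- `M` is a triangulation whose rotation around each vertex is given by the lists `rot` and
`pos`. -/
structure IsCyclicTriangulation (rot pos : List ℕ) (M : RotationSystem (ZMod 19 × Arc)) : Prop where
  tables : ValidTables rot pos
  rev_fst : ∀ d, (M.rev d).1 = d.1 + d.2
  rev_snd : ∀ d, ((M.rev d).2 : ZMod 19) = -d.2
  rot_fst : ∀ d, (M.rot d).1 = d.1
  position_rot : ∀ d, position pos (M.rot d) = (position pos d + 1) % 18
  face_face_face : ∀ d, M.face (M.face (M.face d)) = d

/-- The dart from one vertex of `K₁₉` to another. -/
def dartBetween (x y : ZMod 19) (h : y ≠ x) : ZMod 19 × Arc := (x, ⟨y - x, sub_ne_zero.2 h⟩)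

theorem dart_ext {d e : ZMod 19 × Arc} (h1 : d.1 = e.1) (h2 : d.1 + d.2 = e.1 + (e.2 : ZMod 19)) :
    d = e := by
  refine Prod.ext h1 (Subtype.ext ?_)
  rw [h1] at h2
  exact add_left_cancel h2

namespace IsCyclicTriangulation

variable {rot pos : List ℕ} {M : RotationSystem (ZMod 19 × Arc)} (hM : IsCyclicTriangulation rot pos M)
include hM

theorem rev_head (d : ZMod 19 × Arc) : (M.rev d).1 + ((M.rev d).2 : ZMod 19) = d.1 := by
  rw [hM.rev_fst, hM.rev_snd]; ring

omit hM in
theorem head_ne (d : ZMod 19 × Arc) : d.1 + (d.2 : ZMod 19) ≠ d.1 := by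
  rw [Ne, add_eq_left]; exact d.2.2

theorem position_lt (d : ZMod 19 × Arc) : position pos d < 18 := hM.tables.pos_lt _ (ZMod.val_lt _)

theorem eq_of_position {d e : ZMod 19 × Arc} (h1 : d.1 = e.1) (h2 : position pos d = position pos e) :
    d = e := by
  refine Prod.ext h1 (Subtype.ext ?_)
  have h3 : nthD 0 pos ((d.2 : ZMod 19) - 0).val = nthD 0 pos ((e.2 : ZMod 19) - 0).val := by
    rw [sub_zero, sub_zero]; exact h2
  exact hM.tables.pos_inj d.2.2 e.2.2 h3

theorem rot_pow (d : ZMod 19 × Arc) (k : ℕ) : ((M.rot ^ k) d).1 = d.1 ∧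
    position pos ((M.rot ^ k) d) = (position pos d + k) % 18 := by
  induction k with
  | zero =>
    have := hM.position_lt d
    simp only [pow_zero, Equiv.Perm.one_apply, true_and]
    omega
  | succ k ih =>
    rw [pow_succ', Equiv.Perm.mul_apply, hM.rot_fst, hM.position_rot, ih.1, ih.2]
    exact ⟨rfl, by omega⟩

/-- Two darts with the same origin differ by a power of the rotation. -/
theorem exists_rot_pow {d e : ZMod 19 × Arc} (h : d.1 = e.1) :
    (M.rot ^ sub18 (position pos e) (position pos d)) d = e := by
  obtain ⟨h1, h2⟩ := hM.rot_pow d (sub18 (position pos e) (position pos d))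
  refine hM.eq_of_position (h1.trans h) ?_
  have := hM.position_lt d
  have := hM.position_lt e
  rw [h2, sub18_eq]
  omega

omit hM in
theorem face_rev (d : ZMod 19 × Arc) : M.face (M.rev d) = M.rot d := by
  change M.rot (M.rev (M.rev d)) = _
  rw [M.rev_rev]

theorem face_fst (d : ZMod 19 × Arc) : (M.face d).1 = d.1 + d.2 := by
  change (M.rot (M.rev d)).1 = _
  rw [hM.rot_fst, hM.rev_fst]

theorem face_ne (d : ZMod 19 × Arc) : M.face d ≠ d := fun h => by
  have := hM.face_fst d
  rw [h] at this
  exact IsCyclicTriangulation.head_ne d this.symm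

end IsCyclicTriangulation

/-! ### The two sides of a separating cycle -/

/-- A cycle of `M`, with darts indexed by the integers modulo its length, and the set of darts on
its left, when this set does not meet its right and when every vertex that is not on the cycle is to
the right. -/
structure LeftSide (M : RotationSystem (ZMod 19 × Arc)) where
  len : ℕ
  three_le : 3 ≤ len
  dart : ℤ → ZMod 19 × Arc
  periodic : ∀ i, dart (i + len) = dart i
  next : ∀ i, (dart (i + 1)).1 = (dart i).1 + (dart i).2
  inj : ∀ i j, (dart i).1 = (dart j).1 → (len : ℤ) ∣ i - j
  left : Finset (ZMod 19 × Arc)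
  face_mem : ∀ d, M.face d ∈ left ↔ d ∈ left
  rev_mem : ∀ d, (∀ i, d ≠ dart i) → (∀ i, d ≠ M.rev (dart i)) → (M.rev d ∈ left ↔ d ∈ left)
  dart_mem : ∀ i, dart i ∈ left
  rev_dart_notMem : ∀ i, M.rev (dart i) ∉ left
  off : ∀ d, (∀ i, (dart i).1 ≠ d.1) → d ∉ left

namespace LeftSide

variable {rot pos : List ℕ} {M : RotationSystem (ZMod 19 × Arc)} (S : LeftSide M)

theorem dart_eq_of_dvd {i j : ℤ} (h : (S.len : ℤ) ∣ i - j) : S.dart i = S.dart j := by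
  have hp : Function.Periodic S.dart (S.len : ℤ) := S.periodic
  obtain ⟨k, hk⟩ := h
  have h1 := hp.int_mul k j
  rw [show i = j + k * S.len by linarith]
  exact_mod_cast h1

theorem dart_eq {i j : ℤ} (h : (S.dart i).1 = (S.dart j).1) : S.dart i = S.dart j :=
  S.dart_eq_of_dvd (S.inj _ _ h)

theorem dart_pred_eq {i j : ℤ} (h : (S.dart i).1 = (S.dart j).1) : S.dart (i - 1) = S.dart (j - 1) :=
  S.dart_eq_of_dvd (by rw [sub_sub_sub_cancel_right]; exact S.inj _ _ h)

theorem next' (i : ℤ) : (S.dart (i - 1)).1 + (S.dart (i - 1)).2 = (S.dart i).1 := by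
  rw [← S.next, sub_add_cancel]

/-- The position at which the cycle comes to its vertex `i`. -/
def enter (pos : List ℕ) (i : ℤ) : ℕ := position pos (M.rev (S.dart (i - 1)))

/-- The number of darts to the left at vertex `i` of the cycle. -/
def width (pos : List ℕ) (i : ℤ) : ℕ := sub18 (position pos (S.dart i)) (S.enter pos i)

/-- The position of a dart with origin at vertex `i` of the cycle, from 1 to 18, counted from the one
at which the cycle comes to this vertex. -/
def angle (pos : List ℕ) (i : ℤ) (d : ZMod 19 × Arc) : ℕ := sub18 (position pos d) (S.enter pos i)

section

variable (hM : IsCyclicTriangulation rot pos M)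
include hM

theorem rev_dart_fst (i : ℤ) : (M.rev (S.dart (i - 1))).1 = (S.dart i).1 := by
  rw [hM.rev_fst, S.next']

theorem enter_lt (i : ℤ) : S.enter pos i < 18 := hM.position_lt _

theorem eq_rev_dart_of_angle {i : ℤ} {d : ZMod 19 × Arc} (hd : d.1 = (S.dart i).1)
    (h : S.angle pos i d = 0) : d = M.rev (S.dart (i - 1)) := by
  refine hM.eq_of_position (hd.trans (S.rev_dart_fst hM i).symm) ?_
  have h1 := hM.position_lt d
  have h2 := S.enter_lt hM i
  rw [angle, sub18_eq] at h
  change _ = S.enter pos i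
  omega

theorem eq_dart_of_angle {i : ℤ} {d : ZMod 19 × Arc} (hd : d.1 = (S.dart i).1)
    (h : S.angle pos i d = S.width pos i) : d = S.dart i := by
  refine hM.eq_of_position hd ?_
  have h1 := hM.position_lt d
  have h2 := S.enter_lt hM i
  have h3 := hM.position_lt (S.dart i)
  rw [angle, width, sub18_eq, sub18_eq] at h
  omega

omit hM in
theorem dart_ne_rev_dart (i j : ℤ) : S.dart i ≠ M.rev (S.dart j) := fun h =>
  S.rev_dart_notMem j (h ▸ S.dart_mem i)

omit hM in
theorem rot_mem_iff (d : ZMod 19 × Arc) : M.rot d ∈ S.left ↔ M.rev d ∈ S.left := by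
  rw [← IsCyclicTriangulation.face_rev, S.face_mem]

/-- Around a vertex of the cycle, the darts to the left are those after the one at which the cycle
comes, up to the one along which it leaves. -/
theorem rot_pow_mem (i : ℤ) (k : ℕ) (hk : 1 ≤ k) (hk' : k ≤ 18) :
    (M.rot ^ k) (M.rev (S.dart (i - 1))) ∈ S.left ↔ k ≤ S.width pos i := by
  have hw : S.width pos i < 18 := sub18_lt _ _
  have hE := S.enter_lt hM i
  have hpos : ∀ k, S.angle pos i ((M.rot ^ k) (M.rev (S.dart (i - 1)))) = k % 18 := fun k => by
    rw [angle, (hM.rot_pow _ k).2, sub18_eq]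
    change ((S.enter pos i + k) % 18 + 18 - S.enter pos i) % 18 = _
    omega
  have horg : ∀ k, ((M.rot ^ k) (M.rev (S.dart (i - 1)))).1 = (S.dart i).1 := fun k =>
    (hM.rot_pow _ k).1.trans (S.rev_dart_fst hM i)
  have hw0 : S.width pos i ≠ 0 := fun h0 => by
    have := S.eq_rev_dart_of_angle hM (i := i) rfl h0
    exact S.dart_ne_rev_dart _ _ this
  induction k with
  | zero => omega
  | succ k ih =>
    rw [pow_succ', Equiv.Perm.mul_apply, S.rot_mem_iff]
    rcases Nat.eq_zero_or_pos k with rfl | hk0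
    · rw [pow_zero, Equiv.Perm.one_apply, M.rev_rev]
      simp only [S.dart_mem, true_iff]
      omega
    · by_cases hkw : k = S.width pos i
      · have h1 := hpos k
        rw [Nat.mod_eq_of_lt (by omega)] at h1
        rw [S.eq_dart_of_angle hM (horg k) (h1.trans hkw)]
        simp only [S.rev_dart_notMem, false_iff]
        omega
      · have h5 := ih hk0 (by omega)
        refine (S.rev_mem _ ?_ ?_).trans (h5.trans (by omega))
        · intro j hj
          have h1 : S.dart i = S.dart j := S.dart_eq (by rw [← hj, horg])
          have h2 := hpos k
          rw [hj, ← h1] at h2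
          change S.width pos i = k % 18 at h2
          omega
        · intro j hj
          have h1 : S.dart j = S.dart (i - 1) := by
            rw [show j = j + 1 - 1 by ring]
            refine S.dart_pred_eq ?_
            rw [← horg k, hj, hM.rev_fst, S.next]
          have h2 := hpos k
          rw [hj, h1] at h2
          change sub18 (S.enter pos i) (S.enter pos i) = k % 18 at h2
          rw [sub18_eq] at h2
          omega

theorem mem_left_iff {i : ℤ} {d : ZMod 19 × Arc} (hd : d.1 = (S.dart i).1) :
    d ∈ S.left ↔ 0 < S.angle pos i d ∧ S.angle pos i d ≤ S.width pos i := by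
  have h1 := hM.exists_rot_pow ((S.rev_dart_fst hM i).trans hd.symm)
  change (M.rot ^ S.angle pos i d) _ = _ at h1
  rcases Nat.eq_zero_or_pos (S.angle pos i d) with h0 | h0
  · rw [S.eq_rev_dart_of_angle hM hd h0]
    simp only [S.rev_dart_notMem, false_iff]
    rw [← S.eq_rev_dart_of_angle hM hd h0]
    omega
  · have h2 : S.angle pos i d < 18 := sub18_lt _ _
    have h3 := S.rot_pow_mem hM i _ h0 h2.le
    rw [h1] at h3
    rw [h3]
    simp [h0]

theorem angle_dartBetween {i : ℤ} {x : ZMod 19} (hx : x ≠ (S.dart i).1) :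
    S.angle pos i (dartBetween (S.dart i).1 x hx) = sub18 (nthD 0 pos (x - (S.dart i).1).val)
      (nthD 0 pos ((S.dart (i - 1)).1 - (S.dart i).1).val) := by
  have h : ((M.rev (S.dart (i - 1))).2 : ZMod 19) = (S.dart (i - 1)).1 - (S.dart i).1 := by
    rw [hM.rev_snd, ← S.next' i]; ring
  rw [angle, enter, position, position, h]
  rfl

theorem width_eq (i : ℤ) :
    S.width pos i = sub18 (nthD 0 pos ((S.dart (i + 1)).1 - (S.dart i).1).val)
      (nthD 0 pos ((S.dart (i - 1)).1 - (S.dart i).1).val) := by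
  have hne : (S.dart (i + 1)).1 ≠ (S.dart i).1 := by
    rw [S.next]; exact IsCyclicTriangulation.head_ne _
  have h : S.dart i = dartBetween (S.dart i).1 (S.dart (i + 1)).1 hne :=
    dart_ext rfl (by rw [← S.next]; exact (add_sub_cancel _ _).symm)
  rw [← S.angle_dartBetween hM hne, ← h]
  rfl

/-- A dart strictly to the left of the cycle is opposite to a dart to the left of the cycle. -/
theorem rev_mem_of_angle_lt {i : ℤ} {d : ZMod 19 × Arc} (hd : d.1 = (S.dart i).1)
    (h0 : S.angle pos i d ≠ 0) (hlt : S.angle pos i d < S.width pos i) : M.rev d ∈ S.left := by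
  have h1 : d ∈ S.left := (S.mem_left_iff hM hd).2 ⟨by omega, hlt.le⟩
  refine (S.rev_mem d ?_ ?_).2 h1
  · rintro j rfl
    have h2 := S.dart_eq hd
    rw [h2] at hlt
    exact lt_irrefl _ hlt
  · rintro j rfl
    exact S.rev_dart_notMem j h1

/-- The cycle, seen as a sequence of vertices. -/
def toLeftCut : LeftCut pos where
  len := S.len
  three_le := S.three_le
  v i := (S.dart i).1
  periodic i := by rw [S.periodic]
  inj := S.inj
  consistent i j hij h0 hlt := by
    rw [← S.angle_dartBetween hM hij.symm] at h0 hlt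
    rw [← S.width_eq hM] at hlt
    rw [← S.angle_dartBetween hM hij, ← S.width_eq hM]
    have h1 := S.rev_mem_of_angle_lt hM (i := i)
      (show (dartBetween _ _ hij.symm).1 = (S.dart i).1 from rfl) h0 hlt
    have h2 : M.rev (dartBetween (S.dart i).1 (S.dart j).1 hij.symm) =
        dartBetween (S.dart j).1 (S.dart i).1 hij := by
      refine dart_ext ?_ ?_
      · rw [hM.rev_fst]; exact add_sub_cancel _ _
      · rw [hM.rev_head]; exact (add_sub_cancel _ _).symm
    have h3 := (S.mem_left_iff hM (i := j) (by rw [h2]; rfl)).1 h1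
    rw [h2] at h3
    refine ⟨by omega, lt_of_le_of_ne h3.2 fun h4 => ?_⟩
    have h5 := S.eq_dart_of_angle hM (i := j)
      (show (dartBetween _ _ hij).1 = (S.dart j).1 from rfl) h4
    rw [h2, h5] at h1
    have h6 : M.rev (S.dart j) ∈ S.left := by
      rw [← h5, ← h2, M.rev_rev]
      exact (S.mem_left_iff hM (i := i) (show (dartBetween _ _ hij.symm).1 = (S.dart i).1 from rfl)).2 ⟨by omega, hlt.le⟩
    exact S.rev_dart_notMem j h6
  off i x hx := by
    rw [← S.width_eq hM, ← S.angle_dartBetween hM (hx i).symm]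
    by_contra hcon
    have h0 : S.angle pos i (dartBetween (S.dart i).1 x (hx i).symm) ≠ 0 := fun h0 => by
      have h1 := S.eq_rev_dart_of_angle hM (i := i)
        (show (dartBetween _ x (hx i).symm).1 = (S.dart i).1 from rfl) h0
      have h2 := congrArg (fun d => d.1 + (d.2 : ZMod 19)) h1
      rw [hM.rev_head] at h2
      exact hx (i - 1) (h2.symm.trans (add_sub_cancel _ _))
    have h1 := S.rev_mem_of_angle_lt hM (i := i)
      (show (dartBetween _ x (hx i).symm).1 = (S.dart i).1 from rfl) h0 (not_le.1 hcon)
    refine S.off _ (fun k hk => hx k ?_) h1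
    rw [hk, hM.rev_fst]
    exact add_sub_cancel _ _

theorem toLeftCut_total : (S.toLeftCut hM).total = S.left.card := by
  classical
  have h1 : ∀ d ∈ S.left, d.1 ∈ (S.toLeftCut hM).support := fun d hd => by
    by_contra hcon
    exact S.off d (fun i hi => hcon (hi ▸ (S.toLeftCut hM).mem_support i)) hd
  rw [Finset.card_eq_sum_card_fiberwise h1, LeftCut.support, Finset.sum_image, LeftCut.total]
  · refine Finset.sum_congr rfl fun k _ => ?_
    change (S.toLeftCut hM).width k = (S.left.filter fun d => d.1 = (S.dart k).1).card
    have h2 : (S.toLeftCut hM).width k = S.width pos k := (S.width_eq hM k).symm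
    rw [h2]
    have h3 : (Finset.Ioc 0 (S.width pos k)).card = S.width pos k := by simp
    conv_lhs => rw [← h3]
    symm
    refine Finset.card_bij (fun d _ => S.angle pos k d) ?_ ?_ ?_
    · intro d hd
      rw [Finset.mem_filter] at hd
      rw [Finset.mem_Ioc]
      exact (S.mem_left_iff hM hd.2).1 hd.1
    · intro d hd e he hde
      rw [Finset.mem_filter] at hd he
      refine hM.eq_of_position (hd.2.trans he.2.symm) ?_
      have := hM.position_lt d
      have := hM.position_lt e
      have := S.enter_lt hM k
      dsimp only [angle] at hde
      rw [sub18_eq, sub18_eq] at hde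
      omega
    · intro a ha
      rw [Finset.mem_Ioc] at ha
      have hw : S.width pos k < 18 := sub18_lt _ _
      have horg := (hM.rot_pow (M.rev (S.dart (k - 1))) a).1.trans (S.rev_dart_fst hM k)
      refine ⟨(M.rot ^ a) (M.rev (S.dart (k - 1))), ?_, ?_⟩
      · rw [Finset.mem_filter]
        exact ⟨(S.rot_pow_mem hM k a ha.1 (by omega)).2 ha.2, horg⟩
      · rw [angle, (hM.rot_pow _ a).2, sub18_eq]
        have := S.enter_lt hM k
        change ((S.enter pos k + a) % 18 + 18 - S.enter pos k) % 18 = _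
        omega
  · intro i hi j hj hij
    rw [Finset.coe_range, Set.mem_Iio] at hi hj
    have h3 : (i : ℤ) % S.len = (j : ℤ) % S.len :=
      Int.emod_eq_emod_iff_emod_sub_eq_zero.2 (Int.emod_eq_zero_of_dvd (S.inj _ _ hij))
    change i < S.len at hi
    change j < S.len at hj
    rw [Int.emod_eq_of_lt (by omega) (by omega), Int.emod_eq_of_lt (by omega) (by omega)] at h3
    exact_mod_cast h3

end

end LeftSide

/-! ### Counting vertices, edges and faces -/

open Equiv.Perm in
/-- The number of orbits in a finite invariant set that consists of orbits of the same length. -/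
theorem card_eq_mul_card_orbits {D : Type} [DecidableEq D] (f : Equiv.Perm D) {k : ℕ} (hk : 0 < k)
    [DecidableEq (Quotient (SameCycle.setoid f))] (s : Finset D) (hs : ∀ d ∈ s, f d ∈ s)
    (hf : ∀ d, Function.minimalPeriod f d = k) :
    s.card = k * (s.image (Quotient.mk (SameCycle.setoid f))).card := by
  rw [Finset.card_eq_sum_card_image (Quotient.mk (SameCycle.setoid f)), mul_comm, ← smul_eq_mul]
  refine Finset.sum_const_nat (m := k) fun q hq => ?_
  obtain ⟨d, hd, rfl⟩ := Finset.mem_image.1 hq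
  have h1 : s.filter (fun e => (Quotient.mk (SameCycle.setoid f) e) = Quotient.mk _ d) =
      (Finset.range k).image fun i => f^[i] d := by
    ext e
    rw [Finset.mem_filter, Finset.mem_image]
    constructor
    · rintro ⟨-, he⟩
      obtain ⟨i, hi⟩ : SameCycle f d e := (Quotient.exact he).symm
      refine ⟨(i % k).toNat, Finset.mem_range.2 ?_, ?_⟩
      · have := Int.emod_nonneg i (by omega : (k : ℤ) ≠ 0)
        have := Int.emod_lt_of_pos i (by omega : (0 : ℤ) < k)
        omega
      · have h2 : ((i % k).toNat : ℤ) = i % k :=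
          Int.toNat_of_nonneg (Int.emod_nonneg i (by omega : (k : ℤ) ≠ 0))
        have h3 : (f ^ (k : ℤ)) d = d := by
          rw [zpow_natCast, ← iterate_eq_pow, ← hf d]
          exact Function.iterate_minimalPeriod
        have h4 : (f ^ ((k : ℤ) * (i / k))) d = d := by
          rw [zpow_mul]
          exact zpow_apply_eq_self_of_apply_eq_self h3 _
        rw [iterate_eq_pow, ← zpow_natCast, h2, ← hi]
        conv_rhs => rw [← Int.emod_add_mul_ediv i k, zpow_add, Equiv.Perm.mul_apply, h4]
    · rintro ⟨i, -, rfl⟩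
      refine ⟨?_, Quotient.sound ?_⟩
      · clear hq
        induction i with
        | zero => exact hd
        | succ i ih => rw [Function.iterate_succ_apply']; exact hs _ ih
      · rw [iterate_eq_pow]
        exact (SameCycle.refl f d).pow_left
  rw [h1, Finset.card_image_of_injOn, Finset.card_range]
  intro i hi j hj hij
  rw [Finset.coe_range, Set.mem_Iio] at hi hj
  exact (Function.iterate_injOn_Iio_minimalPeriod (f := f) (x := d)) (by rw [hf]; exact hi)
    (by rw [hf]; exact hj) hij

namespace RotationSystem

theorem minimalPeriod_rev {D : Type} (M : RotationSystem D) (d : D) :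
    Function.minimalPeriod M.rev d = 2 :=
  Function.minimalPeriod_eq_prime (M.rev_rev d) (M.rev_ne d)

end RotationSystem

namespace IsCyclicTriangulation

variable {rot pos : List ℕ} {M : RotationSystem (ZMod 19 × Arc)} (hM : IsCyclicTriangulation rot pos M)
include hM

theorem minimalPeriod_face (d : ZMod 19 × Arc) : Function.minimalPeriod M.face d = 3 :=
  Function.minimalPeriod_eq_prime (hM.face_face_face d) (hM.face_ne d)

theorem origin_eq_iff (d e : ZMod 19 × Arc) : M.origin d = M.origin e ↔ d.1 = e.1 := by
  constructor
  · intro h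
    obtain ⟨i, hi⟩ : Equiv.Perm.SameCycle M.rot d e := Quotient.exact h
    rw [← hi]
    have h1 : ∀ k : ℕ, ∀ x, ((M.rot ^ k) x).1 = x.1 := fun k x => (hM.rot_pow x k).1
    obtain ⟨k, rfl | rfl⟩ := i.eq_nat_or_neg
    · rw [zpow_natCast, h1]
    · rw [zpow_neg, zpow_natCast]
      have := h1 k ((M.rot ^ k)⁻¹ d)
      rwa [← Equiv.Perm.mul_apply, mul_inv_cancel, Equiv.Perm.one_apply] at this
  · intro h
    refine Quotient.sound ?_
    rw [← hM.exists_rot_pow h]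
    exact (Equiv.Perm.SameCycle.refl M.rot d).pow_right

theorem ncard_origin_image (s : Set (ZMod 19 × Arc)) :
    (M.origin '' s).ncard = (Prod.fst '' s).ncard := by
  let f : M.Vertex → ZMod 19 := Quotient.lift Prod.fst fun d e h =>
    (hM.origin_eq_iff d e).1 (Quotient.sound h)
  have hf : Function.Injective f := by
    intro v w
    refine Quotient.inductionOn₂ v w fun d e h => ?_
    exact (hM.origin_eq_iff d e).2 h
  rw [← Set.ncard_image_of_injective _ hf, Set.image_image]
  rfl

theorem card_faces (s : Finset (ZMod 19 × Arc)) (hs : ∀ d ∈ s, M.face d ∈ s) :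
    s.card = 3 * (M.leftFace '' (s : Set (ZMod 19 × Arc))).ncard := by
  classical
  rw [card_eq_mul_card_orbits M.face (by omega) s hs hM.minimalPeriod_face, ← Set.ncard_coe_finset,
    Finset.coe_image]
  rfl

omit hM in
/-- The number of edges of a side `s` of a cycle, when `t` consists of the darts of the cycle whose
opposites are in `s`. -/
theorem card_edges (s t : Finset (ZMod 19 × Arc)) (hst : Disjoint s t) (ht : ∀ d ∈ t, M.rev d ∈ s)
    (hs : ∀ d ∈ s, M.rev d ∈ s ∨ M.rev d ∈ t) :
    s.card + t.card = 2 * (M.edge '' (s : Set (ZMod 19 × Arc))).ncard := by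
  classical
  have h1 := card_eq_mul_card_orbits M.rev (by omega) (s ∪ t) (fun d hd => by
    rcases Finset.mem_union.1 hd with h | h
    · exact Finset.mem_union.2 (hs d h)
    · exact Finset.mem_union_left _ (ht d h)) M.minimalPeriod_rev
  rw [Finset.card_union_of_disjoint hst] at h1
  rw [h1, ← Set.ncard_coe_finset, Finset.coe_image, Finset.coe_union, Set.image_union,
    Set.union_eq_self_of_subset_right]
  · rfl
  · rintro _ ⟨d, hd, rfl⟩
    refine ⟨M.rev d, ht d hd, Quotient.sound ?_⟩
    exact ⟨1, by rw [zpow_one, M.rev_rev]⟩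

end IsCyclicTriangulation

/-- The permutation that agrees with `f` on an invariant set, and fixes everything else. -/
def permOn {D : Type} [DecidableEq D] (f : Equiv.Perm D) (s : Finset D) (hs : ∀ d, f d ∈ s ↔ d ∈ s) :
    Equiv.Perm D :=
  Equiv.Perm.ofSubtype (f.subtypePerm (p := (· ∈ s)) hs)

theorem permOn_of_mem {D : Type} [DecidableEq D] {f : Equiv.Perm D} {s : Finset D}
    (hs : ∀ d, f d ∈ s ↔ d ∈ s) {d : D} (hd : d ∈ s) : permOn f s hs d = f d :=
  Equiv.Perm.ofSubtype_subtypePerm_of_mem hs hd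

theorem permOn_of_notMem {D : Type} [DecidableEq D] {f : Equiv.Perm D} {s : Finset D}
    (hs : ∀ d, f d ∈ s ↔ d ∈ s) {d : D} (hd : d ∉ s) : permOn f s hs d = d :=
  Equiv.Perm.ofSubtype_subtypePerm_of_not_mem hs hd

namespace LeftSide

variable {rot pos : List ℕ} {M : RotationSystem (ZMod 19 × Arc)} (S : LeftSide M)

/-- The darts of the cycle. -/
def darts : Finset (ZMod 19 × Arc) := (Finset.range S.len).image fun k : ℕ => S.dart k

/-- The opposites of the darts of the cycle. -/
def revDarts : Finset (ZMod 19 × Arc) := S.darts.image M.rev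

theorem dart_mem_darts (i : ℤ) : S.dart i ∈ S.darts := by
  have h3 : (0 : ℤ) < S.len := by have := S.three_le; omega
  have h4 := Int.emod_nonneg i h3.ne'
  have h5 := Int.emod_lt_of_pos i h3
  refine Finset.mem_image.2 ⟨(i % S.len).toNat, Finset.mem_range.2 (by omega), ?_⟩
  rw [Int.toNat_of_nonneg h4]
  refine S.dart_eq_of_dvd ?_
  rw [← dvd_neg, neg_sub]
  exact Int.dvd_self_sub_emod

theorem mem_darts {d : ZMod 19 × Arc} : d ∈ S.darts ↔ ∃ i, d = S.dart i := by
  constructor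
  · intro h
    obtain ⟨k, -, rfl⟩ := Finset.mem_image.1 h
    exact ⟨_, rfl⟩
  · rintro ⟨i, rfl⟩
    exact S.dart_mem_darts i

theorem mem_revDarts {d : ZMod 19 × Arc} : d ∈ S.revDarts ↔ ∃ i, d = M.rev (S.dart i) := by
  rw [revDarts, Finset.mem_image]
  constructor
  · rintro ⟨e, he, rfl⟩
    obtain ⟨i, rfl⟩ := S.mem_darts.1 he
    exact ⟨i, rfl⟩
  · rintro ⟨i, rfl⟩
    exact ⟨_, S.dart_mem_darts i, rfl⟩

theorem natCast_inj {i j : ℕ} (hi : i < S.len) (hj : j < S.len)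
    (h : (S.dart i).1 = (S.dart j).1) : i = j := by
  have h3 : (i : ℤ) % S.len = (j : ℤ) % S.len :=
    Int.emod_eq_emod_iff_emod_sub_eq_zero.2 (Int.emod_eq_zero_of_dvd (S.inj _ _ h))
  rw [Int.emod_eq_of_lt (by omega) (by omega), Int.emod_eq_of_lt (by omega) (by omega)] at h3
  exact_mod_cast h3

theorem card_darts : S.darts.card = S.len := by
  rw [darts, Finset.card_image_of_injOn, Finset.card_range]
  intro i hi j hj hij
  rw [Finset.coe_range, Set.mem_Iio] at hi hj
  exact S.natCast_inj hi hj (congrArg Prod.fst hij)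

theorem card_revDarts : S.revDarts.card = S.len := by
  rw [revDarts, Finset.card_image_of_injective _ M.rev.injective, S.card_darts]

theorem disjoint_left_revDarts : Disjoint S.left S.revDarts :=
  Finset.disjoint_left.2 fun d hd hd' => by
    obtain ⟨i, rfl⟩ := S.mem_revDarts.1 hd'
    exact S.rev_dart_notMem i hd

theorem rev_mem_or {d : ZMod 19 × Arc} (hd : d ∈ S.left) : M.rev d ∈ S.left ∨ M.rev d ∈ S.revDarts := by
  by_cases h1 : ∃ i, d = S.dart i
  · obtain ⟨i, rfl⟩ := h1
    exact Or.inr (S.mem_revDarts.2 ⟨i, rfl⟩)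
  · refine Or.inl ((S.rev_mem d (fun i hi => h1 ⟨i, hi⟩) fun i hi => ?_).2 hd)
    rw [hi] at hd
    exact S.rev_dart_notMem i hd

theorem rev_mem_left_of_mem_revDarts {d : ZMod 19 × Arc} (hd : d ∈ S.revDarts) : M.rev d ∈ S.left := by
  obtain ⟨i, rfl⟩ := S.mem_revDarts.1 hd
  rw [M.rev_rev]
  exact S.dart_mem i

theorem two_mul_card_edges :
    S.left.card + S.len = 2 * (M.edge '' (S.left : Set (ZMod 19 × Arc))).ncard := by
  rw [← S.card_revDarts]
  exact IsCyclicTriangulation.card_edges _ _ S.disjoint_left_revDarts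
    (fun d => S.rev_mem_left_of_mem_revDarts) fun d => S.rev_mem_or

/-- The darts of the edges of the left side, including the cycle. -/
def closure : Finset (ZMod 19 × Arc) := S.left ∪ S.revDarts

theorem card_closure : S.closure.card = S.left.card + S.len := by
  rw [closure, Finset.card_union_of_disjoint S.disjoint_left_revDarts, S.card_revDarts]

theorem rev_mem_closure (d : ZMod 19 × Arc) : M.rev d ∈ S.closure ↔ d ∈ S.closure := by
  have key : ∀ d ∈ S.closure, M.rev d ∈ S.closure := fun d hd => by
    rcases Finset.mem_union.1 hd with h | h
    · exact Finset.mem_union.2 (S.rev_mem_or h)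
    · exact Finset.mem_union_left _ (S.rev_mem_left_of_mem_revDarts h)
  exact ⟨fun h => M.rev_rev d ▸ key _ h, key d⟩

/-- The rotation of the map that the left side becomes when its boundary, which contains all its
vertices, is contracted to a point. -/
def boundaryRot : Equiv.Perm (ZMod 19 × Arc) :=
  permOn M.face S.left S.face_mem * permOn M.rev S.closure S.rev_mem_closure

theorem boundaryRot_of_rev_mem {d : ZMod 19 × Arc} (h : M.rev d ∈ S.left) :
    S.boundaryRot d = M.rot d := by
  have hd : d ∈ S.closure := (S.rev_mem_closure d).1 (Finset.mem_union_left _ h)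
  rw [boundaryRot, Equiv.Perm.mul_apply, permOn_of_mem _ hd, permOn_of_mem _ h,
    IsCyclicTriangulation.face_rev]

theorem boundaryRot_dart (i : ℤ) : S.boundaryRot (S.dart i) = M.rev (S.dart i) := by
  have hd : S.dart i ∈ S.closure := Finset.mem_union_left _ (S.dart_mem i)
  rw [boundaryRot, Equiv.Perm.mul_apply, permOn_of_mem _ hd, permOn_of_notMem _ (S.rev_dart_notMem i)]

theorem boundaryRot_of_notMem {d : ZMod 19 × Arc} (h : d ∉ S.closure) : S.boundaryRot d = d := by
  rw [boundaryRot, Equiv.Perm.mul_apply, permOn_of_notMem _ h,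
    permOn_of_notMem _ fun h' => h (Finset.mem_union_left _ h')]

section

variable (hM : IsCyclicTriangulation rot pos M)
include hM

theorem support_boundaryRot : S.boundaryRot.support = S.closure := by
  ext d
  rw [Equiv.Perm.mem_support]
  constructor
  · exact fun h => by_contra fun h' => h (S.boundaryRot_of_notMem h')
  · intro h h'
    by_cases h1 : M.rev d ∈ S.left
    · rw [S.boundaryRot_of_rev_mem h1] at h'
      have h2 := hM.position_rot d
      have := hM.position_lt d
      rw [h'] at h2
      omega
    · rcases Finset.mem_union.1 ((S.rev_mem_closure d).2 h) with h2 | h2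
      · exact h1 h2
      · obtain ⟨i, hi⟩ := S.mem_revDarts.1 h2
        rw [M.rev.injective hi, S.boundaryRot_dart] at h'
        exact M.rev_ne _ h'

theorem sameCycle_dart_of_mem_left {d : ZMod 19 × Arc} {i : ℤ} (hd : d ∈ S.left)
    (hi : d.1 = (S.dart i).1) : S.boundaryRot.SameCycle d (S.dart i) := by
  have key : ∀ (m : ℕ) (d : ZMod 19 × Arc), d ∈ S.left → d.1 = (S.dart i).1 →
      S.width pos i - S.angle pos i d = m → S.boundaryRot.SameCycle d (S.dart i) := by
    intro m
    induction m with
    | zero =>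
      intro d hd hi hm
      have h1 := (S.mem_left_iff hM hi).1 hd
      rw [S.eq_dart_of_angle hM hi (by omega)]
    | succ m ih =>
      intro d hd hi hm
      have h1 := (S.mem_left_iff hM hi).1 hd
      have h2 := S.boundaryRot_of_rev_mem (S.rev_mem_of_angle_lt hM hi (by omega) (by omega))
      have h3 : S.angle pos i (M.rot d) = S.angle pos i d + 1 := by
        have h4 : S.width pos i < 18 := sub18_lt _ _
        have h5 := hM.position_lt d
        have h6 := S.enter_lt hM i
        have h7 : S.angle pos i d < S.width pos i := by omega
        rw [angle, sub18_eq] at h7 ⊢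
        rw [angle, sub18_eq, hM.position_rot]
        omega
      have h4 := ih (M.rot d) ((S.mem_left_iff hM (by rw [hM.rot_fst, hi])).2 (by omega))
        (by rw [hM.rot_fst, hi]) (by omega)
      rw [← h2] at h4
      exact Equiv.Perm.sameCycle_apply_left.1 h4
  exact key _ d hd hi rfl

theorem sameCycle_dart (i : ℤ) : S.boundaryRot.SameCycle (S.dart 0) (S.dart i) := by
  have key : ∀ i, S.boundaryRot.SameCycle (S.dart (i - 1)) (S.dart i) := fun i => by
    have h1 : S.boundaryRot (M.rev (S.dart (i - 1))) = M.rot (M.rev (S.dart (i - 1))) :=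
      S.boundaryRot_of_rev_mem (by rw [M.rev_rev]; exact S.dart_mem _)
    have h2 : M.rot (M.rev (S.dart (i - 1))) ∈ S.left := by
      rw [S.rot_mem_iff, M.rev_rev]; exact S.dart_mem _
    have h3 := S.sameCycle_dart_of_mem_left hM (i := i) h2 (by rw [hM.rot_fst, S.rev_dart_fst hM])
    rw [← h1, ← S.boundaryRot_dart] at h3
    exact Equiv.Perm.sameCycle_apply_left.1 (Equiv.Perm.sameCycle_apply_left.1 h3)
  induction i using Int.induction_on with
  | zero => exact Equiv.Perm.SameCycle.refl _ _
  | succ i ih =>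
    have := key (i + 1)
    rw [add_sub_cancel_right] at this
    exact ih.trans this
  | pred i ih => exact ih.trans (key (-i)).symm

omit hM in
theorem exists_dart_fst {d : ZMod 19 × Arc} (hd : d ∈ S.left) : ∃ i, d.1 = (S.dart i).1 := by
  by_contra hcon
  push Not at hcon
  exact S.off d (fun i => (hcon i).symm) hd

/-- Every dart of the left side starts at the cycle, hence is reached along the rotation around one of
its vertices; and `boundaryRot` passes from each vertex of the cycle to the next. -/
theorem isCycle_boundaryRot : S.boundaryRot.IsCycle := by
  refine ⟨S.dart 0, ?_, fun d hd => ?_⟩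
  · rw [S.boundaryRot_dart]; exact M.rev_ne _
  · have h1 : d ∈ S.closure := by
      rw [← S.support_boundaryRot hM, Equiv.Perm.mem_support]; exact hd
    rcases Finset.mem_union.1 h1 with h | h
    · obtain ⟨i, hi⟩ := S.exists_dart_fst h
      exact (S.sameCycle_dart hM i).trans (S.sameCycle_dart_of_mem_left hM h hi).symm
    · obtain ⟨i, rfl⟩ := S.mem_revDarts.1 h
      rw [← S.boundaryRot_dart]
      exact Equiv.Perm.sameCycle_apply_right.2 (S.sameCycle_dart hM i)

/-- The parity of the number of edges of the left side: the rotation `boundaryRot` is one cycle of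
even length, hence odd, the permutation of the faces has order 3, hence is even, and the involution
has as many transpositions as there are edges. -/
theorem odd_card_edges : Odd (M.edge '' (S.left : Set (ZMod 19 × Arc))).ncard := by
  have h2E := S.two_mul_card_edges
  set E := (M.edge '' (S.left : Set (ZMod 19 × Arc))).ncard
  have h1 := (S.isCycle_boundaryRot hM).sign
  rw [S.support_boundaryRot hM, S.card_closure, h2E, pow_mul] at h1
  rw [boundaryRot, Equiv.Perm.sign_mul] at h1
  have h3 : Equiv.Perm.sign (permOn M.face S.left S.face_mem) = 1 := by
    have h4 : permOn M.face S.left S.face_mem ^ 3 = 1 := by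
      ext1 d
      by_cases hd : d ∈ S.left
      · have hd1 := (S.face_mem d).2 hd
        have hd2 := (S.face_mem _).2 hd1
        rw [pow_succ, pow_two, Equiv.Perm.mul_apply, Equiv.Perm.mul_apply, permOn_of_mem _ hd,
          permOn_of_mem _ hd1, permOn_of_mem _ hd2, hM.face_face_face]
        rfl
      · rw [pow_succ, pow_two, Equiv.Perm.mul_apply, Equiv.Perm.mul_apply, permOn_of_notMem _ hd,
          permOn_of_notMem _ hd, permOn_of_notMem _ hd]
        rfl
    have h5 := congrArg Equiv.Perm.sign h4
    rw [map_pow, map_one, pow_succ, Int.units_sq, one_mul] at h5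
    exact h5
  have h6 : Equiv.Perm.sign (permOn M.rev S.closure S.rev_mem_closure) = (-1) ^ E := by
    have h7 : permOn M.rev S.closure S.rev_mem_closure ^ 2 = 1 := by
      ext1 d
      by_cases hd : d ∈ S.closure
      · rw [pow_two, Equiv.Perm.mul_apply, permOn_of_mem _ hd,
          permOn_of_mem _ ((S.rev_mem_closure d).2 hd), M.rev_rev]
        rfl
      · rw [pow_two, Equiv.Perm.mul_apply, permOn_of_notMem _ hd, permOn_of_notMem _ hd]
        rfl
    have h8 : (permOn M.rev S.closure S.rev_mem_closure).support = S.closure := by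
      ext d
      rw [Equiv.Perm.mem_support]
      by_cases hd : d ∈ S.closure
      · rw [permOn_of_mem _ hd]
        simp only [hd, iff_true]
        exact M.rev_ne d
      · rw [permOn_of_notMem _ hd]
        simp [hd]
    have h9 : (permOn M.rev S.closure S.rev_mem_closure).support.card ≤
        Fintype.card (ZMod 19 × Arc) := Finset.card_le_univ _
    rw [Equiv.Perm.sign_of_pow_two_eq_one h7, Equiv.Perm.card_fixedPoints, Equiv.Perm.sum_cycleType,
      Nat.sub_sub_self h9, h8, S.card_closure, h2E, Nat.mul_div_cancel_left _ (by omega)]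
  rw [h3, h6, one_mul, neg_one_sq, one_pow] at h1
  rcases Nat.even_or_odd E with h | h
  · rw [h.neg_one_pow] at h1
    exact absurd h1 (by decide)
  · exact h

end

end LeftSide

/-! ### Euler characteristics of the two sides -/

namespace LeftSide

variable {rot pos : List ℕ} {M : RotationSystem (ZMod 19 × Arc)} (S : LeftSide M)
  (hM : IsCyclicTriangulation rot pos M)

/-- The Euler characteristic, with boundary, of the part of the surface to the left of the darts in
a set. -/
noncomputable def eulerCharOf (M : RotationSystem (ZMod 19 × Arc)) (s : Set (ZMod 19 × Arc)) : ℤ :=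
  ((M.origin '' s).ncard : ℤ) - (M.edge '' s).ncard + (M.leftFace '' s).ncard

include hM

theorem ncard_origin_left : (M.origin '' (S.left : Set (ZMod 19 × Arc))).ncard = S.len := by
  rw [hM.ncard_origin_image]
  have h : Prod.fst '' (S.left : Set (ZMod 19 × Arc)) = (S.toLeftCut hM).support := by
    ext x
    constructor
    · rintro ⟨d, hd, rfl⟩
      obtain ⟨i, hi⟩ := S.exists_dart_fst hd
      rw [hi]
      exact (S.toLeftCut hM).mem_support i
    · intro hx
      obtain ⟨k, -, rfl⟩ := Finset.mem_image.1 hx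
      exact ⟨S.dart k, S.dart_mem k, rfl⟩
  rw [h, Set.ncard_coe_finset, LeftCut.card_support]
  rfl

theorem three_mul_card_faces :
    S.left.card = 3 * (M.leftFace '' (S.left : Set (ZMod 19 × Arc))).ncard :=
  hM.card_faces _ fun d hd => (S.face_mem d).2 hd

omit hM in
theorem card_left_compl : S.left.card + S.leftᶜ.card = 342 := by
  rw [Finset.card_add_card_compl, Fintype.card_prod, ZMod.card]
  decide

/-- The Euler characteristics of the two sides add up to that of the surface, as a circle has Euler
characteristic 0. -/
theorem eulerChar_left_compl : eulerCharOf M (S.leftᶜ : Finset (ZMod 19 × Arc)) =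
    -38 - eulerCharOf M S.left := by
  have h1 := S.two_mul_card_edges
  have h2 := S.three_mul_card_faces hM
  have h3 := S.ncard_origin_left hM
  have h4 := S.card_left_compl
  have h5 : S.leftᶜ.card + S.len =
      2 * (M.edge '' ((S.leftᶜ : Finset (ZMod 19 × Arc)) : Set (ZMod 19 × Arc))).ncard := by
    rw [← S.card_darts]
    refine IsCyclicTriangulation.card_edges _ _ ?_ ?_ ?_
    · refine Finset.disjoint_left.2 fun d hd hd' => ?_
      obtain ⟨i, rfl⟩ := S.mem_darts.1 hd'
      exact Finset.mem_compl.1 hd (S.dart_mem i)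
    · intro d hd
      obtain ⟨i, rfl⟩ := S.mem_darts.1 hd
      exact Finset.mem_compl.2 (S.rev_dart_notMem i)
    · intro d hd
      rw [Finset.mem_compl] at hd
      by_cases h6 : ∃ i, d = M.rev (S.dart i)
      · obtain ⟨i, rfl⟩ := h6
        rw [M.rev_rev]
        exact Or.inr (S.dart_mem_darts i)
      · refine Or.inl (Finset.mem_compl.2 ((S.rev_mem d (fun i hi => ?_) fun i hi => h6 ⟨i, hi⟩).not.2 hd))
        exact hd (hi ▸ S.dart_mem i)
  have h6 := hM.card_faces S.leftᶜ fun d hd => by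
    rw [Finset.mem_compl] at hd ⊢
    rwa [S.face_mem]
  have h7 : (M.origin '' ((S.leftᶜ : Finset (ZMod 19 × Arc)) : Set (ZMod 19 × Arc))).ncard = 19 := by
    rw [hM.ncard_origin_image]
    have h8 : Prod.fst '' ((S.leftᶜ : Finset (ZMod 19 × Arc)) : Set (ZMod 19 × Arc)) = Set.univ := by
      refine Set.eq_univ_of_forall fun x => ?_
      by_cases hx : ∃ i, (S.dart i).1 = x
      · obtain ⟨i, hi⟩ := hx
        exact ⟨M.rev (S.dart (i - 1)), Finset.mem_compl.2 (S.rev_dart_notMem _),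
          (S.rev_dart_fst hM i).trans hi⟩
      · exact ⟨(x, ⟨1, by decide⟩), Finset.mem_compl.2 (S.off _ fun i hi => hx ⟨i, hi⟩), rfl⟩
    rw [h8, Set.ncard_univ, Nat.card_eq_fintype_card, ZMod.card]
  unfold eulerCharOf
  omega

/-- The genus of the left side, with the restrictions on it that the search gives. -/
theorem exists_genus {ml : List ℕ} (hml : ∀ c : LeftCut pos, excluded ml c.len c.total = false) :
    ∃ h, ((1 ≤ h ∧ h ≤ 4 ∧ nthD 0 ml h ≤ S.len) ∨ (16 ≤ h ∧ h ≤ 19 ∧ nthD 0 ml (20 - h) ≤ S.len) ∨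
      h = 0 ∨ h = 20) ∧ eulerCharOf M S.left = 1 - 2 * (h : ℤ) ∧
      eulerCharOf M (S.leftᶜ : Finset (ZMod 19 × Arc)) = 1 - 2 * ((20 - h : ℕ) : ℤ) := by
  have h1 := S.two_mul_card_edges
  have h2 := S.three_mul_card_faces hM
  have h3 := S.ncard_origin_left hM
  have h4 := S.eulerChar_left_compl hM
  obtain ⟨m, h5⟩ := S.odd_card_edges hM
  have h6 := hml (S.toLeftCut hM)
  have h7 := (S.toLeftCut hM).len_le
  have h8 := (S.toLeftCut hM).le_total hM.tables
  rw [S.toLeftCut_total hM] at h6 h8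
  change excluded ml S.len S.left.card = false at h6
  change S.len ≤ S.left.card at h8
  change S.len ≤ 19 at h7
  -- Here `k` is `h + 3`. The equation is solvable because `n` is a multiple of 3 and the number of
  -- edges, `(n + l) / 2`, is odd.
  obtain ⟨k, hk⟩ : ∃ k, S.left.card + 42 = 3 * S.len + 12 * k :=
    ⟨(S.left.card + 42 - 3 * S.len) / 12, by omega⟩
  have h9 : (S.left.card + 42 - 3 * S.len) / 12 = k := by omega
  unfold excluded at h6
  rw [h9, hk] at h6
  have h10 : Nat.beq (3 * S.len + 12 * k) (3 * S.len + 12 * k) = true := (beq_iff _ _).2 rfl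
  beta_reduce at h6
  rw [h10, Bool.true_and] at h6
  simp only [cond_eq_ite, blt_iff, ble_iff] at h6
  rw [h4]
  unfold eulerCharOf
  have h11 : (1 ≤ k - 3 ∧ k - 3 ≤ 4 ∧ nthD 0 ml (k - 3) ≤ S.len) ∨
      (16 ≤ k - 3 ∧ k - 3 ≤ 19 ∧ nthD 0 ml (20 - (k - 3)) ≤ S.len) ∨ k - 3 = 0 ∨ k - 3 = 20 := by
    split_ifs at h6 with a1 a2 a3 a4
    · rw [← Bool.not_eq_true, blt_iff] at h6
      omega
    · rw [← Bool.not_eq_true, blt_iff] at h6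
      rw [show 20 - (k - 3) = 23 - k by omega]
      omega
  have h12 : 3 ≤ k := by
    by_contra hcon
    rw [if_pos (by omega)] at h6
    exact Bool.noConfusion h6
  exact ⟨k - 3, h11, by omega, by omega⟩

end LeftSide

theorem val_finRotate {n : ℕ} (k : Fin n) : (finRotate n k : ℕ) = (k + 1) % n := by
  cases n with
  | zero => exact k.elim0
  | succ n =>
    rw [finRotate_apply, Fin.val_add, Fin.val_one', Nat.add_mod_mod]

theorem RotationSystem.edge_eq_iff {D : Type} (M : RotationSystem D) (d e : D) :
    M.edge d = M.edge e ↔ e = d ∨ e = M.rev d := by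
  constructor
  · intro h
    obtain ⟨i, hi⟩ : Equiv.Perm.SameCycle M.rev d e := Quotient.exact h
    have h2 : M.rev ^ (2 : ℤ) = 1 := by
      ext1 x
      exact M.rev_rev x
    rcases Int.even_or_odd' i with ⟨k, rfl | rfl⟩
    · rw [zpow_mul, h2, one_zpow] at hi
      exact Or.inl hi.symm
    · rw [zpow_add, zpow_mul, h2, one_zpow, one_mul, zpow_one] at hi
      exact Or.inr hi.symm
  · rintro (rfl | rfl)
    · rfl
    · exact Quotient.sound ⟨1, by rw [zpow_one]⟩

/-! ### From a cycle of the map to its two sides -/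

namespace RotationSystem.Cycle

variable {rot pos : List ℕ} {M : RotationSystem (ZMod 19 × Arc)} (γ : M.Cycle)

/-- The component to the left of a dart. -/
def componentOf (d : ZMod 19 × Arc) : γ.Component := Quotient.mk γ.cutSetoid d

theorem componentOf_face (d : ZMod 19 × Arc) : γ.componentOf (M.face d) = γ.componentOf d :=
  (Quotient.sound (s := γ.cutSetoid) (Relation.EqvGen.rel _ _ (Or.inl rfl))).symm

theorem componentOf_rev {d : ZMod 19 × Arc} (h : M.edge d ∉ γ.edges) :
    γ.componentOf (M.rev d) = γ.componentOf d :=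
  (Quotient.sound (s := γ.cutSetoid) (Relation.EqvGen.rel _ _ (Or.inr ⟨h, rfl⟩))).symm

theorem componentOf_rot (d : ZMod 19 × Arc) : γ.componentOf (M.rot d) = γ.componentOf (M.rev d) := by
  rw [← IsCyclicTriangulation.face_rev, componentOf_face]

theorem length_pos_int : (0 : ℤ) < γ.length := by have := γ.length_pos; omega

/-- The darts of a cycle, indexed by the integers. -/
def dartInt (i : ℤ) : ZMod 19 × Arc :=
  γ.dart ⟨(i % γ.length).toNat, by
    have := Int.emod_nonneg i γ.length_pos_int.ne'
    have := Int.emod_lt_of_pos i γ.length_pos_int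
    omega⟩

theorem dartInt_natCast (k : Fin γ.length) : γ.dartInt (k : ℕ) = γ.dart k := by
  unfold dartInt
  congr 1
  refine Fin.ext ?_
  change (((k : ℕ) : ℤ) % γ.length).toNat = k
  rw [Int.emod_eq_of_lt (by omega) (by have := k.2; omega)]
  rfl

theorem dartInt_eq_of_emod {i j : ℤ} (h : i % γ.length = j % γ.length) : γ.dartInt i = γ.dartInt j := by
  unfold dartInt
  simp only [h]

theorem exists_dartInt (i : ℤ) : ∃ k : Fin γ.length, γ.dartInt i = γ.dart k ∧
    (k : ℕ) = i % γ.length :=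
  ⟨_, rfl, Int.toNat_of_nonneg (Int.emod_nonneg i γ.length_pos_int.ne')⟩

theorem edge_mem_edges_iff (d : ZMod 19 × Arc) :
    M.edge d ∈ γ.edges ↔ (∃ i, d = γ.dartInt i) ∨ ∃ i, d = M.rev (γ.dartInt i) := by
  constructor
  · rintro ⟨k, hk⟩
    rcases (M.edge_eq_iff _ _).1 hk with h | h
    · exact Or.inl ⟨(k : ℕ), by rw [dartInt_natCast, h]⟩
    · exact Or.inr ⟨(k : ℕ), by rw [dartInt_natCast, h]⟩
  · rintro (⟨i, rfl⟩ | ⟨i, rfl⟩)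
    · obtain ⟨k, hk, -⟩ := γ.exists_dartInt i
      exact ⟨k, congrArg M.edge hk.symm⟩
    · obtain ⟨k, hk, -⟩ := γ.exists_dartInt i
      exact ⟨k, (M.edge_eq_iff _ _).2 (Or.inr (by rw [hk]))⟩

variable (hM : IsCyclicTriangulation rot pos M)
include hM

theorem dartInt_next (i : ℤ) : (γ.dartInt (i + 1)).1 = (γ.dartInt i).1 + (γ.dartInt i).2 := by
  obtain ⟨k, hk, hk'⟩ := γ.exists_dartInt i
  have h1 := γ.closed k
  rw [RotationSystem.target, hM.origin_eq_iff, hM.rev_fst] at h1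
  rw [hk, h1]
  have h2 : γ.dartInt (i + 1) = γ.dart (finRotate γ.length k) := by
    rw [← dartInt_natCast]
    refine γ.dartInt_eq_of_emod ?_
    rw [val_finRotate]
    push_cast
    rw [hk', Int.emod_emod_of_dvd _ (dvd_refl _), Int.emod_add_emod]
  rw [h2]

theorem dartInt_inj {i j : ℤ} (h : (γ.dartInt i).1 = (γ.dartInt j).1) : (γ.length : ℤ) ∣ i - j := by
  obtain ⟨k, hk, hk'⟩ := γ.exists_dartInt i
  obtain ⟨l, hl, hl'⟩ := γ.exists_dartInt j
  rw [hk, hl, ← hM.origin_eq_iff] at h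
  have := γ.vertex_injective h
  rw [this, hl'] at hk'
  exact Int.dvd_of_emod_eq_zero (Int.emod_eq_emod_iff_emod_sub_eq_zero.1 hk'.symm)

theorem three_le_length : 3 ≤ γ.length := by
  have h0 := γ.length_pos
  have hp : ∀ i, γ.dartInt (i + γ.length) = γ.dartInt i := fun i =>
    γ.dartInt_eq_of_emod (Int.add_emod_right _ _)
  have h1 := γ.dartInt_next hM 0
  have h2 := γ.dartInt_next hM 1
  have h3 := hp 0
  by_contra hcon
  obtain h | h : γ.length = 1 ∨ γ.length = 2 := by omega
  · rw [h] at h3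
    rw [show (0 : ℤ) + 1 = 0 + (1 : ℕ) by rfl, h3] at h1
    exact IsCyclicTriangulation.head_ne _ h1.symm
  · rw [h] at h3
    rw [show (1 : ℤ) + 1 = 0 + (2 : ℕ) by rfl, h3] at h2
    have h4 : γ.dartInt 1 = M.rev (γ.dartInt 0) := by
      refine dart_ext ?_ ?_
      · rw [hM.rev_fst, ← h1]; rfl
      · rw [hM.rev_head, h2]
    have h5 := γ.edge_injective (a₁ := ⟨0, by omega⟩) (a₂ := ⟨1, by omega⟩) (by
      dsimp only
      rw [← dartInt_natCast, ← dartInt_natCast]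
      change M.edge (γ.dartInt 0) = M.edge (γ.dartInt 1)
      rw [h4]
      exact Quotient.sound ⟨1, by rw [zpow_one]⟩)
    simp at h5

theorem fst_of_edge_mem {d : ZMod 19 × Arc} (h : M.edge d ∈ γ.edges) : ∃ i, (γ.dartInt i).1 = d.1 := by
  rcases (γ.edge_mem_edges_iff d).1 h with ⟨i, rfl⟩ | ⟨i, rfl⟩
  · exact ⟨i, rfl⟩
  · exact ⟨i + 1, by rw [γ.dartInt_next hM, hM.rev_fst]⟩

theorem dartInt_next' (i : ℤ) : (M.rev (γ.dartInt (i - 1))).1 = (γ.dartInt i).1 := by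
  rw [hM.rev_fst, ← γ.dartInt_next hM, sub_add_cancel]

theorem eq_of_edge_mem {d : ZMod 19 × Arc} {i : ℤ} (h : M.edge d ∈ γ.edges)
    (hi : d.1 = (γ.dartInt i).1) : d = M.rev (γ.dartInt (i - 1)) ∨ d = γ.dartInt i := by
  have key : ∀ i j, (γ.dartInt i).1 = (γ.dartInt j).1 → ∀ m, γ.dartInt (i + m) = γ.dartInt (j + m) :=
    fun i j hij m => γ.dartInt_eq_of_emod (Int.emod_eq_emod_iff_emod_sub_eq_zero.2
      (Int.emod_eq_zero_of_dvd (by rw [add_sub_add_right_eq_sub]; exact γ.dartInt_inj hM hij)))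
  rcases (γ.edge_mem_edges_iff d).1 h with ⟨j, rfl⟩ | ⟨j, rfl⟩
  · have := key _ _ hi 0
    rw [add_zero, add_zero] at this
    exact Or.inr this
  · have := key (j + 1) i (by rw [γ.dartInt_next hM, ← hM.rev_fst, hi]) (-1)
    rw [add_neg_cancel_right] at this
    exact Or.inl (by rw [this]; rfl)

/-- If no other dart of the cycle has the same origin as `d` and `e`, then the darts between `d` and
`e` around this vertex have the same component on the left as the opposite of `d`. -/
theorem componentOf_eq_of_between {d e f : ZMod 19 × Arc} (hdf : d.1 = f.1)
    (honly : ∀ g, M.edge g ∈ γ.edges → g.1 = d.1 → g = d ∨ g = e) (hfd : f ≠ d)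
    (hle : sub18 (position pos f) (position pos d) ≤ sub18 (position pos e) (position pos d)) :
    γ.componentOf f = γ.componentOf (M.rev d) := by
  have key : ∀ m, 1 ≤ m → m ≤ sub18 (position pos e) (position pos d) →
      γ.componentOf ((M.rot ^ m) d) = γ.componentOf (M.rev d) := by
    intro m hm hm'
    induction m with
    | zero => omega
    | succ m ih =>
      rw [pow_succ', Equiv.Perm.mul_apply, componentOf_rot]
      rcases Nat.eq_zero_or_pos m with rfl | hm0
      · rfl
      · rw [componentOf_rev, ih hm0 (by omega)]
        intro hmem
        have h1 := hM.rot_pow d m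
        have h2 := hM.position_lt d
        have h3 := hM.position_lt e
        have h4 := sub18_lt (position pos e) (position pos d)
        rw [sub18_eq] at hm' h4
        rcases honly _ hmem h1.1 with h5 | h5
        · rw [h5] at h1
          omega
        · rw [h5] at h1
          omega
  rw [← hM.exists_rot_pow hdf]
  refine key _ (Nat.one_le_iff_ne_zero.2 fun h0 => hfd ?_) hle
  have h1 := hM.exists_rot_pow hdf
  rw [h0, pow_zero] at h1
  exact h1.symm

theorem dartInt_ne_rev (i : ℤ) : γ.dartInt i ≠ M.rev (γ.dartInt (i - 1)) := fun h => by
  have h1 := γ.dartInt_next hM i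
  have h2 := hM.rev_head (γ.dartInt (i - 1))
  rw [← h, ← h1] at h2
  have h3 := γ.dartInt_inj hM h2
  rw [show i + 1 - (i - 1) = 2 by ring] at h3
  have := Int.le_of_dvd (by omega) h3
  have := γ.three_le_length hM
  omega

theorem componentOf_pred (i : ℤ) :
    γ.componentOf (γ.dartInt i) = γ.componentOf (γ.dartInt (i - 1)) ∧
      γ.componentOf (M.rev (γ.dartInt i)) = γ.componentOf (M.rev (γ.dartInt (i - 1))) := by
  have h1 := γ.dartInt_next' hM i
  have h2 := γ.dartInt_ne_rev hM i
  constructor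
  · have := γ.componentOf_eq_of_between hM h1 (fun g hg hg1 => γ.eq_of_edge_mem hM hg (hg1.trans h1))
      h2 le_rfl
    rwa [M.rev_rev] at this
  · exact (γ.componentOf_eq_of_between hM h1.symm
      (fun g hg hg1 => (γ.eq_of_edge_mem hM hg hg1).symm) h2.symm le_rfl).symm

theorem componentOf_dartInt (i : ℤ) :
    γ.componentOf (γ.dartInt i) = γ.componentOf (γ.dartInt 0) ∧
      γ.componentOf (M.rev (γ.dartInt i)) = γ.componentOf (M.rev (γ.dartInt 0)) := by
  induction i using Int.induction_on with
  | zero => exact ⟨rfl, rfl⟩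
  | succ i ih =>
    have := γ.componentOf_pred hM (i + 1)
    rw [add_sub_cancel_right] at this
    exact ⟨this.1.trans ih.1, this.2.trans ih.2⟩
  | pred i ih =>
    have := γ.componentOf_pred hM (-i)
    exact ⟨this.1.symm.trans ih.1, this.2.symm.trans ih.2⟩

theorem componentOf_on {d : ZMod 19 × Arc} {i : ℤ} (hd : d.1 = (γ.dartInt i).1) :
    γ.componentOf d = γ.componentOf (γ.dartInt 0) ∨
      γ.componentOf d = γ.componentOf (M.rev (γ.dartInt 0)) := by
  have h1 := γ.dartInt_next' hM i
  by_cases hd1 : d = γ.dartInt i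
  · rw [hd1]; exact Or.inl (γ.componentOf_dartInt hM i).1
  by_cases hd2 : d = M.rev (γ.dartInt (i - 1))
  · rw [hd2]; exact Or.inr (γ.componentOf_dartInt hM _).2
  by_cases hle : sub18 (position pos d) (position pos (M.rev (γ.dartInt (i - 1)))) ≤
      sub18 (position pos (γ.dartInt i)) (position pos (M.rev (γ.dartInt (i - 1))))
  · left
    have := γ.componentOf_eq_of_between hM (h1.trans hd.symm)
      (fun g hg hg1 => γ.eq_of_edge_mem hM hg (hg1.trans h1)) hd2 hle
    rw [M.rev_rev] at this
    exact this.trans (γ.componentOf_dartInt hM _).1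
  · right
    have := γ.componentOf_eq_of_between hM hd.symm
      (fun g hg hg1 => (γ.eq_of_edge_mem hM hg hg1).symm) hd1 (by
        have := hM.position_lt d
        have := hM.position_lt (γ.dartInt i)
        have := hM.position_lt (M.rev (γ.dartInt (i - 1)))
        have : position pos (γ.dartInt i) ≠ position pos (M.rev (γ.dartInt (i - 1))) := fun h2 =>
          γ.dartInt_ne_rev hM i (hM.eq_of_position h1.symm h2)
        rw [sub18_eq, sub18_eq] at hle ⊢
        omega)
    exact this.trans (γ.componentOf_dartInt hM _).2

theorem componentOf_off {d e : ZMod 19 × Arc} (hd : ∀ i, (γ.dartInt i).1 ≠ d.1) (hde : d.1 = e.1) :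
    γ.componentOf d = γ.componentOf e := by
  have key : ∀ m, γ.componentOf ((M.rot ^ m) d) = γ.componentOf d := by
    intro m
    induction m with
    | zero => rfl
    | succ m ih =>
      rw [pow_succ', Equiv.Perm.mul_apply, componentOf_rot, componentOf_rev, ih]
      intro hmem
      obtain ⟨i, hi⟩ := γ.fst_of_edge_mem hM hmem
      exact hd i (hi.trans (hM.rot_pow d m).1)
  rw [← hM.exists_rot_pow hde, key]

/-- All vertices that are not on the cycle are on the same side of it. -/
theorem componentOf_off_off {d e : ZMod 19 × Arc} (hd : ∀ i, (γ.dartInt i).1 ≠ d.1)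
    (he : ∀ i, (γ.dartInt i).1 ≠ e.1) : γ.componentOf d = γ.componentOf e := by
  by_cases hde : d.1 = e.1
  · exact γ.componentOf_off hM hd hde
  · have hne : e.1 ≠ d.1 := fun h => hde h.symm
    have h1 : (M.rev (dartBetween d.1 e.1 hne)).1 = e.1 := by
      rw [hM.rev_fst]; exact add_sub_cancel _ _
    have h2 : M.edge (dartBetween d.1 e.1 hne) ∉ γ.edges := fun hmem => by
      obtain ⟨i, hi⟩ := γ.fst_of_edge_mem hM hmem
      exact hd i hi
    rw [γ.componentOf_off hM hd (e := dartBetween d.1 e.1 hne) rfl, ← γ.componentOf_rev h2]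
    exact (γ.componentOf_off hM he h1.symm).symm

/-- A cycle has at most two sides. -/
theorem componentOf_eq_or (d : ZMod 19 × Arc) :
    γ.componentOf d = γ.componentOf (γ.dartInt 0) ∨
      γ.componentOf d = γ.componentOf (M.rev (γ.dartInt 0)) := by
  by_cases hd : ∃ i, d.1 = (γ.dartInt i).1
  · obtain ⟨i, hi⟩ := hd
    exact γ.componentOf_on hM hi
  · push Not at hd
    have hd' : ∀ i, (γ.dartInt i).1 ≠ d.1 := fun i => (hd i).symm
    have hne : (γ.dartInt 0).1 ≠ d.1 := hd' 0
    have h1 : (M.rev (dartBetween d.1 _ hne)).1 = (γ.dartInt 0).1 := by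
      rw [hM.rev_fst]; exact add_sub_cancel _ _
    have h2 : M.edge (dartBetween d.1 _ hne) ∉ γ.edges := fun hmem => by
      obtain ⟨i, hi⟩ := γ.fst_of_edge_mem hM hmem
      exact hd' i hi
    rw [γ.componentOf_off hM hd' (e := dartBetween d.1 _ hne) rfl, ← γ.componentOf_rev h2]
    exact γ.componentOf_on hM h1

open Classical in
/-- The left side of a cycle, when no vertex off the cycle belongs to it. -/
noncomputable def leftSide (hne : γ.componentOf (γ.dartInt 0) ≠ γ.componentOf (M.rev (γ.dartInt 0)))
    (hoff : ∀ d, (∀ i, (γ.dartInt i).1 ≠ d.1) → γ.componentOf d ≠ γ.componentOf (γ.dartInt 0)) :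
    LeftSide M where
  len := γ.length
  three_le := γ.three_le_length hM
  dart := γ.dartInt
  periodic i := γ.dartInt_eq_of_emod (Int.add_emod_right _ _)
  next := γ.dartInt_next hM
  inj _ _ h := γ.dartInt_inj hM h
  left := Finset.univ.filter fun d => γ.componentOf d = γ.componentOf (γ.dartInt 0)
  face_mem d := by
    rw [Finset.mem_filter, Finset.mem_filter, componentOf_face]
    simp
  rev_mem d h1 h2 := by
    rw [Finset.mem_filter, Finset.mem_filter, componentOf_rev]
    · simp
    · rw [γ.edge_mem_edges_iff]
      rintro (⟨i, hi⟩ | ⟨i, hi⟩)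
      · exact h1 i hi
      · exact h2 i hi
  dart_mem i := Finset.mem_filter.2 ⟨Finset.mem_univ _, (γ.componentOf_dartInt hM i).1⟩
  rev_dart_notMem i := by
    rw [Finset.mem_filter, (γ.componentOf_dartInt hM i).2]
    exact fun h => hne h.2.symm
  off d hd := by
    rw [Finset.mem_filter]
    exact fun h => hoff d hd h.2

open Classical in
/-- The right side of a cycle, as the left side of the cycle run backwards, when no vertex off the
cycle belongs to it. -/
noncomputable def rightSide (hne : γ.componentOf (γ.dartInt 0) ≠ γ.componentOf (M.rev (γ.dartInt 0)))
    (hoff : ∀ d, (∀ i, (γ.dartInt i).1 ≠ d.1) →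
      γ.componentOf d ≠ γ.componentOf (M.rev (γ.dartInt 0))) :
    LeftSide M where
  len := γ.length
  three_le := γ.three_le_length hM
  dart i := M.rev (γ.dartInt (-i))
  periodic i := by
    congr 1
    refine γ.dartInt_eq_of_emod ?_
    rw [neg_add, ← sub_eq_add_neg, Int.sub_emod_right]
  next i := by
    rw [hM.rev_head, hM.rev_fst, ← γ.dartInt_next hM]
    congr 2
    ring
  inj i j h := by
    rw [hM.rev_fst, hM.rev_fst, ← γ.dartInt_next hM, ← γ.dartInt_next hM] at h
    have := γ.dartInt_inj hM h
    rwa [add_sub_add_right_eq_sub, neg_sub_neg, ← dvd_neg, neg_sub] at this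
  left := Finset.univ.filter fun d => γ.componentOf d = γ.componentOf (M.rev (γ.dartInt 0))
  face_mem d := by
    rw [Finset.mem_filter, Finset.mem_filter, componentOf_face]
    simp
  rev_mem d h1 h2 := by
    rw [Finset.mem_filter, Finset.mem_filter, componentOf_rev]
    · simp
    · rw [γ.edge_mem_edges_iff]
      rintro (⟨i, hi⟩ | ⟨i, hi⟩)
      · exact h2 (-i) (by rw [neg_neg, M.rev_rev, hi])
      · exact h1 (-i) (by rw [neg_neg, hi])
  dart_mem i := Finset.mem_filter.2 ⟨Finset.mem_univ _, (γ.componentOf_dartInt hM _).2⟩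
  rev_dart_notMem i := by
    rw [Finset.mem_filter, M.rev_rev, (γ.componentOf_dartInt hM _).1]
    exact fun h => hne h.2
  off d hd := by
    rw [Finset.mem_filter]
    refine fun h => hoff d (fun i hi => ?_) h.2
    refine hd (-(i - 1)) ?_
    rw [neg_neg, γ.dartInt_next' hM, hi]

open Classical in
theorem mem_leftSide (hne : γ.componentOf (γ.dartInt 0) ≠ γ.componentOf (M.rev (γ.dartInt 0)))
    (hoff : ∀ d, (∀ i, (γ.dartInt i).1 ≠ d.1) → γ.componentOf d ≠ γ.componentOf (γ.dartInt 0))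
    (d : ZMod 19 × Arc) :
    d ∈ (γ.leftSide hM hne hoff).left ↔ γ.componentOf d = γ.componentOf (γ.dartInt 0) :=
  Finset.mem_filter.trans (and_iff_right (Finset.mem_univ _))

open Classical in
theorem mem_rightSide (hne : γ.componentOf (γ.dartInt 0) ≠ γ.componentOf (M.rev (γ.dartInt 0)))
    (hoff : ∀ d, (∀ i, (γ.dartInt i).1 ≠ d.1) → γ.componentOf d ≠ γ.componentOf (M.rev (γ.dartInt 0)))
    (d : ZMod 19 × Arc) :
    d ∈ (γ.rightSide hM hne hoff).left ↔ γ.componentOf d = γ.componentOf (M.rev (γ.dartInt 0)) :=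
  Finset.mem_filter.trans (and_iff_right (Finset.mem_univ _))

/-- A cycle that cuts the surface into two components has two sides, of which one contains no
further vertex. -/
theorem exists_leftSide {C₁ C₂ : γ.Component} (h : γ.CutsInto C₁ C₂) :
    ∃ (S : LeftSide M) (T T' : γ.Component), S.len = γ.length ∧ (∀ C, C = T ∨ C = T') ∧
      γ.dartsOf T = S.left ∧ γ.dartsOf T' = (S.leftᶜ : Finset (ZMod 19 × Arc)) := by
  have hall : ∀ C : γ.Component, C = γ.componentOf (γ.dartInt 0) ∨
      C = γ.componentOf (M.rev (γ.dartInt 0)) := fun C =>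
    Quotient.inductionOn C fun d => γ.componentOf_eq_or hM d
  have hne : γ.componentOf (γ.dartInt 0) ≠ γ.componentOf (M.rev (γ.dartInt 0)) := fun heq => by
    rw [← heq] at hall
    exact h.1 (((hall C₁).elim id id).trans ((hall C₂).elim id id).symm)
  by_cases hoff : ∀ d, (∀ i, (γ.dartInt i).1 ≠ d.1) → γ.componentOf d ≠ γ.componentOf (γ.dartInt 0)
  · refine ⟨γ.leftSide hM hne hoff, _, _, rfl, hall, ?_, ?_⟩
    · ext d
      exact (γ.mem_leftSide hM _ _ d).symm
    · ext d
      have h1 := γ.componentOf_eq_or hM d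
      rw [Finset.mem_coe, Finset.mem_compl, γ.mem_leftSide hM]
      constructor
      · intro h2 h3
        exact hne (h3.symm.trans h2)
      · exact fun h2 => h1.resolve_left h2
  · push Not at hoff
    obtain ⟨d, hd, hdl⟩ := hoff
    have hoff' : ∀ d, (∀ i, (γ.dartInt i).1 ≠ d.1) →
        γ.componentOf d ≠ γ.componentOf (M.rev (γ.dartInt 0)) := fun e he h2 =>
      hne (hdl.symm.trans ((γ.componentOf_off_off hM hd he).trans h2))
    refine ⟨γ.rightSide hM hne hoff', _, _, rfl, fun C => (hall C).symm, ?_, ?_⟩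
    · ext d
      exact (γ.mem_rightSide hM _ _ d).symm
    · ext d
      have h1 := γ.componentOf_eq_or hM d
      rw [Finset.mem_coe, Finset.mem_compl, γ.mem_rightSide hM]
      constructor
      · intro h2 h3
        exact hne (h2.symm.trans h3)
      · exact fun h2 => h1.resolve_right h2

/-- The genera of the two components, with the restrictions on them that the search gives. -/
theorem exists_genus {ml : List ℕ} (hml : ∀ c : LeftCut pos, excluded ml c.len c.total = false)
    {C₁ C₂ : γ.Component} (h : γ.CutsInto C₁ C₂) :
    ∃ k, k ≤ 4 ∧ nthD 0 ml k ≤ max γ.length (nthD 0 ml 0) ∧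
      ((γ.ComponentHasGenus C₁ k ∧ γ.ComponentHasGenus C₂ (20 - k)) ∨
        (γ.ComponentHasGenus C₁ (20 - k) ∧ γ.ComponentHasGenus C₂ k)) := by
  obtain ⟨S, T, T', hlen, hall, hT, hT'⟩ := γ.exists_leftSide hM h
  obtain ⟨g, hg, h1, h2⟩ := S.exists_genus hM hml
  have e1 : γ.ComponentHasGenus T g := by
    rw [ComponentHasGenus, componentEulerChar, hT]; exact h1
  have e2 : γ.ComponentHasGenus T' (20 - g) := by
    rw [ComponentHasGenus, componentEulerChar, hT']; exact h2
  rw [hlen] at hg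
  have h3 : (C₁ = T ∧ C₂ = T') ∨ (C₁ = T' ∧ C₂ = T) := by
    rcases hall C₁ with a | a <;> rcases hall C₂ with b | b
    · exact absurd (a.trans b.symm) h.1
    · exact Or.inl ⟨a, b⟩
    · exact Or.inr ⟨a, b⟩
    · exact absurd (a.trans b.symm) h.1
  have h4 : ∃ k, k ≤ 4 ∧ nthD 0 ml k ≤ max γ.length (nthD 0 ml 0) ∧
      ((k = g ∧ 20 - g = 20 - k) ∨ (20 - g = k ∧ g = 20 - k)) := by
    rcases hg with ⟨a, b, c⟩ | ⟨a, b, c⟩ | rfl | rfl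
    · exact ⟨g, b, c.trans (le_max_left _ _), Or.inl ⟨rfl, rfl⟩⟩
    · exact ⟨20 - g, by omega, c.trans (le_max_left _ _), Or.inr ⟨rfl, by omega⟩⟩
    · exact ⟨0, by omega, le_max_right _ _, Or.inl ⟨rfl, rfl⟩⟩
    · exact ⟨0, by omega, le_max_right _ _, Or.inr ⟨rfl, rfl⟩⟩
  obtain ⟨k, hk, hkl, h5⟩ := h4
  refine ⟨k, hk, hkl, ?_⟩
  rcases h3 with ⟨rfl, rfl⟩ | ⟨rfl, rfl⟩ <;> rcases h5 with ⟨a, b⟩ | ⟨a, b⟩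
  · left; rw [a, ← a, ← b]; exact ⟨a ▸ e1, e2⟩
  · right; rw [← b, ← a]; exact ⟨e1, e2⟩
  · right; rw [← b, a]; exact ⟨e2, e1⟩
  · left; rw [← b, ← a]; exact ⟨e2, e1⟩

end RotationSystem.Cycle

/-! ### Connectedness, genus and face-width -/

namespace IsCyclicTriangulation

variable {rot pos : List ℕ} {M : RotationSystem (ZMod 19 × Arc)} (hM : IsCyclicTriangulation rot pos M)
include hM

theorem rev_dartBetween {x y : ZMod 19} (h : y ≠ x) :
    M.rev (dartBetween x y h) = dartBetween y x h.symm := by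
  refine dart_ext ?_ ?_
  · rw [hM.rev_fst]; exact add_sub_cancel _ _
  · rw [hM.rev_head]; exact (add_sub_cancel _ _).symm

theorem isConnected : M.IsConnected := by
  refine ⟨⟨(0, ⟨1, by decide⟩)⟩, ⟨fun d e => ?_⟩⟩
  have hrot : M.rot ∈ Subgroup.closure ({M.rot, M.rev} : Set (Equiv.Perm (ZMod 19 × Arc))) :=
    Subgroup.subset_closure (Or.inl rfl)
  have hrev : M.rev ∈ Subgroup.closure ({M.rot, M.rev} : Set (Equiv.Perm (ZMod 19 × Arc))) :=
    Subgroup.subset_closure (Or.inr rfl)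
  by_cases h : d.1 = e.1
  · exact ⟨⟨_, pow_mem hrot _⟩, hM.exists_rot_pow h⟩
  · have hne : e.1 ≠ d.1 := fun h' => h h'.symm
    have h1 := hM.exists_rot_pow (d := d) (e := dartBetween d.1 e.1 hne) rfl
    have h2 := hM.exists_rot_pow (d := dartBetween e.1 d.1 hne.symm) (e := e) rfl
    refine ⟨⟨M.rot ^ sub18 (position pos e) (position pos (dartBetween e.1 d.1 hne.symm)) *
      (M.rev * M.rot ^ sub18 (position pos (dartBetween d.1 e.1 hne)) (position pos d)),
      mul_mem (pow_mem hrot _) (mul_mem hrev (pow_mem hrot _))⟩, ?_⟩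
    change (M.rot ^ sub18 (position pos e) (position pos (dartBetween e.1 d.1 hne.symm)) *
      (M.rev * M.rot ^ sub18 (position pos (dartBetween d.1 e.1 hne)) (position pos d))) d = e
    rw [Equiv.Perm.mul_apply, Equiv.Perm.mul_apply, h1, hM.rev_dartBetween, h2]

theorem card_vertex : Nat.card M.Vertex = 19 := by
  rw [← Set.ncard_univ]
  have h : M.origin '' Set.univ = Set.univ :=
    Set.image_univ_of_surjective Quotient.mk_surjective
  have h' : Prod.fst '' (Set.univ : Set (ZMod 19 × Arc)) = Set.univ :=
    Set.image_univ_of_surjective fun x => ⟨(x, ⟨1, by decide⟩), rfl⟩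
  rw [← h, hM.ncard_origin_image, h', Set.ncard_univ, Nat.card_eq_fintype_card, ZMod.card]

theorem target_eq_origin_iff (d e : ZMod 19 × Arc) :
    M.target d = M.origin e ↔ d.1 + (d.2 : ZMod 19) = e.1 := by
  rw [RotationSystem.target, hM.origin_eq_iff, hM.rev_fst]

theorem isTriangulation : M.IsTriangulation := by
  refine ⟨fun d h => ?_, fun d e h1 h2 => ?_, hM.minimalPeriod_face, ?_⟩
  · exact head_ne d ((hM.target_eq_origin_iff d d).1 h.symm)
  · refine dart_ext ((hM.origin_eq_iff d e).1 h1) ?_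
    rw [← hM.rev_fst e]
    exact (hM.target_eq_origin_iff d (M.rev e)).1 h2
  · rw [hM.card_vertex]; omega

theorem isCompleteOn : M.IsCompleteOn 19 := by
  refine ⟨hM.card_vertex, fun v w => Quotient.inductionOn₂ v w fun d e h => ?_⟩
  have hne : e.1 ≠ d.1 := fun h' => h ((hM.origin_eq_iff d e).2 h'.symm)
  refine ⟨dartBetween d.1 e.1 hne, (hM.origin_eq_iff _ _).2 rfl, (hM.target_eq_origin_iff _ _).2 ?_⟩
  exact add_sub_cancel _ _

theorem hasGenus : M.HasGenus 20 := by
  have hcard : (Finset.univ : Finset (ZMod 19 × Arc)).card = 342 := by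
    rw [Finset.card_univ, Fintype.card_prod, ZMod.card]
    decide
  have h1 := hM.card_faces Finset.univ fun _ _ => Finset.mem_univ _
  have h2 := card_edges (M := M) Finset.univ ∅ (Finset.disjoint_empty_right _)
    (fun d hd => absurd hd (Finset.notMem_empty d)) fun _ _ => Or.inl (Finset.mem_univ _)
  have h3 : M.leftFace '' Set.univ = Set.univ :=
    Set.image_univ_of_surjective Quotient.mk_surjective
  have h4 : M.edge '' Set.univ = Set.univ := Set.image_univ_of_surjective Quotient.mk_surjective
  rw [Finset.coe_univ, h3, Set.ncard_univ, hcard] at h1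
  rw [Finset.coe_univ, h4, Set.ncard_univ, hcard, Finset.card_empty] at h2
  unfold RotationSystem.HasGenus RotationSystem.eulerChar
  rw [hM.card_vertex]
  omega

theorem iterate_face_mod (d : ZMod 19 × Arc) (m : ℕ) : (M.face)^[m % 3] d = (M.face)^[m] d := by
  rw [← hM.minimalPeriod_face d]
  exact Function.iterate_mod_minimalPeriod_eq

theorem head_face_face (d : ZMod 19 × Arc) :
    (M.face (M.face d)).1 + ((M.face (M.face d)).2 : ZMod 19) = d.1 := by
  rw [← hM.face_fst, hM.face_face_face]

omit hM in
theorem faceWalk_succ (d : ZMod 19 × Arc) (m : ℕ) :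
    M.faceWalk d (m + 1) = M.faceWalk d m ++ [(M.face)^[m] d] := by
  simp [RotationSystem.faceWalk, List.range_succ]

theorem isWalk_append_faceWalk {w : List (ZMod 19 × Arc)} (hw : M.IsWalk w) (d : ZMod 19 × Arc)
    (h : ∀ e ∈ w.getLast?, e.1 + (e.2 : ZMod 19) = d.1) (m : ℕ) : M.IsWalk (w ++ M.faceWalk d m) := by
  induction m with
  | zero => simpa [RotationSystem.faceWalk] using hw
  | succ m ih =>
    rw [faceWalk_succ, ← List.append_assoc]
    refine List.IsChain.append ih (List.isChain_singleton _) ?_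
    intro x hx y hy
    rw [List.head?_cons, Option.mem_some_iff] at hy
    subst hy
    rw [hM.target_eq_origin_iff]
    cases m with
    | zero =>
      refine h x ?_
      simpa [RotationSystem.faceWalk] using hx
    | succ m =>
      rw [faceWalk_succ, ← List.append_assoc, List.getLast?_append, List.getLast?_singleton,
        Option.some_or, Option.mem_some_iff] at hx
      subst hx
      rw [Function.iterate_succ_apply', hM.face_fst]

theorem isWalk_faceWalk_append {d e : ZMod 19 × Arc} {m : ℕ} (h : ((M.face)^[m] d).1 = e.1) (n : ℕ) :
    M.IsWalk (M.faceWalk d m ++ M.faceWalk e n) := by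
  have h1 : M.IsWalk (M.faceWalk d m) := by
    have := hM.isWalk_append_faceWalk (w := []) List.isChain_nil d (by simp) m
    rwa [List.nil_append] at this
  refine hM.isWalk_append_faceWalk h1 e (fun x hx => ?_) n
  cases m with
  | zero => simp [RotationSystem.faceWalk] at hx
  | succ m =>
    rw [faceWalk_succ, List.getLast?_append, List.getLast?_singleton, Option.some_or,
      Option.mem_some_iff] at hx
    subst hx
    rw [← h, Function.iterate_succ_apply', hM.face_fst]

/-- Full turns around a face can be removed. -/
theorem eqvGen_move_mod {d e : ZMod 19 × Arc} {m n : ℕ} (h : ((M.face)^[m] d).1 = e.1) :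
    Relation.EqvGen M.Move (M.faceWalk d m ++ M.faceWalk e n)
      (M.faceWalk d (m % 3) ++ M.faceWalk e (n % 3)) := by
  have hfw : ∀ (d : ZMod 19 × Arc) m, M.faceWalk d (m + 3) =
      M.faceWalk d m ++ M.faceWalk ((M.face)^[m] d) (Function.minimalPeriod M.face ((M.face)^[m] d)) := by
    intro d m
    rw [hM.minimalPeriod_face, RotationSystem.faceWalk, List.range_add, List.map_append, List.map_map]
    congr 1
    refine List.map_congr_left fun i _ => ?_
    rw [Function.comp_apply, Nat.add_comm, Function.iterate_add_apply]
  have h1 : ∀ q n, Relation.EqvGen M.Move (M.faceWalk d m ++ M.faceWalk e (n + 3 * q))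
      (M.faceWalk d m ++ M.faceWalk e n) := by
    intro q n
    induction q with
    | zero => exact Relation.EqvGen.refl _
    | succ q ih =>
      refine Relation.EqvGen.trans _ _ _ (Relation.EqvGen.rel _ _ ?_) ih
      rw [show n + 3 * (q + 1) = n + 3 * q + 3 by ring, hfw]
      have hw := hM.isWalk_faceWalk_append h (n + 3 * q + 3)
      have := RotationSystem.Move.face (M := M) (M.faceWalk d m ++ M.faceWalk e (n + 3 * q)) []
        ((M.face)^[n + 3 * q] e) (by
          rw [List.append_nil, List.append_assoc, ← hfw]; exact hw)
      simpa only [List.append_nil, List.append_assoc] using this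
  have h2 : ∀ q m n, ((M.face)^[m] d).1 = e.1 → Relation.EqvGen M.Move
      (M.faceWalk d (m + 3 * q) ++ M.faceWalk e n) (M.faceWalk d m ++ M.faceWalk e n) := by
    intro q m n hm
    induction q with
    | zero => exact Relation.EqvGen.refl _
    | succ q ih =>
      refine Relation.EqvGen.trans _ _ _ (Relation.EqvGen.rel _ _ ?_) ih
      rw [show m + 3 * (q + 1) = m + 3 * q + 3 by ring, hfw]
      have h3 : ((M.face)^[m + 3 * q + 3] d).1 = e.1 := by
        rw [← hM.iterate_face_mod, show (m + 3 * q + 3) % 3 = m % 3 by omega, hM.iterate_face_mod, hm]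
      have hw := hM.isWalk_faceWalk_append h3 n
      exact RotationSystem.Move.face (M := M) (M.faceWalk d (m + 3 * q)) (M.faceWalk e n)
        ((M.face)^[m + 3 * q] d) (by rw [← hfw]; exact hw)
  have h3 := h1 (n / 3) (n % 3)
  have h4 := h2 (m / 3) (m % 3) (n % 3) (by rw [hM.iterate_face_mod, h])
  rw [Nat.mod_add_div] at h3 h4
  exact h3.trans _ _ _ h4

/-- Every closed curve that meets the graph in two vertices is contractible. -/
theorem isContractible_two {d e : ZMod 19 × Arc} {m n : ℕ} (h1 : ((M.face)^[m] d).1 = e.1)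
    (h2 : ((M.face)^[n] e).1 = d.1) : M.IsContractible (M.faceWalk d m ++ M.faceWalk e n) := by
  refine (hM.eqvGen_move_mod h1).trans _ _ _ ?_
  have hw := hM.isWalk_faceWalk_append (d := d) (e := e) (m := m % 3) (by rw [hM.iterate_face_mod, h1]) (n % 3)
  rw [← hM.iterate_face_mod] at h1 h2
  have hm : m % 3 < 3 := Nat.mod_lt _ (by decide)
  have hn : n % 3 < 3 := Nat.mod_lt _ (by decide)
  generalize m % 3 = r at *
  generalize n % 3 = s at *
  have f1 : ∀ d : ZMod 19 × Arc, (M.face d).1 ≠ d.1 := fun d => by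
    rw [hM.face_fst]; exact head_ne d
  have f2 : ∀ d : ZMod 19 × Arc, (M.face (M.face d)).1 ≠ d.1 := fun d => by
    have := head_ne (M.face (M.face d))
    rw [hM.head_face_face] at this
    exact this.symm
  have w0 : ∀ d, M.faceWalk d 0 = [] := fun d => rfl
  have w1 : ∀ d, M.faceWalk d 1 = [d] := fun d => rfl
  have w2 : ∀ d, M.faceWalk d 2 = [d, M.face d] := fun d => rfl
  have w3 : ∀ d, M.faceWalk d (Function.minimalPeriod M.face d) = [d, M.face d, M.face (M.face d)] :=
    fun d => by rw [hM.minimalPeriod_face]; rfl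
  have triangle : ∀ d, M.IsContractible [d, M.face d, M.face (M.face d)] := fun d => by
    have hw := hM.isWalk_faceWalk_append (d := d) (e := d) (m := 3) (n := 0) (by
      change (M.face (M.face (M.face d))).1 = _
      rw [hM.face_face_face])
    rw [w0, List.append_nil] at hw
    have := RotationSystem.Move.face (M := M) [] [] d (by
      rw [List.append_nil, List.nil_append, hM.minimalPeriod_face]; exact hw)
    rw [List.append_nil, List.nil_append, w3] at this
    exact Relation.EqvGen.rel _ _ this
  -- If both passages have one step, the walk is a spur; if one has two steps, it is the boundary of a
  -- triangle; if both have two steps, it bounds two triangles that share an edge.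
  obtain rfl | rfl | rfl : r = 0 ∨ r = 1 ∨ r = 2 := by omega
  · obtain rfl | rfl | rfl : s = 0 ∨ s = 1 ∨ s = 2 := by omega
    · exact Relation.EqvGen.refl _
    · exact absurd (h2.trans h1) (f1 e)
    · exact absurd (h2.trans h1) (f2 e)
  · change (M.face d).1 = e.1 at h1
    obtain rfl | rfl | rfl : s = 0 ∨ s = 1 ∨ s = 2 := by omega
    · exact absurd (h1.trans h2) (f1 d)
    · change (M.face e).1 = d.1 at h2
      rw [hM.face_fst] at h1 h2
      have h3 : e = M.rev d := dart_ext (by rw [hM.rev_fst, h1]) (by rw [hM.rev_head, h2])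
      rw [w1, w1, h3] at hw ⊢
      exact Relation.EqvGen.rel _ _ (RotationSystem.Move.spur [] [] d hw)
    · change (M.face (M.face e)).1 = d.1 at h2
      have h3 : M.face (M.face e) = d := dart_ext h2 (by
        rw [hM.head_face_face, ← h1, hM.face_fst])
      have h4 : M.face d = e := by rw [← h3, hM.face_face_face]
      rw [w1, w2, ← h4]
      exact triangle d
  · change (M.face (M.face d)).1 = e.1 at h1
    obtain rfl | rfl | rfl : s = 0 ∨ s = 1 ∨ s = 2 := by omega
    · exact absurd (h1.trans h2) (f2 d)
    · change (M.face e).1 = d.1 at h2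
      have h3 : M.face (M.face d) = e := dart_ext h1 (by
        rw [hM.head_face_face, ← h2, hM.face_fst])
      rw [w1, w2, ← h3]
      exact triangle d
    · change (M.face (M.face e)).1 = d.1 at h2
      have h3 : M.rev (M.face (M.face d)) = M.face (M.face e) := dart_ext
        (by rw [hM.rev_fst, hM.head_face_face, h2])
        (by rw [hM.rev_head, hM.head_face_face, h1])
      -- Between the two triangles, insert the common edge and its opposite.
      have hwalk : M.IsWalk ([d, M.face d] ++ [M.face (M.face d), M.rev (M.face (M.face d))] ++
          [e, M.face e]) := by
        simp only [List.cons_append, List.nil_append, RotationSystem.IsWalk, List.isChain_cons_cons,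
          List.isChain_singleton, and_true, hM.target_eq_origin_iff]
        refine ⟨(hM.face_fst d).symm, (hM.face_fst _).symm, (hM.rev_fst _).symm, ?_, (hM.face_fst e).symm⟩
        rw [hM.rev_head, h1]
      refine Relation.EqvGen.trans _ _ _ (Relation.EqvGen.symm _ _ (Relation.EqvGen.rel _ _
        (RotationSystem.Move.spur _ _ _ hwalk))) ?_
      have h4 : M.face (M.rev (M.face (M.face d))) = e := by rw [h3, hM.face_face_face]
      have h5 := triangle (M.rev (M.face (M.face d)))
      rw [h4] at h5
      refine Relation.EqvGen.trans _ _ _ (Relation.EqvGen.rel _ _ ?_) h5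
      have h6 := RotationSystem.Move.face (M := M) [] [M.rev (M.face (M.face d)), e, M.face e] d (by
        rw [w3]; exact hwalk)
      rw [w3] at h6
      exact h6

theorem faceWidthAtLeast_three : M.FaceWidthAtLeast 3 := by
  intro n hn d m h
  obtain rfl | rfl | rfl : n = 0 ∨ n = 1 ∨ n = 2 := by omega
  · exact Relation.EqvGen.refl _
  · have h0 := (hM.origin_eq_iff _ _).1 (h 0)
    have h1 := hM.isContractible_two (n := 0) h0 rfl
    have h2 : M.faceWalk (d (finRotate 1 0)) 0 = [] := rfl
    rw [h2] at h1
    exact h1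
  · have h0 := (hM.origin_eq_iff _ _).1 (h 0)
    have h1 := (hM.origin_eq_iff _ _).1 (h 1)
    have h2 := hM.isContractible_two (m := m 0) (n := m 1) h0 h1
    rw [← List.append_nil (M.faceWalk (d (finRotate 2 0)) (m 1))] at h2
    exact h2

end IsCyclicTriangulation

/-- The checks on the cyclic order that make its covering a triangulation: `h1` says that `pos` lists the
positions, and `h2` that the faces of the base map are triangles with voltages that add up to 0. -/
theorem isCyclicTriangulation_cyclicEmbedding {l : List (ZMod 19)} {h : (0 : ZMod 19) ∉ l}
    {rot pos : List ℕ} (ht : ValidTables rot pos)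
    (h1 : ∀ a : ZMod 19, a ≠ 0 →
      nthD 0 pos (l.formPerm a).val = (nthD 0 pos a.val + 1) % 18)
    (h2 : ∀ a : ZMod 19, a ≠ 0 → a + l.formPerm (-a) + l.formPerm (-l.formPerm (-a)) = 0 ∧
      l.formPerm (-l.formPerm (-l.formPerm (-a))) = a) :
    IsCyclicTriangulation rot pos (cyclicEmbedding l h) where
  tables := ht
  rev_fst _ := rfl
  rev_snd _ := rfl
  rot_fst _ := rfl
  position_rot d := h1 d.2 d.2.2
  face_face_face d := by
    refine Prod.ext ?_ (Subtype.ext (h2 d.2 d.2.2).2)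
    change d.1 + d.2 + l.formPerm (-d.2) + l.formPerm (-l.formPerm (-d.2)) = d.1
    rw [add_assoc, add_assoc, ← add_assoc (d.2 : ZMod 19), (h2 d.2 d.2.2).1, add_zero]

/-! ### Splitting cycles of types 1 to 4 -/

namespace IsCyclicTriangulation

variable {rot pos : List ℕ} {M : RotationSystem (ZMod 19 × Arc)} (hM : IsCyclicTriangulation rot pos M)
include hM

/-- The cycle through given vertices of the complete graph. -/
def cycleThrough {m : ℕ} (hm : 3 ≤ m) (c : Fin m → ZMod 19) (hc : Function.Injective c)
    (hne : ∀ i, c (finRotate m i) ≠ c i) : M.Cycle where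
  length := m
  length_pos := by omega
  dart i := dartBetween (c i) (c (finRotate m i)) (hne i)
  closed i := (hM.target_eq_origin_iff _ _).2 (add_sub_cancel _ _)
  vertex_injective i j h := hc ((hM.origin_eq_iff _ _).1 h)
  edge_injective i j h := by
    rcases (M.edge_eq_iff _ _).1 h with h | h
    · exact hc (congrArg Prod.fst h).symm
    · rw [hM.rev_dartBetween] at h
      have h1 := congrArg Fin.val (hc (congrArg Prod.fst h))
      have h2 := congrArg (fun d => d.1 + (d.2 : ZMod 19)) h
      have h3 := congrArg Fin.val (hc ((add_sub_cancel _ _).symm.trans (h2.trans (add_sub_cancel _ _))))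
      rw [val_finRotate] at h1 h3
      have := i.2
      have := j.2
      have h4 : ∀ a, a < m → (a + 1) % m = if a + 1 = m then 0 else a + 1 := fun a ha => by
        split_ifs with h
        · rw [h, Nat.mod_self]
        · exact Nat.mod_eq_of_lt (by omega)
      rw [h4 _ i.2] at h1
      rw [h4 _ j.2] at h3
      split_ifs at h1 h3 <;> omega

/-- If a set of darts, given by the Boolean values `f x a` for the darts from `x` to `x + a`, contains
a cycle but not its opposite, is invariant under moving along faces and
under crossing the other edges, and contains no dart starting off the cycle, then the cycle is
separating, this set is its left side, and its type can be read off from the number of these darts. -/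
theorem exists_isSplittingOfType {m k : ℕ} (c : Fin m → ZMod 19) (f : ZMod 19 → ZMod 19 → Bool)
    (h : (3 ≤ m ∧ 1 ≤ k ∧ k ≤ 4) ∧ Function.Injective c ∧
      (∀ d, f (M.face d).1 (M.face d).2 = f d.1 d.2) ∧
      (∀ d : ZMod 19 × Arc, f (d.1 + d.2) (-d.2) = f d.1 d.2 ∨
        (∃ i, c i = d.1 ∧ c (finRotate m i) = d.1 + d.2) ∨
        ∃ i, c i = d.1 + d.2 ∧ c (finRotate m i) = d.1) ∧
      (∀ i, f (c i) (c (finRotate m i) - c i) = true ∧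
        f (c (finRotate m i)) (c i - c (finRotate m i)) = false) ∧
      (∀ x, (∃ i, c i = x) ∨ ∀ a, f x a = false) ∧
      (Finset.univ.filter fun d : ZMod 19 × Arc => f d.1 d.2 = true).card + 6 = 3 * m + 12 * k) :
    ∃ γ : M.Cycle, γ.IsSplittingOfType k ∧ γ.length = m := by
  obtain ⟨⟨hm, hk, hk'⟩, hc, hface, hrev, hleft, hoff, hn⟩ := h
  have hne : ∀ i, c (finRotate m i) ≠ c i := fun i h => by
    have := congrArg Fin.val (hc h)
    rw [val_finRotate] at this
    have h1 := i.2
    rcases Nat.lt_or_ge (i + 1) m with h2 | h2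
    · rw [Nat.mod_eq_of_lt h2] at this; omega
    · rw [show (i : ℕ) + 1 = m by omega, Nat.mod_self] at this; omega
  let γ : M.Cycle := hM.cycleThrough hm c hc hne
  have hdart : ∀ i, γ.dart i = dartBetween (c i) (c (finRotate m i)) (hne i) := fun i => rfl
  have hon : ∀ i, ∃ j, c j = (γ.dartInt i).1 ∧ c (finRotate m j) = (γ.dartInt i).1 + (γ.dartInt i).2 :=
    fun i => by
      obtain ⟨j, hj, -⟩ := γ.exists_dartInt i
      rw [hj, hdart]
      exact ⟨j, rfl, (add_sub_cancel _ _).symm⟩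
  have hedge : ∀ d, (∃ i, c i = d.1 ∧ c (finRotate m i) = d.1 + d.2) → M.edge d ∈ γ.edges := by
    rintro d ⟨i, h1, h2⟩
    exact ⟨i, congrArg M.edge (dart_ext h1 ((add_sub_cancel _ _).trans h2))⟩
  -- The set is a union of components of the complement of the cycle.
  have hlift : ∀ d e, γ.componentOf d = γ.componentOf e → f d.1 d.2 = f e.1 e.2 := by
    intro d e h
    have h1 : Relation.EqvGen _ d e := Quotient.exact h
    clear h
    induction h1 with
    | rel d e h =>
      rcases h with rfl | ⟨h, rfl⟩
      · exact (hface d).symm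
      · rw [hM.rev_fst, hM.rev_snd]
        rcases hrev d with h1 | h1 | ⟨i, h1, h2⟩
        · exact h1.symm
        · exact absurd (hedge d h1) h
        · have h3 := hedge (M.rev d) ⟨i, by rw [hM.rev_fst, h1], by rw [hM.rev_head, h2]⟩
          refine absurd ?_ h
          rwa [show M.edge d = M.edge (M.rev d) from Quotient.sound ⟨1, by rw [zpow_one]⟩]
    | refl => rfl
    | symm d e _ ih => exact ih.symm
    | trans d e g _ _ ih1 ih2 => exact ih1.trans ih2
  have h0 : f (γ.dartInt 0).1 (γ.dartInt 0).2 = true := by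
    obtain ⟨i, h1, h2⟩ := hon 0
    have h3 := (hleft i).1
    rwa [h2, h1, add_sub_cancel_left] at h3
  have h0' : f (M.rev (γ.dartInt 0)).1 (M.rev (γ.dartInt 0)).2 = false := by
    obtain ⟨i, h1, h2⟩ := hon 0
    have h3 := (hleft i).2
    rwa [h2, h1, sub_add_cancel_left, ← hM.rev_fst, ← hM.rev_snd] at h3
  have hne : γ.componentOf (γ.dartInt 0) ≠ γ.componentOf (M.rev (γ.dartInt 0)) := fun h => by
    have := hlift _ _ h
    rw [h0, h0'] at this
    exact Bool.noConfusion this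
  have hoff' : ∀ d, (∀ i, (γ.dartInt i).1 ≠ d.1) → γ.componentOf d ≠ γ.componentOf (γ.dartInt 0) := by
    intro d hd h
    have h1 := (hlift _ _ h).trans h0
    obtain ⟨i, hi⟩ := (hoff d.1).resolve_right fun h2 => by
      rw [h2] at h1
      exact Bool.noConfusion h1
    refine hd (i : ℕ) ?_
    have h1 : γ.dartInt ((i : ℕ) : ℤ) = γ.dart i := γ.dartInt_natCast i
    rw [h1]
    exact hi
  have hmem : ∀ d, γ.componentOf d = γ.componentOf (γ.dartInt 0) ↔ f d.1 d.2 = true := fun d => by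
    refine ⟨fun h => (hlift _ _ h).trans h0, fun h => (γ.componentOf_eq_or hM d).resolve_right fun h1 => ?_⟩
    have := hlift _ _ h1
    rw [h, h0'] at this
    exact Bool.noConfusion this
  let S := γ.leftSide hM hne hoff'
  have hS : S.left = Finset.univ.filter fun d => f d.1 d.2 = true := by
    ext d
    rw [γ.mem_leftSide hM, hmem, Finset.mem_filter]
    simp
  have hT : γ.dartsOf (γ.componentOf (γ.dartInt 0)) = S.left := by
    ext d
    exact (γ.mem_leftSide hM hne hoff' d).symm
  have hT' : γ.dartsOf (γ.componentOf (M.rev (γ.dartInt 0))) =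
      (S.leftᶜ : Finset (ZMod 19 × Arc)) := by
    ext d
    rw [Finset.mem_coe, Finset.mem_compl, γ.mem_leftSide hM]
    exact ⟨fun h2 h3 => hne (h3.symm.trans h2), fun h2 => (γ.componentOf_eq_or hM d).resolve_left h2⟩
  have h1 := S.two_mul_card_edges
  have h2 := S.three_mul_card_faces hM
  have h3 := S.ncard_origin_left hM
  have h4 := S.eulerChar_left_compl hM
  rw [← hS] at hn
  have hlen : S.len = m := rfl
  unfold LeftSide.eulerCharOf at h4
  have hg : γ.componentEulerChar (γ.componentOf (γ.dartInt 0)) = 1 - 2 * (k : ℤ) := by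
    unfold RotationSystem.Cycle.componentEulerChar
    rw [hT]
    omega
  have hg' : γ.componentEulerChar (γ.componentOf (M.rev (γ.dartInt 0))) =
      1 - 2 * ((20 - k : ℕ) : ℤ) := by
    unfold RotationSystem.Cycle.componentEulerChar at hg ⊢
    rw [hT] at hg
    rw [hT']
    omega
  have hcuts : γ.CutsInto (γ.componentOf (γ.dartInt 0)) (γ.componentOf (M.rev (γ.dartInt 0))) :=
    ⟨hne, fun C => Quotient.inductionOn C fun d => γ.componentOf_eq_or hM d⟩
  refine ⟨γ, ⟨⟨_, _, hcuts, ?_, ?_⟩, 20, _, _, hM.hasGenus, by omega, hcuts, hg, hg'⟩, rfl⟩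
  · unfold RotationSystem.Cycle.ComponentHasGenus
    omega
  · unfold RotationSystem.Cycle.ComponentHasGenus
    omega

end IsCyclicTriangulation

/-- Whether the dart from `x` to `x + a` is to the left of the walk through the vertices in a list:
this is so if it lies, around the vertex `x` of the walk, after the dart at which the walk comes, and
not after the one along which it leaves. The first and the last vertex of the list are not taken into
account. -/
def isLeftOf (pos : List ℕ) : List ℕ → ZMod 19 → ZMod 19 → Bool
  | u :: v :: w :: t, x, a =>
    cond (Nat.beq v x.val)
      (let e := nthD 0 pos ((u + 19 - v) % 19)
       let s := sub18 (nthD 0 pos a.val) e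
       Nat.blt 0 s && Nat.ble s (sub18 (nthD 0 pos ((w + 19 - v) % 19)) e))
      (isLeftOf pos (v :: w :: t) x a)
  | _, _, _ => false

theorem isCyclicTriangulationA : IsCyclicTriangulation rotA posA embeddingA :=
  isCyclicTriangulation_cyclicEmbedding validTablesA (by decide +kernel) (by decide +kernel)

theorem isCyclicTriangulationB : IsCyclicTriangulation rotB posB embeddingB :=
  isCyclicTriangulation_cyclicEmbedding validTablesB (by decide +kernel) (by decide +kernel)

theorem isCyclicTriangulationC : IsCyclicTriangulation rotC posC embeddingC :=
  isCyclicTriangulation_cyclicEmbedding validTablesC (by decide +kernel) (by decide +kernel)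

/-- Cycles of the four types with the least possible length in embedding A. -/
theorem exists_isSplittingOfTypeA {k : ℕ} (h1 : 1 ≤ k) (h4 : k ≤ 4) :
    ∃ γ : embeddingA.Cycle, γ.IsSplittingOfType k ∧ γ.length = nthD 0 minLengthsA k := by
  have key := fun l : List ℕ =>
    isCyclicTriangulationA.exists_isSplittingOfType (k := k) (fun i => (l.get i : ZMod 19))
      (isLeftOf posA (l.getLast! :: l ++ l.take 1))
  obtain rfl | rfl | rfl | rfl : k = 1 ∨ k = 2 ∨ k = 3 ∨ k = 4 := by omega
  · exact key [0, 1, 12, 17, 14, 3, 10, 9, 2, 5, 15]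
      (by decide +kernel)
  · exact key [0, 1, 18, 10, 9, 2, 5, 15, 12, 17, 14, 3, 13, 7]
      (by decide +kernel)
  · exact key [0, 2, 17, 5, 9, 18, 7, 3, 10, 14, 4, 12, 8, 6, 1, 15]
      (by decide +kernel)
  · exact key [0, 2, 17, 13, 11, 6, 1, 5, 9, 18, 7, 3, 10, 14, 4, 12, 8, 15]
      (by decide +kernel)

/-- Cycles of the four types with the least possible length in embedding B. -/
theorem exists_isSplittingOfTypeB {k : ℕ} (h1 : 1 ≤ k) (h4 : k ≤ 4) :
    ∃ γ : embeddingB.Cycle, γ.IsSplittingOfType k ∧ γ.length = nthD 0 minLengthsB k := by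
  have key := fun l : List ℕ =>
    isCyclicTriangulationB.exists_isSplittingOfType (k := k) (fun i => (l.get i : ZMod 19))
      (isLeftOf posB (l.getLast! :: l ++ l.take 1))
  obtain rfl | rfl | rfl | rfl : k = 1 ∨ k = 2 ∨ k = 3 ∨ k = 4 := by omega
  · exact key [0, 1, 9, 2, 13, 7, 4, 15, 3, 5]
      (by decide +kernel)
  · exact key [0, 1, 9, 4, 15, 3, 7, 2, 5, 13, 6, 17, 11, 8]
      (by decide +kernel)
  · exact key [0, 1, 14, 11, 4, 15, 3, 10, 9, 2, 13, 18, 8, 16, 12, 7, 17, 5]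
      (by decide +kernel)
  · exact key [0, 1, 14, 11, 4, 15, 3, 10, 12, 7, 2, 13, 18, 8, 16, 9, 6, 17, 5]
      (by decide +kernel)

/-- Cycles of the four types with the least possible length in embedding C. -/
theorem exists_isSplittingOfTypeC {k : ℕ} (h1 : 1 ≤ k) (h4 : k ≤ 4) :
    ∃ γ : embeddingC.Cycle, γ.IsSplittingOfType k ∧ γ.length = nthD 0 minLengthsC k := by
  have key := fun l : List ℕ =>
    isCyclicTriangulationC.exists_isSplittingOfType (k := k) (fun i => (l.get i : ZMod 19))
      (isLeftOf posC (l.getLast! :: l ++ l.take 1))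
  obtain rfl | rfl | rfl | rfl : k = 1 ∨ k = 2 ∨ k = 3 ∨ k = 4 := by omega
  · exact key [0, 1, 3, 2, 16, 6, 4, 10, 14, 7, 12]
      (by decide +kernel)
  · exact key [0, 1, 3, 6, 4, 10, 14, 7, 12, 2, 16, 18, 17, 15, 11]
      (by decide +kernel)
  · exact key [0, 1, 3, 8, 15, 10, 14, 7, 12, 11, 9, 5, 13, 4, 16, 6, 2]
      (by decide +kernel)
  · exact key [0, 1, 3, 8, 15, 10, 18, 9, 5, 13, 4, 14, 7, 12, 11, 16, 6, 2]
      (by decide +kernel)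

/-! ### The types of splitting cycles -/

namespace IsCyclicTriangulation

variable {rot pos : List ℕ} {M : RotationSystem (ZMod 19 × Arc)} (hM : IsCyclicTriangulation rot pos M)
  {ml : List ℕ} (hml : ∀ c : LeftCut pos, excluded ml c.len c.total = false) (h0 : nthD 0 ml 0 = 0)
include hM hml

theorem exists_isSplittingOfType_of_isSplitting {γ : M.Cycle} (h : γ.IsSplitting) :
    ∃ k, 1 ≤ k ∧ k ≤ 4 ∧ γ.IsSplittingOfType k := by
  obtain ⟨C₁, C₂, hcuts, h1, h2⟩ := id h
  obtain ⟨k, hk, -, hgen⟩ := γ.exists_genus hM hml hcuts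
  refine ⟨k, Nat.one_le_iff_ne_zero.2 ?_, hk, h, ?_⟩
  · rintro rfl
    exact hgen.elim (fun h => h1 h.1) fun h => h2 h.2
  · rcases hgen with ⟨a, b⟩ | ⟨a, b⟩
    · exact ⟨20, C₁, C₂, hM.hasGenus, by omega, hcuts, a, b⟩
    · exact ⟨20, C₂, C₁, hM.hasGenus, by omega, ⟨hcuts.1.symm, fun C => (hcuts.2 C).symm⟩, b, a⟩

include h0

/-- The genera of the two components determine the type up to exchanging `k` and `20 - k`, so a type
`k ≤ 10` is the one that the search restricts. -/
theorem le_of_isSplittingOfType {γ : M.Cycle} {k : ℕ} (hk : k ≤ 10) (h : γ.IsSplittingOfType k) :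
    k ≤ 4 ∧ nthD 0 ml k ≤ γ.length := by
  obtain ⟨-, g, C₁, C₂, hg, -, hcuts, h1, h2⟩ := h
  obtain ⟨j, hj, hlen, hgen⟩ := γ.exists_genus hM hml hcuts
  rw [h0, max_eq_left (Nat.zero_le _)] at hlen
  have hjk : j = k := by
    unfold RotationSystem.Cycle.ComponentHasGenus at h1 hgen
    omega
  exact hjk ▸ ⟨hj, hlen⟩

theorem isLeast_length {k n : ℕ} (hk : k ≤ 4) (hn : nthD 0 ml k = n)
    (hex : ∃ γ : M.Cycle, γ.IsSplittingOfType k ∧ γ.length = nthD 0 ml k) :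
    IsLeast {n | ∃ γ : M.Cycle, γ.IsSplittingOfType k ∧ γ.length = n} n := by
  rw [← hn]
  refine ⟨hex, ?_⟩
  rintro n ⟨γ, hγ, rfl⟩
  exact (hM.le_of_isSplittingOfType hml h0 (by omega) hγ).2

theorem splitting_types
    (hex : ∀ k, 1 ≤ k → k ≤ 4 → ∃ γ : M.Cycle, γ.IsSplittingOfType k ∧ γ.length = nthD 0 ml k) :
    M.IsConnected ∧ M.IsTriangulation ∧ M.IsCompleteOn 19 ∧ M.HasGenus 20 ∧
      (∀ γ : M.Cycle, γ.IsSplitting → ∃ k, 1 ≤ k ∧ k ≤ 4 ∧ γ.IsSplittingOfType k) ∧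
      (∀ k, 1 ≤ k → k ≤ 4 → ∃ γ : M.Cycle, γ.IsSplittingOfType k) ∧
      (∀ k, 5 ≤ k → k ≤ 10 → ¬ ∃ γ : M.Cycle, γ.IsSplittingOfType k) := by
  refine ⟨hM.isConnected, hM.isTriangulation, hM.isCompleteOn, hM.hasGenus,
    fun γ => hM.exists_isSplittingOfType_of_isSplitting hml,
    fun k h1 h4 => (hex k h1 h4).imp fun γ h => h.1, ?_⟩
  rintro k h5 h10 ⟨γ, hγ⟩
  have := (hM.le_of_isSplittingOfType hml h0 h10 hγ).1
  omega

end IsCyclicTriangulation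

theorem mainTheorem1 :
    (∀ M : RotationSystem (ZMod 19 × Arc), M = embeddingA ∨ M = embeddingB ∨ M = embeddingC →
      M.IsConnected ∧ M.IsTriangulation ∧ M.IsCompleteOn 19 ∧ M.HasGenus 20 ∧
      (∀ γ : M.Cycle, γ.IsSplitting → ∃ k, 1 ≤ k ∧ k ≤ 4 ∧ γ.IsSplittingOfType k) ∧
      (∀ k, 1 ≤ k → k ≤ 4 → ∃ γ : M.Cycle, γ.IsSplittingOfType k) ∧
      (∀ k, 5 ≤ k → k ≤ 10 → ¬ ∃ γ : M.Cycle, γ.IsSplittingOfType k)) ∧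
    (∀ p ∈ [(embeddingA, 1, 11), (embeddingA, 2, 14), (embeddingA, 3, 16), (embeddingA, 4, 18),
        (embeddingB, 1, 10), (embeddingB, 2, 14), (embeddingB, 3, 18), (embeddingB, 4, 19),
        (embeddingC, 1, 11), (embeddingC, 2, 15), (embeddingC, 3, 17), (embeddingC, 4, 18)],
      IsLeast {n | ∃ γ : p.1.Cycle, γ.IsSplittingOfType p.2.1 ∧ γ.length = n} p.2.2) ∧
    ¬ MoharThomassenConjecture ∧ ¬ ZhaZhaoConjecture := by
  have typesA := isCyclicTriangulationA.splitting_types excluded_eq_falseA rfl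
    fun _ => exists_isSplittingOfTypeA
  refine ⟨?_, ?_, fun h => ?_, fun h => ?_⟩
  · rintro M (rfl | rfl | rfl)
    · exact typesA
    · exact isCyclicTriangulationB.splitting_types excluded_eq_falseB rfl
        fun _ => exists_isSplittingOfTypeB
    · exact isCyclicTriangulationC.splitting_types excluded_eq_falseC rfl
        fun _ => exists_isSplittingOfTypeC
  · intro p hp
    simp only [List.mem_cons, List.not_mem_nil, or_false] at hp
    rcases hp with rfl | rfl | rfl | rfl | rfl | rfl | rfl | rfl | rfl | rfl | rfl | rfl
    iterate 4
      · exact isCyclicTriangulationA.isLeast_length excluded_eq_falseA rfl (by decide) rfl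
          (exists_isSplittingOfTypeA (by decide) (by decide))
    iterate 4
      · exact isCyclicTriangulationB.isLeast_length excluded_eq_falseB rfl (by decide) rfl
          (exists_isSplittingOfTypeB (by decide) (by decide))
    iterate 4
      · exact isCyclicTriangulationC.isLeast_length excluded_eq_falseC rfl (by decide) rfl
          (exists_isSplittingOfTypeC (by decide) (by decide))
  · exact typesA.2.2.2.2.2.2 5 le_rfl (by decide) (h _ embeddingA typesA.1 typesA.2.1 20 (by decide)
      typesA.2.2.2.1 5 (by decide) (by decide))
  · exact typesA.2.2.2.2.2.2 5 le_rfl (by decide) (h _ embeddingA typesA.1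
      isCyclicTriangulationA.faceWidthAtLeast_three 20 (by decide) typesA.2.2.2.1 5 (by decide)
      (by decide))
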